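/- Let $R=\mathbb{Z}[a^{\pm1},b^{\pm1},c^{\pm1}]$, and let $B_n$ be the braid group on $n$ strands with Artin generators $s_1,\dots,s_{n-1}$. Let $\mathrm{Q}_n$ be the quotient of the group algebra $RB_n$ by the cubic relations $(s_i-a)(s_i-b)(s_i-c)=0$ for $1\le i\le n-1$ and, if $n\ge 3$, the relation $$\begin{array}{rcl} s_1^{-1}s_2s_1 &=& s_1s_2s_1^{-1}-a^{-1}s_1s_2+a\,s_1s_2^{-1}+a\,s_1^{-1}s_2-a^3s_1^{-1}s_2^{-1}+a^{-1}s_2s_1-a\,s_2s_1^{-1}\\ && {}-a\,s_2^{-1}s_1+a^3s_2^{-1}s_1^{-1}+a^2s_1^{-1}s_2^{-1}s_1-a^2s_1s_2^{-1}s_1^{-1}.\end{array}$$ Via the natural morphism $\mathrm{Q}_4\to\mathrm{Q}_5$, $s_i\mapsto s_i$, the algebra $\mathrm{Q}_5$ is a $\mathrm{Q}_4$-bimodule. Let $u_4\subset\mathrm{Q}_5$ be the $R$-subalgebra generated by $s_4$; let $\mathrm{Q}_5^{(0)}$ be the image of $\mathrm{Q}_4$ in $\mathrm{Q}_5$ and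 $\mathrm{Q}_5^{(k+1)}=\mathrm{Q}_5^{(k)}u_4\mathrm{Q}_4$ (the $R$-span of the products), so that $\mathrm{Q}_5^{(k)}=\mathrm{Q}_4u_4\mathrm{Q}_4\cdots u_4\mathrm{Q}_4$ with $k$ factors $u_4$. Let $\varepsilon:\mathrm{Q}_4\to R$ be the $R$-algebra morphism with $s_i\mapsto a$. Write $i$ and $\bar i$ for $s_i$ and $s_i^{-1}$, and put $x=3\bar23$, $y=1\bar21$, $w_+=32\bar123$, $w_-=\bar3\bar21\bar2\bar3$. Proposition. 1. $\mathrm{Q}_5^{(3)}=\mathrm{Q}_5^{(2)}+R\cdot 4xy4x4$. 2. $\mathrm{Q}_5^{(3)}=\mathrm{Q}_5^{(2)}+R\cdot 4w_-4w_-4=\mathrm{Q}_5^{(2)}+R\cdot\bar4w_+\bar4w_+\bar4$. 3. For every $t\in\{4xy4x4,\ 4w_-4w_-4,\ \bar4w_+\bar4w_+\bar4\}$ and every $\lambda\in\mathrm{Q}_4$, $\lambda t\equiv t\lambda\equiv\varepsilon(\lambda)\,t \mod \mathrm{Q}_5^{(2)}$. -/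

import Mathlib

noncomputable section

namespace CubicQuotient

/-! ### The ring of coefficients -/

/-- `R = ℤ[a^{±1}, b^{±1}, c^{±1}]`, the Laurent polynomials over `ℤ` in three variables
(finitely supported functions on the lattice of exponents, with convolution product). -/
abbrev R : Type := AddMonoidAlgebra ℤ (Fin 3 →₀ ℤ)

/-- The `i`-th variable, as a unit of `R`. -/
def var (i : Fin 3) : Rˣ :=
  Units.map (AddMonoidAlgebra.of ℤ (Fin 3 →₀ ℤ))
    (toUnits (Multiplicative.ofAdd (Finsupp.single i (1 : ℤ))))

theorem var_val (i : Fin 3) :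
    ((var i : Rˣ) : R) = AddMonoidAlgebra.single (Finsupp.single i (1 : ℤ)) 1 := rfl

theorem var_inv_val (i : Fin 3) :
    (((var i)⁻¹ : Rˣ) : R) = AddMonoidAlgebra.single (-Finsupp.single i (1 : ℤ)) 1 := rfl

/-! ### The braid groups -/

/-- The indices `1, …, n - 1` of the Artin generators of the braid group on `n` strands. -/
abbrev Index (n : ℕ) : Type := {i : ℕ // 1 ≤ i ∧ i < n}

/-- The Artin relations `s_i s_j = s_j s_i` for `|i - j| ≥ 2` and
`s_i s_{i+1} s_i = s_{i+1} s_i s_{i+1}`, written as relators. -/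
inductive ArtinRel (n : ℕ) : FreeGroup (Index n) → Prop
  | comm (i j : Index n) (h : i.1 + 1 < j.1) :
      ArtinRel n (FreeGroup.of i * FreeGroup.of j * (FreeGroup.of j * FreeGroup.of i)⁻¹)
  | braid (i j : Index n) (h : i.1 + 1 = j.1) :
      ArtinRel n (FreeGroup.of i * FreeGroup.of j * FreeGroup.of i *
        (FreeGroup.of j * FreeGroup.of i * FreeGroup.of j)⁻¹)

/-- The braid group `B_n` on `n` strands. -/
abbrev Braid (n : ℕ) : Type := PresentedGroup {r | ArtinRel n r}

/-- The Artin generator `s_i` of `B_n`. -/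
def sigma (n i : ℕ) (h : 1 ≤ i ∧ i < n := by omega) : Braid n :=
  PresentedGroup.of ⟨i, h⟩

theorem sigma_comm (n : ℕ) (i j : Index n) (h : i.1 + 1 < j.1) :
    sigma n i i.2 * sigma n j j.2 = sigma n j j.2 * sigma n i i.2 :=
  mul_inv_eq_one.1 ((QuotientGroup.eq_one_iff _).2
    (Subgroup.subset_normalClosure (ArtinRel.comm i j h)))

theorem sigma_braid (n : ℕ) (i j : Index n) (h : i.1 + 1 = j.1) :
    sigma n i i.2 * sigma n j j.2 * sigma n i i.2 =
      sigma n j j.2 * sigma n i i.2 * sigma n j j.2 :=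
  mul_inv_eq_one.1 ((QuotientGroup.eq_one_iff _).2
    (Subgroup.subset_normalClosure (ArtinRel.braid i j h)))

/-- The morphism `B_n → G` determined by the images of the Artin generators. -/
def braidLift {n : ℕ} {G : Type*} [Group G] (f : Index n → G)
    (hc : ∀ i j : Index n, i.1 + 1 < j.1 → f i * f j = f j * f i)
    (hb : ∀ i j : Index n, i.1 + 1 = j.1 → f i * f j * f i = f j * f i * f j) :
    Braid n →* G :=
  PresentedGroup.toGroup (f := f) (by
    rintro r (⟨i, j, h⟩ | ⟨i, j, h⟩)
    · simp only [map_mul, map_inv, FreeGroup.lift_apply_of, hc i j h, mul_inv_cancel]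
    · simp only [map_mul, map_inv, FreeGroup.lift_apply_of, hb i j h, mul_inv_cancel])

theorem braidLift_sigma {n : ℕ} {G : Type*} [Group G] (f : Index n → G) (hc) (hb)
    (i : ℕ) (h : 1 ≤ i ∧ i < n) : braidLift f hc hb (sigma n i h) = f ⟨i, h⟩ :=
  PresentedGroup.toGroup.of _

/-- The usual map `B_n → B_{n+1}`, `s_i ↦ s_i`, adding one strand on the right. -/
def braidIncl (n : ℕ) : Braid n →* Braid (n + 1) :=
  braidLift (fun i => sigma (n + 1) i ⟨i.2.1, i.2.2.trans (Nat.lt_succ_self n)⟩)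
    (fun i j h => sigma_comm (n + 1) ⟨i, i.2.1, i.2.2.trans (Nat.lt_succ_self n)⟩
      ⟨j, j.2.1, j.2.2.trans (Nat.lt_succ_self n)⟩ h)
    (fun i j h => sigma_braid (n + 1) ⟨i, i.2.1, i.2.2.trans (Nat.lt_succ_self n)⟩
      ⟨j, j.2.1, j.2.2.trans (Nat.lt_succ_self n)⟩ h)

theorem braidIncl_sigma (n i : ℕ) (h : 1 ≤ i ∧ i < n) :
    braidIncl n (sigma n i h) = sigma (n + 1) i ⟨h.1, h.2.trans (Nat.lt_succ_self n)⟩ :=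
  braidLift_sigma _ _ _ i h

/-! ### The algebras `Q_n`

They are defined over any commutative ring `k` with three units `a`, `b`, `c`. -/

section Algebra

variable {k : Type} [CommRing k]

/-- A braid, seen in the group algebra `k B_n`. -/
abbrev bas (k : Type) [CommRing k] {n : ℕ} (g : Braid n) : MonoidAlgebra k (Braid n) :=
  MonoidAlgebra.of k (Braid n) g

/-- The defining relations of `Q_n` in the group algebra `k B_n`: the cubic relation
`(s_i - a)(s_i - b)(s_i - c) = 0` for every Artin generator and, if `n ≥ 3`, the relation
expressing `s_1^{-1} s_2 s_1`. -/
inductive QRel (a b c : kˣ) (n : ℕ) :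
    MonoidAlgebra k (Braid n) → MonoidAlgebra k (Braid n) → Prop
  | cubic (i : Index n) :
      QRel a b c n
        ((bas k (sigma n i i.2) - algebraMap k _ (a : k)) *
          (bas k (sigma n i i.2) - algebraMap k _ (b : k)) *
          (bas k (sigma n i i.2) - algebraMap k _ (c : k))) 0
  | threeStrand (h : 3 ≤ n) (s₁ s₂ : Braid n) (h₁ : s₁ = sigma n 1) (h₂ : s₂ = sigma n 2) :
      QRel a b c n (bas k (s₁⁻¹ * s₂ * s₁))
        (bas k (s₁ * s₂ * s₁⁻¹)
          - ((a⁻¹ : kˣ) : k) • bas k (s₁ * s₂)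
          + (a : k) • bas k (s₁ * s₂⁻¹)
          + (a : k) • bas k (s₁⁻¹ * s₂)
          - (a : k) ^ 3 • bas k (s₁⁻¹ * s₂⁻¹)
          + ((a⁻¹ : kˣ) : k) • bas k (s₂ * s₁)
          - (a : k) • bas k (s₂ * s₁⁻¹)
          - (a : k) • bas k (s₂⁻¹ * s₁)
          + (a : k) ^ 3 • bas k (s₂⁻¹ * s₁⁻¹)
          + (a : k) ^ 2 • bas k (s₁⁻¹ * s₂⁻¹ * s₁)
          - (a : k) ^ 2 • bas k (s₁ * s₂⁻¹ * s₁⁻¹))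

/-- The `k`-algebra `Q_n`. -/
abbrev Q (a b c : kˣ) (n : ℕ) : Type := RingQuot (QRel a b c n)

/-- The image of a braid in `Q_n`. -/
def br (a b c : kˣ) {n : ℕ} : Braid n →* Q a b c n :=
  ((RingQuot.mkAlgHom k (QRel a b c n) : MonoidAlgebra k (Braid n) →* Q a b c n)).comp
    (MonoidAlgebra.of k (Braid n))

theorem mk_of (a b c : kˣ) {n : ℕ} (g : Braid n) :
    RingQuot.mkAlgHom k (QRel a b c n) (MonoidAlgebra.of k (Braid n) g) = br a b c g := rfl

/-- The natural morphism `Q_n → Q_{n+1}`, `s_i ↦ s_i`. -/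
def incl (a b c : kˣ) (n : ℕ) : Q a b c n →ₐ[k] Q a b c (n + 1) :=
  RingQuot.liftAlgHom k
    ⟨MonoidAlgebra.lift k (Q a b c (n + 1)) (Braid n) ((br a b c).comp (braidIncl n)), by
      rintro x y (i | ⟨h, s₁, s₂, h₁, h₂⟩)
      · have := RingQuot.mkAlgHom_rel k (QRel.cubic (a := a) (b := b) (c := c) (n := n + 1)
          ⟨i, i.2.1, i.2.2.trans (Nat.lt_succ_self n)⟩)
        simpa only [bas, map_mul, map_sub, map_zero, AlgHom.commutes, MonoidAlgebra.lift_of,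
          MonoidHom.comp_apply, braidIncl_sigma, mk_of] using this
      · have := RingQuot.mkAlgHom_rel k (QRel.threeStrand (a := a) (b := b) (c := c)
          (n := n + 1) (h.trans (Nat.le_succ n)) (braidIncl n s₁) (braidIncl n s₂)
          (by rw [h₁, braidIncl_sigma]) (by rw [h₂, braidIncl_sigma]))
        simpa only [bas, map_add, map_sub, map_smul, map_mul, map_inv, MonoidAlgebra.lift_of,
          MonoidHom.comp_apply, mk_of] using this⟩

theorem incl_br (a b c : kˣ) (n : ℕ) (g : Braid n) :
    incl a b c n (br a b c g) = br a b c (braidIncl n g) := by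
  simp [incl, br]

/-- The character `B_n → kˣ`, `s_i ↦ a`. -/
def braidChar (a : kˣ) (n : ℕ) : Braid n →* kˣ :=
  braidLift (fun _ => a) (fun _ _ _ => rfl) (fun _ _ _ => rfl)

/-- The character `ε : Q_n → k`, `s_i ↦ a`. -/
def eps (a b c : kˣ) (n : ℕ) : Q a b c n →ₐ[k] k :=
  RingQuot.liftAlgHom k
    ⟨MonoidAlgebra.lift k k (Braid n) ((Units.coeHom k).comp (braidChar a n)), by
      rintro x y (i | ⟨h, s₁, s₂, h₁, h₂⟩)
      · simp [braidChar, braidLift_sigma]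
      · have e₁ : braidChar a n s₁ = a := by rw [h₁]; exact braidLift_sigma _ _ _ _ _
        have e₂ : braidChar a n s₂ = a := by rw [h₂]; exact braidLift_sigma _ _ _ _ _
        simp [e₁, e₂]
        ring⟩

theorem eps_sigma (a b c : kˣ) (n i : ℕ) (h : 1 ≤ i ∧ i < n) :
    eps a b c n (br a b c (sigma n i h)) = a := by
  simp [eps, br, braidChar, braidLift_sigma]

/-- The subalgebra `u_i` of `Q_n` generated by `s_i`, as a `k`-submodule. -/
def uSub (a b c : kˣ) (n i : ℕ) (h : 1 ≤ i ∧ i < n := by omega) : Submodule k (Q a b c n) :=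
  Subalgebra.toSubmodule (Algebra.adjoin k {br a b c (sigma n i h)})

/-- The image of `Q_n` in `Q_{n+1}`, as a `k`-submodule. -/
def imSub (a b c : kˣ) (n : ℕ) : Submodule k (Q a b c (n + 1)) :=
  LinearMap.range (incl a b c n).toLinearMap

/-- For `n ≥ 1`, the `k`-submodule `Q_{n+1}^{(m)} = Q_n u_n Q_n u_n ⋯ u_n Q_n` of `Q_{n+1}`,
with `m` factors `u_n` and `m + 1` factors `Q_n`. -/
def filt (a b c : kˣ) (n : ℕ) (hn : 1 ≤ n) : ℕ → Submodule k (Q a b c (n + 1))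
  | 0 => imSub a b c n
  | m + 1 => filt a b c n hn m * uSub a b c (n + 1) n * imSub a b c n

end Algebra

/-! ### Braids on five strands; `i` and `i'` stand for `s_i` and its inverse -/

/-- `x = 3 2' 3` -/
def x : Braid 5 := sigma 5 3 * (sigma 5 2)⁻¹ * sigma 5 3

/-- `y = 1 2' 1` -/
def y : Braid 5 := sigma 5 1 * (sigma 5 2)⁻¹ * sigma 5 1

/-- `w₊ = 3 2 1' 2 3` -/
def wPlus : Braid 5 := sigma 5 3 * sigma 5 2 * (sigma 5 1)⁻¹ * sigma 5 2 * sigma 5 3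

/-- `w₋ = 3' 2' 1 2' 3'` -/
def wMinus : Braid 5 :=
  (sigma 5 3)⁻¹ * (sigma 5 2)⁻¹ * sigma 5 1 * (sigma 5 2)⁻¹ * (sigma 5 3)⁻¹

/-- `4 x y 4 x 4` -/
def z : Braid 5 := sigma 5 4 * x * y * sigma 5 4 * x * sigma 5 4

/-- `4 w₋ 4 w₋ 4` -/
def zMinus : Braid 5 := sigma 5 4 * wMinus * sigma 5 4 * wMinus * sigma 5 4

/-- `4' w₊ 4' w₊ 4'` -/
def zPlus : Braid 5 := (sigma 5 4)⁻¹ * wPlus * (sigma 5 4)⁻¹ * wPlus * (sigma 5 4)⁻¹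

/-! ### The generic algebras, over `R = ℤ[a^{±1}, b^{±1}, c^{±1}]` -/

/-- The generic `Q_n` over `R`. -/
abbrev QR (n : ℕ) : Type := Q (var 0) (var 1) (var 2) n

/-- The image of a braid in the generic `Q_n`. -/
abbrev brR {n : ℕ} : Braid n →* QR n := br (var 0) (var 1) (var 2)

/-- The natural morphism `Q_4 → Q_5`. -/
abbrev incl4 : QR 4 →ₐ[R] QR 5 := incl (var 0) (var 1) (var 2) 4

/-- The character `ε : Q_4 → R`, `s_i ↦ a`. -/
abbrev eps4 : QR 4 →ₐ[R] R := eps (var 0) (var 1) (var 2) 4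

/-- `Q_5^{(m)} = Q_4 u_4 Q_4 ⋯ u_4 Q_4`, with `m` factors `u_4`. -/
abbrev Q5 (m : ℕ) : Submodule R (QR 5) := filt (var 0) (var 1) (var 2) 4 (by omega) m

end CubicQuotient

end

/-! Dividing every generator by a (`nbr`) makes ε the trivial character and turns all coefficients
of the three-strand relation into ±1. In a `CubicSys`, U stands for the product of the two other
normalized roots b/a and c/a, and V for its inverse. By `Q5_eq` the filtration becomes `N n`, the
span of the words with at most n letters 4^±. The theorem is thus about words a l b l' c modulo `N
2`, where a, b, c are 4^± and the gaps l, l' are words in 1, 2, 3. Each such word is shown to be a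
multiple of z = 4xy4x4, on which 1, 2, 3 act trivially from both sides. The elements 4w₋4w₋4 and
4'w₊4'w₊4' are then identified as explicit unit multiples of z.

The driving fact is that a peak j i' j absorbs i on either side, up to smaller words (`c_peak_mul`,
`c_mul_peak`): this is the three-strand relation multiplied by j. For i = 1, j = 2 it makes w₊ and
w₋ invariant under 1 and 2 modulo smaller words. Hence the words in 1, 2, 3 are spanned by p e q
with p, q in 1, 2 and e among ∅, 3, 3', 32'3, 3'23', together with w₊ and w₋ alone (`mid_zero`). For
i = 3, j = 4 it lets 43'4 absorb 3, and then 4^± l 43'4 vanishes modulo `N 2` for every l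
(`peak_zero`). So a product with three letters 4^± vanishes as soon as one gap is p 3^± q or p q
(`short_left`, `short_right`). Only gaps built on x and w_± survive; in a gap x absorbs 2, and U
3'23' equals x.

Two gaps built on x: in 4xq4x4 the factors x absorb 2 on both sides of q, and 4x1^j4x4 vanishes
(`x_one`), so that only q = 12'1 = y is left (`x_low_mem`). For the invariance, a direct computation
gives z2 = z (`z_two`) and 3z1'2'1 = z (`three_z_right`). Hence z1 = 3z, and comparing z121 with
z212 yields 33z = 3z, so 3z = z and z1 = z. The rest follows by reading words backwards.

Gaps w_±: braid relations lead to products 43'4 n 43'4, most of which vanish (`peak_mul_peak_zero`).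
With v = 21'2, those with n = v3v or v3'v equal V² z. This gives V⁸ z for the image of z under
inversion of the generators (`z_bar`), then -V³ z for 4'w₊4'w₊4' (`zPlus_eq`) and -V⁵ z for 4w₋4w₋4
(`zMinus_eq`). Since V is a unit, the three elements span the same line. `mid_mid_mem` collects all
sign patterns, with two symmetries halving the work: reversal (`op`) and inversion of the generators
(`bar`).

Equalities of braids are certified by lists of positions at which moves are applied to the two
sides; `decide` replays them. -/

namespace CubicQuotient

/-! ### Words in the braid generators -/

/-- Letters of braid words: `i` stands for the `i`-th generator, `-i` for its inverse, and `0` for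
the empty word. -/
def IsGen (a : ℤ) : Prop := 1 ≤ a.natAbs ∧ a.natAbs ≤ 4

instance : DecidablePred IsGen := fun _ => inferInstanceAs (Decidable (_ ∧ _))

/-- Four invertible elements of a ring satisfying the braid relations on five strands. -/
structure BraidSys (A : Type) [Ring A] where
  f : ℤ → A
  f_zero : f 0 = 1
  f_inv : ∀ i, f i * f (-i) = 1
  f_comm : ∀ i j : ℤ, 1 ≤ i → i + 2 ≤ j → j ≤ 4 → f i * f j = f j * f i
  f_braid : ∀ i : ℤ, 1 ≤ i → i ≤ 3 → f i * f (i + 1) * f i = f (i + 1) * f i * f (i + 1)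

/-- Two letters at distance at least two. -/
def Far (a b : ℤ) : Prop :=
  IsGen a ∧ IsGen b ∧ (a.natAbs + 2 ≤ b.natAbs ∨ b.natAbs + 2 ≤ a.natAbs)

instance (a b : ℤ) : Decidable (Far a b) := inferInstanceAs (Decidable (_ ∧ _ ∧ (_ ∨ _)))

/-- Three letters to which a braid relation applies. -/
def Braided (a b c : ℤ) : Prop :=
  IsGen a ∧ IsGen b ∧ a.natAbs = c.natAbs ∧ (a.natAbs + 1 = b.natAbs ∨ b.natAbs + 1 = a.natAbs) ∧
    -- The excluded sign patterns are i j' i and i' j i', to which no braid relation applies; they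
    -- are the peaks of the later computations.
    (a = c → a.sign = b.sign)

instance (a b c : ℤ) : Decidable (Braided a b c) :=
  inferInstanceAs (Decidable (_ ∧ _ ∧ _ ∧ (_ ∨ _) ∧ (_ → _)))

/-- Apply a cancellation, a commutation or a braid relation at the beginning of a word. -/
def headMove : List ℤ → List ℤ
  | a :: b :: c :: r =>
    if a + b = 0 then c :: r
    else if Far a b then b :: a :: c :: r
    else if Braided a b c then
      (c.sign * b.natAbs) :: (b.sign * a.natAbs) :: (a.sign * b.natAbs) :: r
    else a :: b :: c :: r
  | [a, b] => if a + b = 0 then [] else if Far a b then [b, a] else [a, b]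
  | l => l

/-- Apply a cancellation, a commutation or a braid relation at a given position of a word. -/
def moveAt : ℕ → List ℤ → List ℤ
  | 0, l => headMove l
  | _ + 1, [] => []
  | n + 1, a :: l => a :: moveAt n l

/-- Apply moves at given positions, one after the other. -/
def moves : List ℕ → List ℤ → List ℤ
  | [], l => l
  | n :: ns, l => moves ns (moveAt n l)

namespace BraidSys

variable {A : Type} [Ring A] (D : BraidSys A)

/-- The value of a word. -/
def w (l : List ℤ) : A := (l.map D.f).prod

@[simp] theorem w_nil : D.w [] = 1 := rfl

theorem w_cons (a : ℤ) (l : List ℤ) : D.w (a :: l) = D.f a * D.w l := by simp [w]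

theorem w_append (l l' : List ℤ) : D.w (l ++ l') = D.w l * D.w l' := by simp [w]

theorem f_inv' (i : ℤ) : D.f (-i) * D.f i = 1 := by simpa using D.f_inv (-i)

/-- The letters as units. -/
def u (i : ℤ) : Aˣ := ⟨D.f i, D.f (-i), D.f_inv i, D.f_inv' i⟩

theorem u_neg (i : ℤ) : D.u (-i) = (D.u i)⁻¹ := Units.ext rfl

theorem u_comm {a b : ℤ} (h : Far a b) : D.u a * D.u b = D.u b * D.u a := by
  have key : ∀ i j : ℤ, 1 ≤ i → i + 2 ≤ j → j ≤ 4 → Commute (D.u i) (D.u j) :=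
    fun i j h₁ h₂ h₃ => Units.ext (D.f_comm i j h₁ h₂ h₃)
  have key2 : ∀ i j : ℤ, 1 ≤ i → 1 ≤ j → i ≤ 4 → j ≤ 4 → (i + 2 ≤ j ∨ j + 2 ≤ i) →
      Commute (D.u i) (D.u j) := by
    rintro i j h₁ h₂ h₃ h₄ (h | h)
    · exact key i j h₁ h h₄
    · exact (key j i h₂ h h₃).symm
  obtain ⟨⟨ha, ha'⟩, ⟨hb, hb'⟩, hab⟩ := h
  change Commute _ _
  rcases Int.natAbs_eq a with h₁ | h₁ <;> rcases Int.natAbs_eq b with h₂ | h₂ <;> rw [h₁, h₂]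
  · exact key2 _ _ (by omega) (by omega) (by omega) (by omega) (by omega)
  · rw [u_neg]
    exact (key2 _ _ (by omega) (by omega) (by omega) (by omega) (by omega)).inv_right
  · rw [u_neg]
    exact (key2 _ _ (by omega) (by omega) (by omega) (by omega) (by omega)).inv_left
  · rw [u_neg, u_neg]
    exact (key2 _ _ (by omega) (by omega) (by omega) (by omega) (by omega)).inv_inv

/-- Each of the six admissible sign patterns is the positive braid relation with some factors moved
across the equality, possibly inverted or with its two generators exchanged. -/
theorem u_braid {a b c : ℤ} (h : Braided a b c) :
    D.u a * (D.u b * D.u c) =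
      D.u (c.sign * b.natAbs) * (D.u (b.sign * a.natAbs) * D.u (a.sign * b.natAbs)) := by
  have key : ∀ i : ℤ, 1 ≤ i → i ≤ 3 →
      D.u i * D.u (i + 1) * D.u i = D.u (i + 1) * D.u i * D.u (i + 1) :=
    fun i h₁ h₂ => Units.ext (D.f_braid i h₁ h₂)
  have key2 : ∀ i j : ℤ, 1 ≤ i → 1 ≤ j → i ≤ 4 → j ≤ 4 → (i + 1 = j ∨ j + 1 = i) →
      D.u i * D.u j * D.u i = D.u j * D.u i * D.u j := by
    rintro i j h₁ h₂ h₃ h₄ (rfl | rfl)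
    · exact key i h₁ (by omega)
    · exact (key j h₂ (by omega)).symm
  have grp : ∀ p q : Aˣ, p * q * p = q * p * q → p * q * p⁻¹ = q⁻¹ * p * q := by
    intro p q e
    rw [mul_inv_eq_iff_eq_mul, mul_assoc, mul_assoc, ← mul_assoc p q p, e]
    group
  have grp2 : ∀ p q : Aˣ, p * q * p = q * p * q → p⁻¹ * q * p = q * p * q⁻¹ := by
    intro p q e
    exact (grp q p e.symm).symm
  have grp3 : ∀ p q : Aˣ, p * q * p = q * p * q → p⁻¹ * q⁻¹ * p⁻¹ = q⁻¹ * p⁻¹ * q⁻¹ := by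
    intro p q e
    have := congrArg (·⁻¹) e
    simpa [mul_assoc] using this
  have grp4 : ∀ p q : Aˣ, p * q * p = q * p * q → p * q⁻¹ * p⁻¹ = q⁻¹ * p⁻¹ * q := by
    intro p q e
    have := congrArg (·⁻¹) (grp p q e)
    simpa [mul_assoc] using this
  obtain ⟨⟨ha, ha'⟩, ⟨hb, hb'⟩, hac, hab, hs⟩ := h
  have hb2 := key2 a.natAbs b.natAbs (by omega) (by omega) (by omega) (by omega) (by omega)
  have sg : ∀ n : ℕ, 1 ≤ n → Int.sign (n : ℤ) = 1 := fun n hn => Int.sign_eq_one_of_pos (by omega)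
  rcases Int.natAbs_eq a with h₁ | h₁ <;> rcases Int.natAbs_eq b with h₂ | h₂ <;>
    rcases Int.natAbs_eq c with h₃ | h₃ <;> rw [← hac] at h₃ <;> rw [h₁, h₂, h₃] <;>
    rw [h₁, h₂, h₃] at hs <;>
    simp only [Int.sign_neg, sg _ ha, sg _ hb, Int.natAbs_neg, Int.natAbs_natCast, one_mul,
      neg_mul, u_neg, ← mul_assoc] at hs ⊢
  · exact hb2
  · exact grp _ _ hb2
  · simp at hs
  · exact grp4 _ _ hb2
  · exact grp2 _ _ hb2
  · simp at hs
  · exact (grp4 _ _ hb2.symm).symm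
  · exact grp3 _ _ hb2

theorem w_headMove (l : List ℤ) : D.w (headMove l) = D.w l := by
  unfold headMove
  split
  · rename_i a b c r
    split_ifs with h₁ h₂ h₃
    · obtain rfl : b = -a := by omega
      rw [w_cons D a, w_cons D (-a), ← mul_assoc, D.f_inv, one_mul]
    · rw [w_cons, w_cons, w_cons D a, w_cons D b, ← mul_assoc, ← mul_assoc]
      exact congrArg (· * _) (congrArg Units.val (D.u_comm h₂)).symm
    · simp only [w_cons, ← mul_assoc]
      have := congrArg Units.val (D.u_braid h₃)
      simp only [Units.val_mul, ← mul_assoc] at this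
      exact congrArg (· * _) this.symm
    · rfl
  · rename_i a b
    split_ifs with h₁ h₂
    · obtain rfl : b = -a := by omega
      simp [w_cons, D.f_inv]
    · simp only [w_cons, w_nil, mul_one]
      exact (congrArg Units.val (D.u_comm h₂)).symm
    · rfl
  · rfl

theorem w_moveAt (n : ℕ) (l : List ℤ) : D.w (moveAt n l) = D.w l := by
  induction n generalizing l with
  | zero => exact D.w_headMove l
  | succ n ih =>
    cases l with
    | nil => rfl
    | cons a l => rw [moveAt, w_cons, ih, w_cons]

theorem w_moves (ms : List ℕ) (l : List ℤ) : D.w (moves ms l) = D.w l := by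
  induction ms generalizing l with
  | nil => rfl
  | cons n ns ih => rw [moves, ih, w_moveAt]

/-- Two words with a common transform have the same value. -/
theorem w_eq {l l' : List ℤ} (ms ms' : List ℕ) (h : moves ms l = moves ms' l') :
    D.w l = D.w l' := by
  rw [← D.w_moves ms, h, D.w_moves]

end BraidSys

/-! ### Systems of generators for the cubic quotient -/

/-- Two adjacent generators. -/
def Adj (i j : ℤ) : Prop :=
  (i = 1 ∧ j = 2) ∨ (i = 2 ∧ j = 1) ∨ (i = 2 ∧ j = 3) ∨ (i = 3 ∧ j = 2) ∨ (i = 3 ∧ j = 4) ∨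
    (i = 4 ∧ j = 3)

instance (i j : ℤ) : Decidable (Adj i j) :=
  inferInstanceAs (Decidable (_ ∨ _ ∨ _ ∨ _ ∨ _ ∨ _))

/-- Generators satisfying the defining relations of `Q_5`, normalized so that `a = 1`. -/
structure CubicSys (k A : Type) [CommRing k] [Ring A] [Algebra k A] extends BraidSys A where
  -- For a generator with roots 1, b, c these are the elementary symmetric functions 1 + b + c, b +
  -- c + bc and bc; V is the inverse of bc. The cubic relation below is the usual one multiplied by
  -- the square of the inverse generator.
  S : k
  T : k
  U : k
  V : k
  UV : U * V = 1
  cubic : ∀ i : ℤ, 1 ≤ i → i ≤ 4 →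
    f i = S • (1 : A) - T • f (-i) + U • (f (-i) * f (-i))
  three : ∀ i j : ℤ, Adj i j →
    toBraidSys.w [-i, j, i] = toBraidSys.w [i, j, -i] - toBraidSys.w [i, j]
      + toBraidSys.w [i, -j] + toBraidSys.w [-i, j] - toBraidSys.w [-i, -j] + toBraidSys.w [j, i]
      - toBraidSys.w [j, -i] - toBraidSys.w [-j, i] + toBraidSys.w [-j, -i]
      + toBraidSys.w [-i, -j, i] - toBraidSys.w [i, -j, -i]

namespace CubicSys

variable {k A : Type} [CommRing k] [Ring A] [Algebra k A] (D : CubicSys k A)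

/-- The class of a word modulo a submodule. -/
def c (W : Submodule k A) (l : List ℤ) : A ⧸ W := W.mkQ (D.w l)

/-- The class of `p a q` modulo a submodule, for words `p` and `q`. -/
def ctx (W : Submodule k A) (p q : List ℤ) : A →ₗ[k] A ⧸ W :=
  W.mkQ ∘ₗ LinearMap.mulRight k (D.w q) ∘ₗ LinearMap.mulLeft k (D.w p)

theorem ctx_w (W : Submodule k A) (p q l : List ℤ) :
    D.ctx W p q (D.w l) = D.c W (p ++ (l ++ q)) := by
  simp [ctx, c, D.w_append, mul_assoc]

theorem c_eq_zero {W : Submodule k A} {l : List ℤ} : D.c W l = 0 ↔ D.w l ∈ W := by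
  simp [c]

variable {D}

/-- Two words with a common transform have the same class. -/
theorem c_eq {W : Submodule k A} {l l' : List ℤ} (ms ms' : List ℕ)
    (h : moves ms l = moves ms' l') : D.c W l = D.c W l' := by
  rw [c, D.w_eq ms ms' h, c]

variable (D)
variable (W : Submodule k A)

/-- The letter 0 lets a factor with exponent in {-1, 0, 1} be written as one letter, so that
spanning families have words of fixed length. -/
theorem c_zero (p q : List ℤ) : D.c W (p ++ 0 :: q) = D.c W (p ++ q) := by
  rw [c, c, D.w_append, D.w_cons, D.f_zero, one_mul, ← D.w_append]

theorem c_cubic (i : ℤ) (h : 1 ≤ i ∧ i ≤ 4) (p q : List ℤ) :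
    D.c W (p ++ i :: q) = D.S • D.c W (p ++ q) - D.T • D.c W (p ++ -i :: q)
      + D.U • D.c W (p ++ -i :: -i :: q) := by
  have := congrArg (D.ctx W p q) (D.cubic i h.1 h.2)
  have e : ∀ j, D.f j = D.w [j] := fun j => by simp [D.w_cons]
  have e₂ : D.w [-i] * D.w [-i] = D.w [-i, -i] := by simp [D.w_cons]
  rw [map_add, map_sub, map_smul, map_smul, map_smul, e, e, e₂, ← D.w_nil] at this
  simpa only [D.ctx_w, List.nil_append, List.cons_append] using this

/-- The cubic relation times i expresses i² through i, 1 and the inverse of i; multiplying by V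
isolates the inverse. -/
theorem c_cubic' (i : ℤ) (h : 1 ≤ i ∧ i ≤ 4) (p q : List ℤ) :
    D.c W (p ++ -i :: q) = (D.T * D.V) • D.c W (p ++ q)
      - (D.S * D.V) • D.c W (p ++ i :: q)
      + D.V • D.c W (p ++ i :: i :: q) := by
  have h₁ := D.c_cubic W i h (p ++ [i]) (i :: q)
  have e₁ : D.c W (p ++ i :: -i :: i :: q) = D.c W (p ++ i :: q) := by
    simp only [c, D.w_append, D.w_cons, ← mul_assoc, D.f_inv, mul_one]
  have h₂ := D.c_cubic W i h p (i :: i :: q)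
  have e₂ : D.c W (p ++ -i :: i :: i :: q) = D.c W (p ++ i :: q) := by
    simp only [c, D.w_append, D.w_cons, ← mul_assoc, D.f_inv', mul_one]
  have e₃ : D.c W (p ++ -i :: -i :: i :: i :: q) = D.c W (p ++ q) := by
    simp only [c, D.w_append, D.w_cons, ← mul_assoc, D.f_inv', mul_one]
  have h₃ := D.c_cubic W i h p (i :: q)
  have e₄ : D.c W (p ++ -i :: i :: q) = D.c W (p ++ q) := by
    simp only [c, D.w_append, D.w_cons, ← mul_assoc, D.f_inv', mul_one]
  have e₅ : D.c W (p ++ -i :: -i :: i :: q) = D.c W (p ++ -i :: q) := by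
    simp only [c, D.w_append, D.w_cons, ← mul_assoc, D.f_inv', mul_one]
  rw [e₄, e₅] at h₃
  rw [h₃, smul_add, smul_sub, smul_smul, smul_smul, smul_smul]
  have : D.V * D.U = 1 := by rw [mul_comm, D.UV]
  rw [this]
  module

theorem c_three (i j : ℤ) (h : Adj i j) (p q : List ℤ) :
    D.c W (p ++ -i :: j :: i :: q) =
      D.c W (p ++ i :: j :: -i :: q) - D.c W (p ++ i :: j :: q)
      + D.c W (p ++ i :: -j :: q) + D.c W (p ++ -i :: j :: q) - D.c W (p ++ -i :: -j :: q)
      + D.c W (p ++ j :: i :: q) - D.c W (p ++ j :: -i :: q) - D.c W (p ++ -j :: i :: q)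
      + D.c W (p ++ -j :: -i :: q) + D.c W (p ++ -i :: -j :: i :: q)
      - D.c W (p ++ i :: -j :: -i :: q) := by
  have := congrArg (D.ctx W p q) (D.three i j h)
  simpa only [map_add, map_sub, D.ctx_w, List.nil_append, List.cons_append] using this

end CubicSys

namespace CubicSys

variable {k A : Type} [CommRing k] [Ring A] [Algebra k A] (D : CubicSys k A)
variable (W : Submodule k A)

/-! ### Consequences of the defining relations, in context -/

theorem VU : D.V * D.U = 1 := by rw [mul_comm, D.UV]

variable {D W}

theorem c_eq_ctx {l l' : List ℤ} (p q : List ℤ) (ms ms' : List ℕ)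
    (h : moves ms l = moves ms' l') : D.c W (p ++ (l ++ q)) = D.c W (p ++ (l' ++ q)) := by
  rw [← D.ctx_w, ← D.ctx_w, D.w_eq ms ms' h]

variable (D W)

theorem c_cancel (a : ℤ) (p q : List ℤ) : D.c W (p ++ a :: -a :: q) = D.c W (p ++ q) := by
  rw [c, c, D.w_append, D.w_cons, D.w_cons, ← mul_assoc (D.f a), D.f_inv, one_mul, ← D.w_append]

theorem c_cancel' (a : ℤ) (p q : List ℤ) : D.c W (p ++ -a :: a :: q) = D.c W (p ++ q) := by
  simpa using D.c_cancel W (-a) p q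

theorem c_filter {l l' : List ℤ} (h : l.filter (· ≠ 0) = l'.filter (· ≠ 0)) :
    D.c W l = D.c W l' := by
  have key : ∀ l : List ℤ, D.w (l.filter (· ≠ 0)) = D.w l := by
    intro l
    induction l with
    | nil => rfl
    | cons a l ih =>
      by_cases ha : a = 0
      · subst ha
        rw [List.filter_cons_of_neg (by simp), ih, D.w_cons, D.f_zero, one_mul]
      · rw [List.filter_cons_of_pos (by simpa using ha), D.w_cons, ih, D.w_cons]
  rw [c, c, ← key l, h, key]

/-- `j i' j` in terms of `j' i j' i'`. -/
theorem c_cube_right (i j : ℤ) (h : Adj i j) (p q : List ℤ) :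
    D.c W (p ++ j :: -i :: j :: q) = D.U • D.c W (p ++ -j :: i :: -j :: -i :: q)
      + D.S • D.c W (p ++ -i :: j :: q) - D.T • D.c W (p ++ i :: -j :: -i :: q) := by
  have hj : 1 ≤ j ∧ j ≤ 4 := by unfold Adj at h; omega
  -- Only the first letter j is expanded; j' i' j = i j' i' then simplifies the two terms with
  -- negative powers of j.
  have h₁ := D.c_cubic W j hj p (-i :: j :: q)
  have h₂ : D.c W (p ++ ([-j, -i, j] ++ q)) = D.c W (p ++ ([i, -j, -i] ++ q)) := by
    rcases h with ⟨rfl, rfl⟩ | ⟨rfl, rfl⟩ | ⟨rfl, rfl⟩ | ⟨rfl, rfl⟩ | ⟨rfl, rfl⟩ | ⟨rfl, rfl⟩ <;>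
      exact c_eq_ctx p q [0] [] (by decide)
  have h₃ : D.c W (p ++ ([-j, -j, -i, j] ++ q)) = D.c W (p ++ ([-j, i, -j, -i] ++ q)) := by
    rcases h with ⟨rfl, rfl⟩ | ⟨rfl, rfl⟩ | ⟨rfl, rfl⟩ | ⟨rfl, rfl⟩ | ⟨rfl, rfl⟩ | ⟨rfl, rfl⟩ <;>
      exact c_eq_ctx p q [1] [] (by decide)
  simp only [List.cons_append, List.nil_append] at h₂ h₃
  rw [h₁, h₂, h₃]
  abel

/-- `j i' j` in terms of `i' j' i j'`. -/
theorem c_cube_left (i j : ℤ) (h : Adj i j) (p q : List ℤ) :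
    D.c W (p ++ j :: -i :: j :: q) = D.U • D.c W (p ++ -i :: -j :: i :: -j :: q)
      + D.S • D.c W (p ++ j :: -i :: q) - D.T • D.c W (p ++ -i :: -j :: i :: q) := by
  have hj : 1 ≤ j ∧ j ≤ 4 := by unfold Adj at h; omega
  have h₁ := D.c_cubic W j hj (p ++ [j, -i]) q
  have h₂ : D.c W (p ++ ([j, -i, -j] ++ q)) = D.c W (p ++ ([-i, -j, i] ++ q)) := by
    rcases h with ⟨rfl, rfl⟩ | ⟨rfl, rfl⟩ | ⟨rfl, rfl⟩ | ⟨rfl, rfl⟩ | ⟨rfl, rfl⟩ | ⟨rfl, rfl⟩ <;>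
      exact c_eq_ctx p q [0] [] (by decide)
  have h₃ : D.c W (p ++ ([j, -i, -j, -j] ++ q)) = D.c W (p ++ ([-i, -j, i, -j] ++ q)) := by
    rcases h with ⟨rfl, rfl⟩ | ⟨rfl, rfl⟩ | ⟨rfl, rfl⟩ | ⟨rfl, rfl⟩ | ⟨rfl, rfl⟩ | ⟨rfl, rfl⟩ <;>
      exact c_eq_ctx p q [0] [] (by decide)
  simp only [List.cons_append, List.nil_append] at h₂ h₃
  simp only [List.append_assoc, List.cons_append, List.nil_append] at h₁
  rw [h₁, h₂, h₃]
  abel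

/-- `j' i j'` in terms of `j i' j i`. -/
theorem c_cube_inv (i j : ℤ) (h : Adj i j) (p q : List ℤ) :
    D.c W (p ++ -j :: i :: -j :: q) = D.V • D.c W (p ++ j :: -i :: j :: i :: q)
      - (D.V * D.S) • D.c W (p ++ -i :: j :: i :: q) + (D.V * D.T) • D.c W (p ++ i :: -j :: q) := by
  have h₁ := D.c_cube_right W i j h p (i :: q)
  have h₂ := D.c_cancel' W i (p ++ [-j, i, -j]) q
  have h₃ := D.c_cancel' W i (p ++ [i, -j]) q
  simp only [List.append_assoc, List.cons_append, List.nil_append] at h₂ h₃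
  rw [h₂, h₃] at h₁
  linear_combination (norm := module)
    -D.V • h₁ - D.VU • D.c W (p ++ -j :: i :: -j :: q)

/-- `j' i j'` in terms of `i j i' j`. -/
theorem c_cube_inv_left (i j : ℤ) (h : Adj i j) (p q : List ℤ) :
    D.c W (p ++ -j :: i :: -j :: q) = D.V • D.c W (p ++ i :: j :: -i :: j :: q)
      - (D.V * D.S) • D.c W (p ++ i :: j :: -i :: q) + (D.V * D.T) • D.c W (p ++ -j :: i :: q) := by
  have h₁ := D.c_cube_left W i j h (p ++ [i]) q
  have h₂ := D.c_cancel W i p (-j :: i :: -j :: q)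
  have h₃ := D.c_cancel W i p (-j :: i :: q)
  simp only [List.append_assoc, List.cons_append, List.nil_append] at h₁
  rw [h₂, h₃] at h₁
  linear_combination (norm := module)
    -D.V • h₁ - D.VU • D.c W (p ++ -j :: i :: -j :: q)

/-- Multiplication of `j i' j` by `i` on the right. -/
theorem c_peak_mul (i j : ℤ) (h : Adj i j) (p q : List ℤ) :
    D.c W (p ++ j :: -i :: j :: i :: q) = D.c W (p ++ j :: -i :: j :: q)
      + D.c W (p ++ i :: j :: q) - D.c W (p ++ i :: j :: i :: q) + D.c W (p ++ -i :: j :: i :: q)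
      - D.c W (p ++ -i :: -j :: i :: q) + D.c W (p ++ -i :: -j :: i :: i :: q)
      - D.c W (p ++ -i :: j :: q) + D.c W (p ++ j :: j :: i :: q) - D.c W (p ++ j :: j :: -i :: q)
      - D.c W (p ++ i :: q) + D.c W (p ++ -i :: q) := by
  -- After multiplication by j on the left, the left side of the relation is j i' j i and its term
  -- i' j becomes the peak j i' j, with coefficient 1. All other terms simplify by braid relations.
  have h₁ := D.c_three W i j h (p ++ [j]) q
  simp only [List.append_assoc, List.cons_append, List.nil_append] at h₁
  have e0 : D.c W (p ++ ([j, i, j, -i] ++ q)) = D.c W (p ++ ([i, j] ++ q)) := by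
    rcases h with ⟨rfl, rfl⟩ | ⟨rfl, rfl⟩ | ⟨rfl, rfl⟩ | ⟨rfl, rfl⟩ | ⟨rfl, rfl⟩ | ⟨rfl, rfl⟩ <;>
      exact c_eq_ctx p q [0, 2] [] (by decide)
  have e1 : D.c W (p ++ ([j, i, j] ++ q)) = D.c W (p ++ ([i, j, i] ++ q)) := by
    rcases h with ⟨rfl, rfl⟩ | ⟨rfl, rfl⟩ | ⟨rfl, rfl⟩ | ⟨rfl, rfl⟩ | ⟨rfl, rfl⟩ | ⟨rfl, rfl⟩ <;>
      exact c_eq_ctx p q [0] [] (by decide)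
  have e2 : D.c W (p ++ ([j, i, -j] ++ q)) = D.c W (p ++ ([-i, j, i] ++ q)) := by
    rcases h with ⟨rfl, rfl⟩ | ⟨rfl, rfl⟩ | ⟨rfl, rfl⟩ | ⟨rfl, rfl⟩ | ⟨rfl, rfl⟩ | ⟨rfl, rfl⟩ <;>
      exact c_eq_ctx p q [0] [] (by decide)
  have e3 : D.c W (p ++ ([j, -i, -j] ++ q)) = D.c W (p ++ ([-i, -j, i] ++ q)) := by
    rcases h with ⟨rfl, rfl⟩ | ⟨rfl, rfl⟩ | ⟨rfl, rfl⟩ | ⟨rfl, rfl⟩ | ⟨rfl, rfl⟩ | ⟨rfl, rfl⟩ <;>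
      exact c_eq_ctx p q [0] [] (by decide)
  have e4 : D.c W (p ++ ([j, -j, i] ++ q)) = D.c W (p ++ ([i] ++ q)) := by
    rcases h with ⟨rfl, rfl⟩ | ⟨rfl, rfl⟩ | ⟨rfl, rfl⟩ | ⟨rfl, rfl⟩ | ⟨rfl, rfl⟩ | ⟨rfl, rfl⟩ <;>
      exact c_eq_ctx p q [0] [] (by decide)
  have e5 : D.c W (p ++ ([j, -j, -i] ++ q)) = D.c W (p ++ ([-i] ++ q)) := by
    rcases h with ⟨rfl, rfl⟩ | ⟨rfl, rfl⟩ | ⟨rfl, rfl⟩ | ⟨rfl, rfl⟩ | ⟨rfl, rfl⟩ | ⟨rfl, rfl⟩ <;>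
      exact c_eq_ctx p q [0] [] (by decide)
  have e6 : D.c W (p ++ ([j, -i, -j, i] ++ q)) = D.c W (p ++ ([-i, -j, i, i] ++ q)) := by
    rcases h with ⟨rfl, rfl⟩ | ⟨rfl, rfl⟩ | ⟨rfl, rfl⟩ | ⟨rfl, rfl⟩ | ⟨rfl, rfl⟩ | ⟨rfl, rfl⟩ <;>
      exact c_eq_ctx p q [0] [] (by decide)
  have e7 : D.c W (p ++ ([j, i, -j, -i] ++ q)) = D.c W (p ++ ([-i, j] ++ q)) := by
    rcases h with ⟨rfl, rfl⟩ | ⟨rfl, rfl⟩ | ⟨rfl, rfl⟩ | ⟨rfl, rfl⟩ | ⟨rfl, rfl⟩ | ⟨rfl, rfl⟩ <;>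
      exact c_eq_ctx p q [0, 2] [] (by decide)
  simp only [List.cons_append, List.nil_append] at e0 e1 e2 e3 e4 e5 e6 e7
  rw [e0, e1, e2, e3, e4, e5, e6, e7] at h₁
  rw [h₁]
  abel

/-- Multiplication of `j i' j` by `i` on the left. -/
theorem c_mul_peak (i j : ℤ) (h : Adj i j) (p q : List ℤ) :
    D.c W (p ++ i :: j :: -i :: j :: q) = D.c W (p ++ j :: -i :: j :: q)
      + D.c W (p ++ j :: i :: q) - D.c W (p ++ i :: j :: i :: q) + D.c W (p ++ i :: j :: -i :: q)
      - D.c W (p ++ i :: -j :: -i :: q) + D.c W (p ++ i :: i :: -j :: -i :: q)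
      - D.c W (p ++ j :: -i :: q) + D.c W (p ++ i :: j :: j :: q) - D.c W (p ++ -i :: j :: j :: q)
      - D.c W (p ++ i :: q) + D.c W (p ++ -i :: q) := by
  have h₁ := D.c_three W i j h p (j :: q)
  have e0 : D.c W (p ++ ([-i, j, i, j] ++ q)) = D.c W (p ++ ([j, i] ++ q)) := by
    rcases h with ⟨rfl, rfl⟩ | ⟨rfl, rfl⟩ | ⟨rfl, rfl⟩ | ⟨rfl, rfl⟩ | ⟨rfl, rfl⟩ | ⟨rfl, rfl⟩ <;>
      exact c_eq_ctx p q [0, 2] [] (by decide)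
  have e1 : D.c W (p ++ ([i, -j, j] ++ q)) = D.c W (p ++ ([i] ++ q)) := by
    rcases h with ⟨rfl, rfl⟩ | ⟨rfl, rfl⟩ | ⟨rfl, rfl⟩ | ⟨rfl, rfl⟩ | ⟨rfl, rfl⟩ | ⟨rfl, rfl⟩ <;>
      exact c_eq_ctx p q [1] [] (by decide)
  have e2 : D.c W (p ++ ([-i, -j, j] ++ q)) = D.c W (p ++ ([-i] ++ q)) := by
    rcases h with ⟨rfl, rfl⟩ | ⟨rfl, rfl⟩ | ⟨rfl, rfl⟩ | ⟨rfl, rfl⟩ | ⟨rfl, rfl⟩ | ⟨rfl, rfl⟩ <;>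
      exact c_eq_ctx p q [1] [] (by decide)
  have e3 : D.c W (p ++ ([j, i, j] ++ q)) = D.c W (p ++ ([i, j, i] ++ q)) := by
    rcases h with ⟨rfl, rfl⟩ | ⟨rfl, rfl⟩ | ⟨rfl, rfl⟩ | ⟨rfl, rfl⟩ | ⟨rfl, rfl⟩ | ⟨rfl, rfl⟩ <;>
      exact c_eq_ctx p q [0] [] (by decide)
  have e4 : D.c W (p ++ ([-j, i, j] ++ q)) = D.c W (p ++ ([i, j, -i] ++ q)) := by
    rcases h with ⟨rfl, rfl⟩ | ⟨rfl, rfl⟩ | ⟨rfl, rfl⟩ | ⟨rfl, rfl⟩ | ⟨rfl, rfl⟩ | ⟨rfl, rfl⟩ <;>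
      exact c_eq_ctx p q [0] [] (by decide)
  have e5 : D.c W (p ++ ([-j, -i, j] ++ q)) = D.c W (p ++ ([i, -j, -i] ++ q)) := by
    rcases h with ⟨rfl, rfl⟩ | ⟨rfl, rfl⟩ | ⟨rfl, rfl⟩ | ⟨rfl, rfl⟩ | ⟨rfl, rfl⟩ | ⟨rfl, rfl⟩ <;>
      exact c_eq_ctx p q [0] [] (by decide)
  have e6 : D.c W (p ++ ([-i, -j, i, j] ++ q)) = D.c W (p ++ ([j, -i] ++ q)) := by
    rcases h with ⟨rfl, rfl⟩ | ⟨rfl, rfl⟩ | ⟨rfl, rfl⟩ | ⟨rfl, rfl⟩ | ⟨rfl, rfl⟩ | ⟨rfl, rfl⟩ <;>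
      exact c_eq_ctx p q [0, 2] [] (by decide)
  have e7 : D.c W (p ++ ([i, -j, -i, j] ++ q)) = D.c W (p ++ ([i, i, -j, -i] ++ q)) := by
    rcases h with ⟨rfl, rfl⟩ | ⟨rfl, rfl⟩ | ⟨rfl, rfl⟩ | ⟨rfl, rfl⟩ | ⟨rfl, rfl⟩ | ⟨rfl, rfl⟩ <;>
      exact c_eq_ctx p q [1] [] (by decide)
  simp only [List.cons_append, List.nil_append] at e0 e1 e2 e3 e4 e5 e6 e7
  rw [e0, e1, e2, e3, e4, e5, e6, e7] at h₁
  rw [h₁]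
  abel

end CubicSys

/-! ### Symmetries and the filtration by the number of letters `4` and `-4` -/

/-- The number of letters `4` and `-4` of a word. -/
def count4 (l : List ℤ) : ℕ := l.countP fun a => a.natAbs = 4

/-- Words in the first two generators. -/
def Low (l : List ℤ) : Prop := ∀ a ∈ l, a.natAbs ≤ 2

/-- Words in the first three generators. -/
def Mid (l : List ℤ) : Prop := ∀ a ∈ l, a.natAbs ≤ 3

instance : DecidablePred Low := fun _ => inferInstanceAs (Decidable (∀ _ ∈ _, _))

instance : DecidablePred Mid := fun _ => inferInstanceAs (Decidable (∀ _ ∈ _, _))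

theorem Low.mid {l : List ℤ} (h : Low l) : Mid l := fun a ha => (h a ha).trans (by norm_num)

theorem Low.append {l l' : List ℤ} (h : Low l) (h' : Low l') : Low (l ++ l') := by
  intro a ha
  rcases List.mem_append.1 ha with ha | ha
  exacts [h a ha, h' a ha]

theorem Mid.append {l l' : List ℤ} (h : Mid l) (h' : Mid l') : Mid (l ++ l') := by
  intro a ha
  rcases List.mem_append.1 ha with ha | ha
  exacts [h a ha, h' a ha]

theorem Low.reverse {l : List ℤ} (h : Low l) : Low l.reverse := by simpa [Low] using h

theorem Mid.reverse {l : List ℤ} (h : Mid l) : Mid l.reverse := by simpa [Mid] using h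

theorem Low.neg {l : List ℤ} (h : Low l) : Low (l.map Neg.neg) := by
  intro a ha
  obtain ⟨b, hb, rfl⟩ := List.mem_map.1 ha
  rw [Int.natAbs_neg]
  exact h b hb

theorem Mid.neg {l : List ℤ} (h : Mid l) : Mid (l.map Neg.neg) := by
  intro a ha
  obtain ⟨b, hb, rfl⟩ := List.mem_map.1 ha
  rw [Int.natAbs_neg]
  exact h b hb

theorem Low.cons {a : ℤ} {l : List ℤ} (ha : a.natAbs ≤ 2) (h : Low l) : Low (a :: l) := by
  simpa [Low, ha] using h

theorem Mid.cons {a : ℤ} {l : List ℤ} (ha : a.natAbs ≤ 3) (h : Mid l) : Mid (a :: l) := by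
  simpa [Mid, ha] using h

theorem count4_append (l l' : List ℤ) : count4 (l ++ l') = count4 l + count4 l' :=
  List.countP_append ..

theorem count4_cons (a : ℤ) (l : List ℤ) :
    count4 (a :: l) = count4 l + if a.natAbs = 4 then 1 else 0 := by
  simp [count4, List.countP_cons]

theorem count4_neg (l : List ℤ) : count4 (l.map Neg.neg) = count4 l := by
  simp [count4, List.countP_map, Function.comp_def]

theorem Mid.count4 {l : List ℤ} (h : Mid l) : count4 l = 0 := by
  simp only [CubicQuotient.count4, List.countP_eq_zero, decide_eq_true_eq]
  intro a ha e
  have := h a ha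
  omega

theorem Low.count4 {l : List ℤ} (h : Low l) : CubicQuotient.count4 l = 0 := h.mid.count4

namespace CubicSys

variable {k A : Type} [CommRing k] [Ring A] [Algebra k A] (D : CubicSys k A)

theorem w_congr_of_c {l : List ℤ} {a : A} (h : (⊥ : Submodule k A).mkQ a = D.c ⊥ l) :
    D.w l = a := by
  have := (Submodule.Quotient.eq _).1 h
  rw [Submodule.mem_bot, sub_eq_zero] at this
  exact this.symm

/-- Exchange every generator with its inverse. -/
def bar : CubicSys k A where
  f i := D.f (-i)
  f_zero := by rw [neg_zero, D.f_zero]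
  f_inv i := D.f_inv (-i)
  f_comm i j h₁ h₂ h₃ := by
    have := D.w_eq (l := [-i, -j]) (l' := [-j, -i]) [0] [] (by
      have : Far (-i) (-j) := by unfold Far IsGen; omega
      simp [moves, moveAt, headMove, this]
      omega)
    simpa [D.w_cons] using this
  f_braid i h₁ h₂ := by
    have key : ∀ i : ℤ, (i = 1 ∨ i = 2 ∨ i = 3) →
        D.w [-i, -(i + 1), -i] = D.w [-(i + 1), -i, -(i + 1)] := by
      rintro i (rfl | rfl | rfl) <;> exact D.w_eq [0] [] (by decide)
    simpa [D.w_cons, mul_assoc] using key i (by omega)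
  S := D.T * D.V
  T := D.S * D.V
  U := D.V
  V := D.U
  UV := D.VU
  cubic i h₁ h₂ := by
    have h := D.c_cubic' ⊥ i ⟨h₁, h₂⟩ [] []
    have e : ∀ j, D.f j = D.w [j] := fun j => by simp [D.w_cons]
    have e₂ : D.f i * D.f i = D.w [i, i] := by simp [D.w_cons]
    rw [neg_neg, e₂, e, e i, ← D.w_nil]
    refine D.w_congr_of_c ?_
    simp only [map_add, map_sub, map_smul]
    exact h.symm
  -- Inverting all letters only redistributes the terms of the relation between its two sides.
  three i j h := by
    change D.w ([-i, j, i].map Neg.neg) = D.w ([i, j, -i].map Neg.neg)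
      - D.w ([i, j].map Neg.neg)
      + D.w ([i, -j].map Neg.neg) + D.w ([-i, j].map Neg.neg) - D.w ([-i, -j].map Neg.neg)
      + D.w ([j, i].map Neg.neg) - D.w ([j, -i].map Neg.neg) - D.w ([-j, i].map Neg.neg)
      + D.w ([-j, -i].map Neg.neg) + D.w ([-i, -j, i].map Neg.neg)
      - D.w ([i, -j, -i].map Neg.neg)
    have := D.three i j h
    simp only [List.map_cons, List.map_nil, neg_neg]
    rw [this]
    abel

theorem bar_w (l : List ℤ) : D.bar.w l = D.w (l.map Neg.neg) := by
  simp only [BraidSys.w, List.map_map]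
  rfl

theorem bar_w_of {l l' : List ℤ} (h : l.map Neg.neg = l') : D.bar.w l = D.w l' := by
  rw [bar_w, h]

theorem c_bar (W : Submodule k A) (l : List ℤ) : D.bar.c W l = D.c W (l.map Neg.neg) := by
  rw [c, bar_w, c]

/-- Exchange left and right. -/
def op : CubicSys k Aᵐᵒᵖ where
  f i := MulOpposite.op (D.f i)
  f_zero := by rw [D.f_zero, MulOpposite.op_one]
  f_inv i := by rw [← MulOpposite.op_mul, D.f_inv', MulOpposite.op_one]
  f_comm i j h₁ h₂ h₃ := by
    rw [← MulOpposite.op_mul, ← MulOpposite.op_mul, D.f_comm i j h₁ h₂ h₃]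
  f_braid i h₁ h₂ := by
    simp only [← MulOpposite.op_mul, ← mul_assoc]
    rw [D.f_braid i h₁ h₂]
  S := D.S
  T := D.T
  U := D.U
  V := D.V
  UV := D.UV
  cubic i h₁ h₂ := by
    rw [D.cubic i h₁ h₂]
    simp
  -- Reversing all words changes the sign of the difference of the two sides.
  three i j h := by
    have := congrArg MulOpposite.op (D.three i j h)
    simp only [BraidSys.w_cons, BraidSys.w_nil, mul_one, MulOpposite.op_mul,
      MulOpposite.op_add, MulOpposite.op_sub, mul_assoc] at this ⊢
    rw [eq_comm, ← sub_eq_zero] at this ⊢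
    rw [← neg_eq_zero, ← this]
    abel

theorem op_w (l : List ℤ) : D.op.w l = MulOpposite.op (D.w l.reverse) := by
  induction l with
  | nil => simp
  | cons a l ih =>
    rw [BraidSys.w_cons, ih, List.reverse_cons, D.w_append, D.w_cons, D.w_nil, mul_one,
      MulOpposite.op_mul]
    rfl

theorem op_w_of {l l' : List ℤ} (h : l.reverse = l') : D.op.w l = MulOpposite.op (D.w l') := by
  rw [op_w, h]

/-- The span of the words with at most `n` letters `4` and `-4`. -/
def N (n : ℕ) : Submodule k A := Submodule.span k {a | ∃ l, count4 l ≤ n ∧ D.w l = a}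

theorem w_mem_N {n : ℕ} {l : List ℤ} (h : count4 l ≤ n) : D.w l ∈ D.N n :=
  Submodule.subset_span ⟨l, h, rfl⟩

theorem N_bar (n : ℕ) : D.bar.N n = D.N n := by
  have key : ∀ E : CubicSys k A, E.bar.N n ≤ E.N n := by
    intro E
    refine Submodule.span_le.2 ?_
    rintro _ ⟨l, hl, rfl⟩
    rw [bar_w]
    refine E.w_mem_N ?_
    rwa [count4_neg]
  refine (key D).antisymm ?_
  have h := key D.bar
  have e : D.bar.bar.N n = D.N n := by
    have : D.bar.bar.w = D.w := by
      funext l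
      simp [BraidSys.w, bar]
    simp only [N, this]
  rwa [e] at h

/-- The class of a word modulo `N 2`. -/
abbrev m (l : List ℤ) : A ⧸ D.N 2 := D.c (D.N 2) l

variable {D}

theorem m_zero {l : List ℤ} (h : count4 l ≤ 2) : D.m l = 0 :=
  D.c_eq_zero.2 (D.w_mem_N h)

variable (D)

/-- The map on classes induced by the exchange of left and right. -/
def rev : (Aᵐᵒᵖ ⧸ D.op.N 2) →ₗ[k] A ⧸ D.N 2 :=
  (D.op.N 2).liftQ ((D.N 2).mkQ ∘ₗ (MulOpposite.opLinearEquiv k).symm.toLinearMap) (by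
    refine Submodule.span_le.2 ?_
    rintro _ ⟨l, hl, rfl⟩
    simp only [SetLike.mem_coe, LinearMap.mem_ker, LinearMap.comp_apply, LinearEquiv.coe_coe,
      op_w]
    refine m_zero (D := D) ?_
    rwa [count4, List.countP_reverse])

theorem rev_m (l : List ℤ) : D.rev (D.op.m l) = D.m l.reverse := by
  simp only [m, c, rev, Submodule.mkQ_apply, op_w]
  rfl

/-- The identity map on classes, for generators exchanged with their inverses. -/
def inv : (A ⧸ D.bar.N 2) →ₗ[k] A ⧸ D.N 2 :=
  (D.bar.N 2).mapQ (D.N 2) LinearMap.id (D.N_bar 2).le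

theorem inv_m (l : List ℤ) : D.inv (D.bar.m l) = D.m (l.map Neg.neg) :=
  D.c_bar (D.N 2) l

theorem bar_m_eq_zero {l : List ℤ} (h : D.bar.m l = 0) : D.m (l.map Neg.neg) = 0 := by
  rw [← inv_m, h, map_zero]

theorem op_m_eq_zero {l : List ℤ} (h : D.op.m l = 0) : D.m l.reverse = 0 := by
  rw [← rev_m, h, map_zero]

/-- Multiplication of classes by words in the first three generators. -/
def act (p q : List ℤ) (hp : Mid p) (hq : Mid q) : (A ⧸ D.N 2) →ₗ[k] A ⧸ D.N 2 :=
  (D.N 2).liftQ (D.ctx (D.N 2) p q) (by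
    refine Submodule.span_le.2 ?_
    rintro _ ⟨l, hl, rfl⟩
    rw [SetLike.mem_coe, LinearMap.mem_ker, ctx_w]
    refine m_zero ?_
    rw [count4_append, count4_append, hp.count4, hq.count4]
    omega)

theorem act_m (p q : List ℤ) (hp : Mid p) (hq : Mid q) (l : List ℤ) :
    D.act p q hp hq (D.m l) = D.m (p ++ (l ++ q)) := by
  exact D.ctx_w _ p q l

variable {D}

theorem m_ctx_zero {l : List ℤ} (p q : List ℤ) (hp : Mid p) (hq : Mid q) (h : D.m l = 0) :
    D.m (p ++ (l ++ q)) = 0 := by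
  rw [← D.act_m p q hp hq, h, map_zero]

/-- A letter commutes with a word all of whose letters commute with it. -/
theorem c_comm {W : Submodule k A} (a : ℤ) {q : List ℤ} (h : ∀ b ∈ q, b = 0 ∨ Far a b)
    (p r : List ℤ) : D.c W (p ++ a :: (q ++ r)) = D.c W (p ++ (q ++ a :: r)) := by
  have key : D.f a * D.w q = D.w q * D.f a := by
    induction q with
    | nil => simp
    | cons b q ih =>
      have hb : D.f a * D.f b = D.f b * D.f a := by
        rcases h b (by simp) with rfl | hb
        · simp [D.f_zero]
        · exact congrArg Units.val (D.u_comm hb)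
      rw [D.w_cons, ← mul_assoc, hb, mul_assoc, ih fun c hc => h c (by simp [hc]), mul_assoc]
  simp only [c, D.w_append, D.w_cons]
  rw [← mul_assoc (D.f a), key, mul_assoc]

theorem Low.far {a : ℤ} (ha : a.natAbs = 4) {q : List ℤ} (h : Low q) :
    ∀ b ∈ q, b = 0 ∨ Far a b := by
  intro b hb
  have := h b hb
  unfold Far IsGen
  omega

/-- `4` and `-4` commute with the words in the first two generators. -/
theorem c_low_comm {W : Submodule k A} (a : ℤ) (ha : a.natAbs = 4) {q : List ℤ} (h : Low q)
    (p r : List ℤ) : D.c W (p ++ a :: (q ++ r)) = D.c W (p ++ (q ++ a :: r)) :=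
  c_comm a (Low.far ha h) p r

end CubicSys

namespace CubicSys

variable {k A : Type} [CommRing k] [Ring A] [Algebra k A] (D : CubicSys k A)

/-! ### Spans of words stable under multiplication by generators -/

/-- The span of the words with a given property. -/
def wspan (P : List ℤ → Prop) : Submodule k A := Submodule.span k {a | ∃ l, P l ∧ D.w l = a}

variable {D}

theorem c_wspan {P : List ℤ → Prop} {l : List ℤ} (h : P l) : D.c (D.wspan P) l = 0 :=
  D.c_eq_zero.2 (Submodule.subset_span ⟨l, h, rfl⟩)

theorem wspan_mul_left {P : List ℤ → Prop} {W : Submodule k A} (a : ℤ)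
    (h : ∀ l, P l → D.c W (a :: l) = 0) {x : A} (hx : x ∈ D.wspan P) : D.f a * x ∈ W := by
  have : D.wspan P ≤ W.comap (LinearMap.mulLeft k (D.f a)) := by
    refine Submodule.span_le.2 ?_
    rintro _ ⟨l, hl, rfl⟩
    rw [SetLike.mem_coe, Submodule.mem_comap, LinearMap.mulLeft_apply, ← D.w_cons]
    exact D.c_eq_zero.1 (h l hl)
  exact this hx

theorem wspan_mul_right {P : List ℤ → Prop} {W : Submodule k A} (a : ℤ)
    (h : ∀ l, P l → D.c W (l ++ [a]) = 0) {x : A} (hx : x ∈ D.wspan P) : x * D.f a ∈ W := by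
  have : D.wspan P ≤ W.comap (LinearMap.mulRight k (D.f a)) := by
    refine Submodule.span_le.2 ?_
    rintro _ ⟨l, hl, rfl⟩
    have := D.c_eq_zero.1 (h l hl)
    rw [D.w_append, D.w_cons, D.w_nil, mul_one] at this
    exact this
  exact this hx

/-- By the cubic relation the inverse of a generator is a polynomial in it, so stability needs to be
checked for positive letters only. -/
theorem neg_mul_mem {W : Submodule k A} (a : ℤ) (ha : 1 ≤ a ∧ a ≤ 4)
    (h : ∀ x ∈ W, D.f a * x ∈ W) {x : A} (hx : x ∈ W) : D.f (-a) * x ∈ W := by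
  have := D.bar.cubic a ha.1 ha.2
  change D.f (-a) = (D.T * D.V) • (1 : A) - (D.S * D.V) • D.f (- -a)
    + D.V • (D.f (- -a) * D.f (- -a)) at this
  rw [this, neg_neg, add_mul, sub_mul, smul_mul_assoc, smul_mul_assoc, smul_mul_assoc, one_mul,
    mul_assoc]
  exact W.add_mem (W.sub_mem (W.smul_mem _ hx) (W.smul_mem _ (h x hx)))
    (W.smul_mem _ (h _ (h x hx)))

theorem mul_neg_mem {W : Submodule k A} (a : ℤ) (ha : 1 ≤ a ∧ a ≤ 4)
    (h : ∀ x ∈ W, x * D.f a ∈ W) {x : A} (hx : x ∈ W) : x * D.f (-a) ∈ W := by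
  have := D.bar.cubic a ha.1 ha.2
  change D.f (-a) = (D.T * D.V) • (1 : A) - (D.S * D.V) • D.f (- -a)
    + D.V • (D.f (- -a) * D.f (- -a)) at this
  rw [this, neg_neg, mul_add, mul_sub, mul_smul_comm, mul_smul_comm, mul_smul_comm, mul_one,
    ← mul_assoc]
  exact W.add_mem (W.sub_mem (W.smul_mem _ hx) (W.smul_mem _ (h x hx)))
    (W.smul_mem _ (h _ (h x hx)))

theorem w_mul_mem {W : Submodule k A} (n : ℕ) (hn : n ≤ 4)
    (h : ∀ a : ℤ, 1 ≤ a → a ≤ n → ∀ x ∈ W, D.f a * x ∈ W) {l : List ℤ}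
    (hl : ∀ a ∈ l, a.natAbs ≤ n) {x : A} (hx : x ∈ W) : D.w l * x ∈ W := by
  induction l with
  | nil => simpa
  | cons a l ih =>
    rw [D.w_cons, mul_assoc]
    have ih' := ih fun b hb => hl b (by simp [hb])
    have ha := hl a (by simp)
    rcases lt_trichotomy a 0 with h₀ | rfl | h₀
    · obtain ⟨b, rfl⟩ : ∃ b, a = -b := ⟨-a, (neg_neg a).symm⟩
      exact neg_mul_mem b (by omega) (h b (by omega) (by omega)) ih'
    · rwa [D.f_zero, one_mul]
    · exact h a (by omega) (by omega) _ ih'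

theorem mul_w_mem {W : Submodule k A} (n : ℕ) (hn : n ≤ 4)
    (h : ∀ a : ℤ, 1 ≤ a → a ≤ n → ∀ x ∈ W, x * D.f a ∈ W) {l : List ℤ}
    (hl : ∀ a ∈ l, a.natAbs ≤ n) {x : A} (hx : x ∈ W) : x * D.w l ∈ W := by
  induction l generalizing x with
  | nil => simpa
  | cons a l ih =>
    rw [D.w_cons, ← mul_assoc]
    refine ih (fun b hb => hl b (by simp [hb])) ?_
    have ha := hl a (by simp)
    rcases lt_trichotomy a 0 with h₀ | rfl | h₀
    · obtain ⟨b, rfl⟩ : ∃ b, a = -b := ⟨-a, (neg_neg a).symm⟩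
      exact mul_neg_mem b (by omega) (h b (by omega) (by omega)) hx
    · rwa [D.f_zero, mul_one]
    · exact h a (by omega) (by omega) _ hx

/-! ### The algebra on three strands -/

/-- The words spanning the algebra on three strands. -/
def Span3 (i j : ℤ) (l : List ℤ) : Prop :=
  (∃ a b c, (a = 0 ∨ a = i ∨ a = -i) ∧ (b = 0 ∨ b = j ∨ b = -j) ∧ (c = 0 ∨ c = i ∨ c = -i) ∧
    l = [a, b, c]) ∨ l = [j, -i, j]

/-- On words i^a j^b i^c this is the cubic relation. On the peak j i' j it is `c_peak_mul`, whose
other terms have the form i^a j^b i^c once the squares are reduced. -/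
theorem span3_right (i j : ℤ) (h : (i = 1 ∧ j = 2) ∨ (i = 2 ∧ j = 1)) {x : A}
    (hx : x ∈ D.wspan (Span3 i j)) : x * D.f i ∈ D.wspan (Span3 i j) := by
  have hi : 1 ≤ i ∧ i ≤ 4 := by omega
  have hij : Adj i j := by unfold Adj; omega
  have hi₀ : i ≠ 0 := by omega
  have hj₀ : j ≠ 0 := by omega
  have g : ∀ a b c, (a = 0 ∨ a = i ∨ a = -i) → (b = 0 ∨ b = j ∨ b = -j) →
      (c = 0 ∨ c = i ∨ c = -i) → D.c (D.wspan (Span3 i j)) [a, b, c] = 0 :=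
    fun a b c ha hb hc => c_wspan (Or.inl ⟨a, b, c, ha, hb, hc, rfl⟩)
  have z : ∀ {l l' : List ℤ}, l.filter (· ≠ 0) = l'.filter (· ≠ 0) →
      D.c (D.wspan (Span3 i j)) l' = 0 → D.c (D.wspan (Span3 i j)) l = 0 :=
    fun h h' => (D.c_filter _ h).trans h'
  have g₁ : ∀ a b c, (a = 0 ∨ a = i ∨ a = -i) → (b = 0 ∨ b = j ∨ b = -j) →
      (c = 0 ∨ c = i ∨ c = -i) → D.c (D.wspan (Span3 i j)) [a, b, c, i] = 0 := by
    intro a b c ha hb hc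
    rcases hc with hc | hc | hc <;> rw [hc]
    · exact (D.c_zero _ [a, b] [i]).trans (z (by simp) (g a b i ha hb (by simp)))
    · have := D.c_cubic (D.wspan (Span3 i j)) i hi [a, b, i] []
      have e₁ := D.c_cancel (D.wspan (Span3 i j)) i [a, b] []
      have e₂ := D.c_cancel (D.wspan (Span3 i j)) i [a, b] [-i]
      have e₃ := D.c_zero (D.wspan (Span3 i j)) [a, b] []
      simp only [List.cons_append, List.nil_append, List.append_nil] at this e₁ e₂ e₃
      rw [this, e₁, e₂, g a b i ha hb (by simp), g a b (-i) ha hb (by simp), ← e₃,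
        g a b 0 ha hb (by simp)]
      simp
    · have e₁ := D.c_cancel' (D.wspan (Span3 i j)) i [a, b] []
      have e₃ := D.c_zero (D.wspan (Span3 i j)) [a, b] []
      simp only [List.cons_append, List.nil_append, List.append_nil] at e₁ e₃
      rw [e₁, ← e₃]
      exact g a b 0 ha hb (by simp)
  refine wspan_mul_right i ?_ hx
  rintro _ (⟨a, b, c, ha, hb, hc, rfl⟩ | rfl)
  · exact g₁ a b c ha hb hc
  · have := D.c_peak_mul (D.wspan (Span3 i j)) i j hij [] []
    simp only [List.cons_append, List.nil_append] at this ⊢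
    have sq : ∀ q, D.c (D.wspan (Span3 i j)) (j :: q) = 0 → D.c (D.wspan (Span3 i j)) q = 0 →
        D.c (D.wspan (Span3 i j)) (-j :: q) = 0 → D.c (D.wspan (Span3 i j)) (j :: j :: q) = 0 := by
      intro q h₁ h₂ h₃
      have := D.c_cubic (D.wspan (Span3 i j)) j (by omega) [j] q
      have e₁ := D.c_cancel (D.wspan (Span3 i j)) j [] q
      have e₂ := D.c_cancel (D.wspan (Span3 i j)) j [] (-j :: q)
      simp only [List.cons_append, List.nil_append] at this e₁ e₂
      rw [this, e₁, e₂, h₁, h₂, h₃]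
      simp
    have hv : D.c (D.wspan (Span3 i j)) [j, -i, j] = 0 := c_wspan (Or.inr rfl)
    have t₁ : D.c (D.wspan (Span3 i j)) [i, j] = 0 :=
      z (by simp [hi₀, hj₀]) (g i j 0 (by simp) (by simp) (by simp))
    have t₂ : D.c (D.wspan (Span3 i j)) [i, j, i] = 0 := g i j i (by simp) (by simp) (by simp)
    have t₃ : D.c (D.wspan (Span3 i j)) [-i, j, i] = 0 := g (-i) j i (by simp) (by simp) (by simp)
    have t₄ : D.c (D.wspan (Span3 i j)) [-i, -j, i] = 0 :=
      g (-i) (-j) i (by simp) (by simp) (by simp)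
    have t₅ : D.c (D.wspan (Span3 i j)) [-i, -j, i, i] = 0 :=
      g₁ (-i) (-j) i (by simp) (by simp) (by simp)
    have t₆ : D.c (D.wspan (Span3 i j)) [-i, j] = 0 :=
      z (by simp [hi₀, hj₀]) (g (-i) j 0 (by simp) (by simp) (by simp))
    have y₁ : D.c (D.wspan (Span3 i j)) [j, i] = 0 :=
      z (by simp [hi₀, hj₀]) (g 0 j i (by simp) (by simp) (by simp))
    have y₂ : D.c (D.wspan (Span3 i j)) [j, -i] = 0 :=
      z (by simp [hi₀, hj₀]) (g 0 j (-i) (by simp) (by simp) (by simp))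
    have y₃ : D.c (D.wspan (Span3 i j)) [i] = 0 :=
      z (by simp [hi₀]) (g 0 0 i (by simp) (by simp) (by simp))
    have y₄ : D.c (D.wspan (Span3 i j)) [-i] = 0 :=
      z (by simp [hi₀]) (g 0 0 (-i) (by simp) (by simp) (by simp))
    have y₅ : D.c (D.wspan (Span3 i j)) [-j, i] = 0 :=
      z (by simp [hi₀, hj₀]) (g 0 (-j) i (by simp) (by simp) (by simp))
    have y₆ : D.c (D.wspan (Span3 i j)) [-j, -i] = 0 :=
      z (by simp [hi₀, hj₀]) (g 0 (-j) (-i) (by simp) (by simp) (by simp))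
    have t₇ := sq [i] y₁ y₃ y₅
    have t₈ := sq [-i] y₂ y₄ y₆
    rw [this, hv, t₁, t₂, t₃, t₄, t₅, t₆, t₇, t₈, y₃, y₄]
    simp

/-- It suffices to treat j i^a j^b, by braid relations and the cubic relation: the last factor i^c
is restored afterwards by `span3_right`. -/
theorem span3_left (i j : ℤ) (h : (i = 1 ∧ j = 2) ∨ (i = 2 ∧ j = 1)) {x : A}
    (hx : x ∈ D.wspan (Span3 i j)) : D.f j * x ∈ D.wspan (Span3 i j) := by
  have hij : Adj i j := by unfold Adj; omega
  have hi₀ : i ≠ 0 := by omega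
  have hj₀ : j ≠ 0 := by omega
  set W := D.wspan (Span3 i j) with hW
  have g : ∀ a b c, (a = 0 ∨ a = i ∨ a = -i) → (b = 0 ∨ b = j ∨ b = -j) →
      (c = 0 ∨ c = i ∨ c = -i) → D.c W [a, b, c] = 0 :=
    fun a b c ha hb hc => c_wspan (Or.inl ⟨a, b, c, ha, hb, hc, rfl⟩)
  have z : ∀ {l l' : List ℤ}, l.filter (· ≠ 0) = l'.filter (· ≠ 0) →
      D.c W l' = 0 → D.c W l = 0 := fun h h' => (D.c_filter _ h).trans h'
  have hv : D.c W [j, -i, j] = 0 := c_wspan (Or.inr rfl)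
  have sq : ∀ q, D.c W (j :: q) = 0 → D.c W q = 0 → D.c W (-j :: q) = 0 →
      D.c W (j :: j :: q) = 0 := by
    intro q h₁ h₂ h₃
    have := D.c_cubic W j (by omega) [j] q
    have e₁ := D.c_cancel W j [] q
    have e₂ := D.c_cancel W j [] (-j :: q)
    simp only [List.cons_append, List.nil_append] at this e₁ e₂
    rw [this, e₁, e₂, h₁, h₂, h₃]
    simp
  have y₀ : D.c W [] = 0 := z (by simp) (g 0 0 0 (by simp) (by simp) (by simp))
  have y₁ : D.c W [j] = 0 := z (by simp [hj₀]) (g 0 j 0 (by simp) (by simp) (by simp))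
  have y₂ : D.c W [-j] = 0 := z (by simp [hj₀]) (g 0 (-j) 0 (by simp) (by simp) (by simp))
  have g₂ : ∀ a b, (a = 0 ∨ a = i ∨ a = -i) → (b = 0 ∨ b = j ∨ b = -j) →
      D.c W [j, a, b] = 0 := by
    rintro a b (ha | ha | ha) (hb | hb | hb) <;> subst ha <;> subst hb
    · exact z (by simp [hj₀]) y₁
    · exact z (by simp [hj₀]) (sq [] y₁ y₀ y₂)
    · have := D.c_cancel W j [] []
      exact z (by simp [hj₀]) (this.trans y₀)
    · exact z (by simp [hi₀, hj₀]) (g 0 j a (by simp) (by simp) (by simp))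
    · have : D.c W [b, a, b] = D.c W [a, b, a] := by
        rcases h with ⟨rfl, rfl⟩ | ⟨rfl, rfl⟩ <;> exact c_eq [0] [] (by decide)
      exact this.trans (g a b a (by simp) (by simp) (by simp))
    · have : D.c W [j, a, -j] = D.c W [-a, j, a] := by
        rcases h with ⟨rfl, rfl⟩ | ⟨rfl, rfl⟩ <;> exact c_eq [0] [] (by decide)
      exact this.trans (g (-a) j a (by simp) (by simp) (by simp))
    · exact z (by simp [hi₀, hj₀]) (g 0 j (-i) (by simp) (by simp) (by simp))
    · exact hv
    · have : D.c W [j, -i, -j] = D.c W [-i, -j, i] := by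
        rcases h with ⟨rfl, rfl⟩ | ⟨rfl, rfl⟩ <;> exact c_eq [0] [] (by decide)
      exact this.trans (g (-i) (-j) i (by simp) (by simp) (by simp))
  refine wspan_mul_left j ?_ hx
  rintro _ (⟨a, b, c, ha, hb, hc, rfl⟩ | rfl)
  · have h₁ := D.c_eq_zero.1 (g₂ a b ha hb)
    have h₂ : D.w [j, a, b] * D.w [c] ∈ W := by
      have e : D.w [c] = D.f c := by simp [D.w_cons]
      rw [e]
      rcases hc with hc | hc | hc <;> rw [hc]
      · rwa [D.f_zero, mul_one]
      · exact span3_right i j h h₁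
      · exact mul_neg_mem i (by omega) (fun y hy => span3_right i j h hy) h₁
    rw [← D.w_append] at h₂
    exact D.c_eq_zero.2 h₂
  · have y₃ : D.c W [-i, j] = 0 := z (by simp [hi₀, hj₀]) (g (-i) j 0 (by simp) (by simp) (by simp))
    have y₄ : D.c W [-j, -i, j] = 0 := by
      have : D.c W [-j, -i, j] = D.c W [i, -j, -i] := by
        rcases h with ⟨rfl, rfl⟩ | ⟨rfl, rfl⟩ <;> exact c_eq [0] [] (by decide)
      exact this.trans (g i (-j) (-i) (by simp) (by simp) (by simp))
    exact sq [-i, j] hv y₃ y₄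

theorem op_mem_wspan {P : List ℤ → Prop} (hP : ∀ l, P l → P l.reverse) (x : A) :
    MulOpposite.op x ∈ D.op.wspan P ↔ x ∈ D.wspan P := by
  constructor
  · intro hx
    have : D.op.wspan P ≤ (D.wspan P).comap (MulOpposite.opLinearEquiv k).symm.toLinearMap := by
      refine Submodule.span_le.2 ?_
      rintro _ ⟨l, hl, rfl⟩
      rw [op_w]
      exact Submodule.subset_span ⟨_, hP l hl, rfl⟩
    exact this hx
  · intro hx
    have : D.wspan P ≤ (D.op.wspan P).comap (MulOpposite.opLinearEquiv k).toLinearMap := by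
      refine Submodule.span_le.2 ?_
      rintro _ ⟨l, hl, rfl⟩
      refine Submodule.subset_span ⟨_, hP l hl, ?_⟩
      rw [op_w, List.reverse_reverse]
      rfl
    exact this hx

theorem span3_left' (i j : ℤ) (h : (i = 1 ∧ j = 2) ∨ (i = 2 ∧ j = 1)) {x : A}
    (hx : x ∈ D.wspan (Span3 i j)) : D.f i * x ∈ D.wspan (Span3 i j) := by
  have hP : ∀ l, Span3 i j l → Span3 i j l.reverse := by
    rintro _ (⟨a, b, c, ha, hb, hc, rfl⟩ | rfl)
    exacts [Or.inl ⟨c, b, a, hc, hb, ha, rfl⟩, Or.inr rfl]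
  rw [← op_mem_wspan hP] at hx ⊢
  exact span3_right i j h hx

/-- A submodule containing the spanning words of the algebra on three strands contains all the
words in the first two generators. -/
theorem low_zero (i j : ℤ) (h : (i = 1 ∧ j = 2) ∨ (i = 2 ∧ j = 1)) {M : Type} [AddCommGroup M]
    [Module k M] (φ : A →ₗ[k] M)
    (h₁ : ∀ a b c, (a = 0 ∨ a = i ∨ a = -i) → (b = 0 ∨ b = j ∨ b = -j) →
      (c = 0 ∨ c = i ∨ c = -i) → φ (D.w [a, b, c]) = 0)
    (h₂ : φ (D.w [j, -i, j]) = 0) {l : List ℤ} (hl : Low l) : φ (D.w l) = 0 := by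
  have h₃ : D.wspan (Span3 i j) ≤ LinearMap.ker φ := by
    refine Submodule.span_le.2 ?_
    rintro _ ⟨_, ⟨a, b, c, ha, hb, hc, rfl⟩ | rfl, rfl⟩
    exacts [h₁ a b c ha hb hc, h₂]
  -- The unit lies in the span, so every word in 1 and 2 is reached from it by left multiplications.
  have one : D.w [0, 0, 0] ∈ D.wspan (Span3 i j) :=
    Submodule.subset_span ⟨_, Or.inl ⟨0, 0, 0, by simp, by simp, by simp, rfl⟩, rfl⟩
  have e : D.w [0, 0, 0] = 1 := by simp [D.w_cons, D.f_zero]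
  refine h₃ ?_
  rw [← mul_one (D.w l), ← e]
  refine w_mul_mem 2 (by norm_num) ?_ hl one
  intro a ha₁ ha₂ x hx
  obtain rfl | rfl : a = i ∨ a = j := by push_cast at ha₂; omega
  · exact span3_left' a j h hx
  · exact span3_left i a h hx

end CubicSys

namespace CubicSys

variable {k A : Type} [CommRing k] [Ring A] [Algebra k A] {D : CubicSys k A}

/-! ### The algebra on four strands -/

/-- Words of the form `p e q` with `p`, `q` in the first two generators and
`e ∈ {∅, 3, 3', 32'3, 3'23'}`. -/
def Span4 (l : List ℤ) : Prop :=
  ∃ p e q, Low p ∧ Low q ∧ (e = [0] ∨ e = [3] ∨ e = [-3] ∨ e = [3, -2, 3] ∨ e = [-3, 2, -3]) ∧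
    l = p ++ (e ++ q)

theorem Span4.reverse {l : List ℤ} (h : Span4 l) : Span4 l.reverse := by
  obtain ⟨p, e, q, hp, hq, he, rfl⟩ := h
  refine ⟨q.reverse, e.reverse, p.reverse, hq.reverse, hp.reverse, ?_, by simp⟩
  rcases he with rfl | rfl | rfl | rfl | rfl <;> simp

theorem Span4.neg {l : List ℤ} (h : Span4 l) : Span4 (l.map Neg.neg) := by
  obtain ⟨p, e, q, hp, hq, he, rfl⟩ := h
  refine ⟨p.map Neg.neg, e.map Neg.neg, q.map Neg.neg, hp.neg, hq.neg, ?_, by simp⟩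
  rcases he with rfl | rfl | rfl | rfl | rfl <;> simp

variable (D) in
/-- The span of the words `p e q`. -/
abbrev W4 : Submodule k A := D.wspan Span4

theorem W4_word {p e q : List ℤ} (hp : Low p) (hq : Low q)
    (he : e = [0] ∨ e = [3] ∨ e = [-3] ∨ e = [3, -2, 3] ∨ e = [-3, 2, -3]) :
    D.c D.W4 (p ++ (e ++ q)) = 0 :=
  c_wspan ⟨p, e, q, hp, hq, he, rfl⟩

theorem W4_ctx_mem {p q : List ℤ} (hp : Low p) (hq : Low q) {x : A} (h : x ∈ D.W4) :
    D.w p * x * D.w q ∈ D.W4 := by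
  refine mul_w_mem 2 (by norm_num) ?_ hq (w_mul_mem 2 (by norm_num) ?_ hp h)
  · intro a ha₁ ha₂ x hx
    refine wspan_mul_right a ?_ hx
    rintro _ ⟨p, e, q, hp, hq, he, rfl⟩
    refine c_wspan ⟨p, e, q ++ [a], hp, hq.append ?_, he, by simp⟩
    intro b hb
    rw [List.mem_singleton] at hb
    subst hb
    push_cast at ha₂
    omega
  · intro a ha₁ ha₂ x hx
    refine wspan_mul_left a ?_ hx
    rintro _ ⟨p, e, q, hp, hq, he, rfl⟩
    exact c_wspan ⟨a :: p, e, q, hp.cons (by push_cast at ha₂; omega), hq, he, by simp⟩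

theorem W4_ctx {p q l : List ℤ} (hp : Low p) (hq : Low q) (h : D.c D.W4 l = 0) :
    D.c D.W4 (p ++ (l ++ q)) = 0 := by
  rw [c_eq_zero] at h ⊢
  rw [D.w_append, D.w_append, ← mul_assoc]
  exact W4_ctx_mem hp hq h

theorem W4_ctx_eq {p q l l' : List ℤ} (hp : Low p) (hq : Low q) (h : D.c D.W4 l = D.c D.W4 l') :
    D.c D.W4 (p ++ (l ++ q)) = D.c D.W4 (p ++ (l' ++ q)) := by
  have := W4_ctx_mem hp hq ((Submodule.Quotient.eq _).1 h)
  refine (Submodule.Quotient.eq _).2 ?_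
  rwa [D.w_append, D.w_append, D.w_append p, D.w_append, ← mul_assoc, ← mul_assoc, ← sub_mul,
    ← mul_sub]

/-- `3^± b 3^±` for `b` a power of the second generator. -/
theorem W4_three {a b c : ℤ} (ha : a = 3 ∨ a = -3) (hb : b = 0 ∨ b = 2 ∨ b = -2)
    (hc : c = 3 ∨ c = -3) : D.c D.W4 [a, b, c] = 0 := by
  have g : ∀ {p e q : List ℤ}, Low p → Low q →
    (e = [0] ∨ e = [3] ∨ e = [-3] ∨ e = [3, -2, 3] ∨ e = [-3, 2, -3]) →
    D.c D.W4 (p ++ (e ++ q)) = 0 := W4_word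
  have g₀ : D.c D.W4 [] = 0 :=
    (D.c_filter _ (by decide)).trans (g (p := []) (e := [0]) (q := []) (by decide) (by decide)
      (by decide))
  have g₁ : D.c D.W4 [3] = 0 := g (p := []) (e := [3]) (q := []) (by decide) (by decide) (by decide)
  have g₂ : D.c D.W4 [-3] = 0 :=
    g (p := []) (e := [-3]) (q := []) (by decide) (by decide) (by decide)
  rcases ha with rfl | rfl <;> rcases hb with rfl | rfl | rfl <;> rcases hc with rfl | rfl
  · refine (D.c_filter _ (l' := [3, 3]) (by decide)).trans ?_
    have h₁ : D.c D.W4 [3, 3] = D.S • D.c D.W4 [3] - D.T • D.c D.W4 [3, -3]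
      + D.U • D.c D.W4 [3, -3, -3] := D.c_cubic _ 3 (by norm_num) [3] []
    have h₂ : D.c D.W4 [3, -3] = D.c D.W4 [] := c_eq [0] [] (by decide)
    have h₃ : D.c D.W4 [3, -3, -3] = D.c D.W4 [-3] := c_eq [0] [] (by decide)
    rw [h₁, h₂, h₃, g₀, g₁, g₂]
    simp
  · exact (D.c_filter _ (l' := [3, -3]) (by decide)).trans
      ((c_eq [0] [] (by decide)).trans g₀)
  · exact (c_eq [0] [] (by decide)).trans
      (g (p := [2]) (e := [3]) (q := [2]) (by decide) (by decide) (by decide))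
  · exact (c_eq [0] [] (by decide)).trans
      (g (p := [-2]) (e := [3]) (q := [2]) (by decide) (by decide) (by decide))
  · exact g (p := []) (e := [3, -2, 3]) (q := []) (by decide) (by decide) (by decide)
  · exact (c_eq [0] [] (by decide)).trans
      (g (p := [-2]) (e := [-3]) (q := [2]) (by decide) (by decide) (by decide))
  · exact (D.c_filter _ (l' := [-3, 3]) (by decide)).trans
      ((c_eq [0] [] (by decide)).trans g₀)
  · refine (D.c_filter _ (l' := [-3, -3]) (by decide)).trans ?_
    have h₁ : D.c D.W4 [-3, -3] = (D.T * D.V) • D.c D.W4 [-3] - (D.S * D.V) • D.c D.W4 [-3, 3]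
      + D.V • D.c D.W4 [-3, 3, 3] := D.c_cubic' _ 3 (by norm_num) [-3] []
    have h₂ : D.c D.W4 [-3, 3] = D.c D.W4 [] := c_eq [0] [] (by decide)
    have h₃ : D.c D.W4 [-3, 3, 3] = D.c D.W4 [3] := c_eq [0] [] (by decide)
    rw [h₁, h₂, h₃, g₀, g₁, g₂]
    simp
  · exact (c_eq [0] [] (by decide)).trans
      (g (p := [2]) (e := [3]) (q := [-2]) (by decide) (by decide) (by decide))
  · exact g (p := []) (e := [-3, 2, -3]) (q := []) (by decide) (by decide) (by decide)
  · exact (c_eq [0] [] (by decide)).trans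
      (g (p := [2]) (e := [-3]) (q := [-2]) (by decide) (by decide) (by decide))
  · exact (c_eq [0] [] (by decide)).trans
      (g (p := [-2]) (e := [-3]) (q := [-2]) (by decide) (by decide) (by decide))

/-- The words in the first generator. -/
def One (l : List ℤ) : Prop := ∀ a ∈ l, a.natAbs ≤ 1

instance : DecidablePred One := fun _ => inferInstanceAs (Decidable (∀ _ ∈ _, _))

theorem One.low {l : List ℤ} (h : One l) : Low l := fun a ha => (h a ha).trans (by norm_num)

theorem One.far {a : ℤ} (ha : 3 ≤ a.natAbs ∧ a.natAbs ≤ 4) {q : List ℤ} (h : One q) :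
    ∀ b ∈ q, b = 0 ∨ Far a b := by
  intro b hb
  have := h b hb
  unfold Far IsGen
  omega

/-- Words in 1 commute with 3^±, so they leave the gap and reduce it to a power of 2. -/
theorem W4_five {a b c : ℤ} {p q : List ℤ} (hp : One p) (hq : One q) (ha : a = 3 ∨ a = -3)
    (hb : b = 0 ∨ b = 2 ∨ b = -2) (hc : c = 3 ∨ c = -3) :
    D.c D.W4 (a :: (p ++ (b :: (q ++ [c])))) = 0 := by
  have h₁ := c_comm (D := D) (W := D.W4) a (hp.far (by omega)) [] (b :: (q ++ [c]))
  have h₂ := c_comm (D := D) (W := D.W4) c (hq.far (by omega)) (p ++ [a, b]) []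
  simp only [List.nil_append, List.append_nil, List.append_assoc, List.cons_append] at h₁ h₂
  rw [h₁, ← h₂]
  simpa using W4_ctx hp.low hq.low (W4_three ha hb hc)

theorem W4_four {a c : ℤ} {p : List ℤ} (hp : One p) (ha : a = 3 ∨ a = -3)
    (hc : c = 3 ∨ c = -3) : D.c D.W4 (a :: (p ++ [c])) = 0 := by
  have := W4_five (D := D) (b := 0) (q := []) hp (by decide) ha (by simp) hc
  have e := D.c_zero D.W4 (a :: p) [c]
  simp only [List.cons_append, List.nil_append] at this e
  rwa [← e]

theorem W4_sq {a c : ℤ} {p q : List ℤ} (hp : One p) (hq : One q) (ha : a = 3 ∨ a = -3)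
    (hc : c = 3 ∨ c = -3) : D.c D.W4 (a :: (p ++ (2 :: (2 :: (q ++ [c]))))) = 0 := by
  have h₁ := D.c_cubic D.W4 2 (by norm_num) (a :: (p ++ [2])) (q ++ [c])
  have e₁ := D.c_cancel D.W4 2 (a :: p) (q ++ [c])
  have e₂ := D.c_cancel D.W4 2 (a :: p) (-2 :: (q ++ [c]))
  have h₂ := W4_five (D := D) (b := 2) hp hq ha (by simp) hc
  have h₃ := W4_five (D := D) (b := -2) hp hq ha (by simp) hc
  have h₄ := W4_five (D := D) (b := 0) hp hq ha (by simp) hc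
  have e₃ := D.c_zero D.W4 (a :: p) (q ++ [c])
  simp only [List.cons_append, List.append_assoc, List.nil_append] at h₁ e₁ e₂ h₂ h₃ h₄ e₃
  rw [h₁, h₂, e₁, e₂, h₃, ← e₃, h₄]
  simp

/-! ### Invariance of w₊ and w₋ under the first two generators -/

/-- The letter 1 passes through 3 and is absorbed by the peak 21'2. The other terms of `c_mul_peak`,
placed between two letters 3, have a gap of the form 1^a 2^b 1^c up to the cubic relation, hence lie
in `W4`. -/
theorem one_mul_wPlus : D.c D.W4 [1, 3, 2, -1, 2, 3] = D.c D.W4 [3, 2, -1, 2, 3] := by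
  have h₀ : D.c D.W4 [1, 3, 2, -1, 2, 3] = D.c D.W4 [3, 1, 2, -1, 2, 3] := c_eq [0] [] (by decide)
  have h := D.c_mul_peak D.W4 1 2 (by decide) [3] [3]
  have f : ∀ {p q : List ℤ} (b : ℤ), One p → One q → (b = 0 ∨ b = 2 ∨ b = -2) →
    D.c D.W4 (3 :: (p ++ (b :: (q ++ [3])))) = 0 := fun b hp hq hb => W4_five hp hq (by simp) hb
        (by simp)
  have s : ∀ {p q : List ℤ}, One p → One q →
    D.c D.W4 (3 :: (p ++ (2 :: (2 :: (q ++ [3]))))) = 0 := fun hp hq => W4_sq hp hq (by simp)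
        (by simp)
  have f₁ := f (p := []) (q := [1]) 2 (by decide) (by decide) (by decide)
  have f₂ := f (p := [1]) (q := [1]) 2 (by decide) (by decide) (by decide)
  have f₃ := f (p := [1]) (q := [-1]) 2 (by decide) (by decide) (by decide)
  have f₄ := f (p := [1]) (q := [-1]) (-2) (by decide) (by decide) (by decide)
  have f₅ := f (p := [1, 1]) (q := [-1]) (-2) (by decide) (by decide) (by decide)
  have f₆ := f (p := []) (q := [-1]) 2 (by decide) (by decide) (by decide)
  have f₇ := s (p := [1]) (q := []) (by decide) (by decide)
  have f₈ := s (p := [-1]) (q := []) (by decide) (by decide)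
  have f₉ := W4_four (D := D) (p := [1]) (a := 3) (c := 3) (by decide) (by decide) (by decide)
  have f₁₀ := W4_four (D := D) (p := [-1]) (a := 3) (c := 3) (by decide) (by decide) (by decide)
  simp only [List.cons_append, List.nil_append] at h f₁ f₂ f₃ f₄ f₅ f₆ f₇ f₈ f₉ f₁₀
  rw [h₀, h, f₁, f₂, f₃, f₄, f₅, f₆, f₇, f₈, f₉, f₁₀]
  simp

/-- As braids, 2w₊ = w₊2. With 1w₊ ≡ w₊ this gives 121w₊ ≡ 12w₊ = 1w₊2 ≡ w₊2, while 212w₊ = 21w₊2 ≡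
2w₊2. Hence 2w₊2 ≡ w₊2, and the final 2 cancels. -/
theorem two_mul_wPlus : D.c D.W4 [2, 3, 2, -1, 2, 3] = D.c D.W4 [3, 2, -1, 2, 3] := by
  have h₁ : D.c D.W4 [1, 2, 1, 3, 2, -1, 2, 3] = D.c D.W4 [1, 2, 3, 2, -1, 2, 3] :=
    W4_ctx_eq (p := [1, 2]) (q := []) (by decide) (by decide) one_mul_wPlus
  have h₂ : D.c D.W4 [1, 2, 3, 2, -1, 2, 3] = D.c D.W4 [1, 3, 2, -1, 2, 3, 2] := c_eq [1, 3] [4]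
      (by decide)
  have h₃ : D.c D.W4 [1, 3, 2, -1, 2, 3, 2] = D.c D.W4 [3, 2, -1, 2, 3, 2] :=
    W4_ctx_eq (p := []) (q := [2]) (by decide) (by decide) one_mul_wPlus
  have h₄ : D.c D.W4 [1, 2, 1, 3, 2, -1, 2, 3] = D.c D.W4 [2, 1, 3, 2, -1, 2, 3, 2] := c_eq [0, 2]
      [5, 4] (by decide)
  have h₅ : D.c D.W4 [2, 1, 3, 2, -1, 2, 3, 2] = D.c D.W4 [2, 3, 2, -1, 2, 3, 2] :=
    W4_ctx_eq (p := [2]) (q := [2]) (by decide) (by decide) one_mul_wPlus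
  have h₆ := h₅.symm.trans (h₄.symm.trans (h₁.trans (h₂.trans h₃)))
  have h₇ := W4_ctx_eq (p := []) (q := [-2]) (by decide) (by decide) h₆
  have h₈ : D.c D.W4 [2, 3, 2, -1, 2, 3, 2, -2] = D.c D.W4 [2, 3, 2, -1, 2, 3] := c_eq [6] []
      (by decide)
  have h₉ : D.c D.W4 [3, 2, -1, 2, 3, 2, -2] = D.c D.W4 [3, 2, -1, 2, 3] := c_eq [5] [] (by decide)
  exact h₈.symm.trans (h₇.trans h₉)

theorem W4_bar (D : CubicSys k A) : D.bar.W4 ≤ D.W4 := by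
  refine Submodule.span_le.2 ?_
  rintro _ ⟨l, hl, rfl⟩
  rw [bar_w]
  exact Submodule.subset_span ⟨_, hl.neg, rfl⟩

/-- Multiplication of `w₊` and `w₋` by the first two generators. -/
theorem mul_wPlus_sub_mem (a : ℤ) (ha : a = 1 ∨ a = 2) :
    D.f a * D.w [3, 2, -1, 2, 3] - D.w [3, 2, -1, 2, 3] ∈ D.W4 := by
  rw [← D.w_cons]
  rcases ha with rfl | rfl
  · exact (Submodule.Quotient.eq _).1 one_mul_wPlus
  · exact (Submodule.Quotient.eq _).1 two_mul_wPlus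

theorem wPlus_mul_sub_mem (a : ℤ) (ha : a = 1 ∨ a = 2) :
    D.w [3, 2, -1, 2, 3] * D.f a - D.w [3, 2, -1, 2, 3] ∈ D.W4 := by
  have h := mul_wPlus_sub_mem (D := D.op) a ha
  have e : D.op.w [3, 2, -1, 2, 3] = MulOpposite.op (D.w [3, 2, -1, 2, 3]) := D.op_w_of (by decide)
  have e₂ : D.op.f a = MulOpposite.op (D.f a) := rfl
  rw [e, e₂, ← MulOpposite.op_mul, ← MulOpposite.op_sub] at h
  exact (op_mem_wspan (D := D) (P := Span4) (fun _ => Span4.reverse) _).1 h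

theorem neg_mul_wMinus_sub_mem (a : ℤ) (ha : a = 1 ∨ a = 2) :
    D.f (-a) * D.w [-3, -2, 1, -2, -3] - D.w [-3, -2, 1, -2, -3] ∈ D.W4 := by
  have h := W4_bar D (mul_wPlus_sub_mem (D := D.bar) a ha)
  have e : D.bar.w [3, 2, -1, 2, 3] = D.w [-3, -2, 1, -2, -3] := D.bar_w_of (by decide)
  have e₂ : D.bar.f a = D.f (-a) := rfl
  rwa [e, e₂] at h

theorem wMinus_mul_neg_sub_mem (a : ℤ) (ha : a = 1 ∨ a = 2) :
    D.w [-3, -2, 1, -2, -3] * D.f (-a) - D.w [-3, -2, 1, -2, -3] ∈ D.W4 := by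
  have h := W4_bar D (wPlus_mul_sub_mem (D := D.bar) a ha)
  have e : D.bar.w [3, 2, -1, 2, 3] = D.w [-3, -2, 1, -2, -3] := D.bar_w_of (by decide)
  have e₂ : D.bar.f a = D.f (-a) := rfl
  rwa [e, e₂] at h

theorem mul_wMinus_sub_mem (a : ℤ) (ha : a = 1 ∨ a = 2) :
    D.f a * D.w [-3, -2, 1, -2, -3] - D.w [-3, -2, 1, -2, -3] ∈ D.W4 := by
  have := W4_ctx_mem (p := [a]) (q := []) (by rcases ha with rfl | rfl <;> decide) (by decide)
    (D.W4.neg_mem (neg_mul_wMinus_sub_mem (D := D) a ha))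
  have e : D.w [a] = D.f a := by simp [D.w_cons]
  rw [BraidSys.w_nil, mul_one, e, neg_sub, mul_sub, ← mul_assoc, D.f_inv, one_mul] at this
  exact this

theorem wMinus_mul_sub_mem (a : ℤ) (ha : a = 1 ∨ a = 2) :
    D.w [-3, -2, 1, -2, -3] * D.f a - D.w [-3, -2, 1, -2, -3] ∈ D.W4 := by
  have := W4_ctx_mem (p := []) (q := [a]) (by decide) (by rcases ha with rfl | rfl <;> decide)
    (D.W4.neg_mem (wMinus_mul_neg_sub_mem (D := D) a ha))
  have e : D.w [a] = D.f a := by simp [D.w_cons]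
  rw [BraidSys.w_nil, one_mul, e, neg_sub, sub_mul, mul_assoc, D.f_inv', mul_one] at this
  exact this

end CubicSys

/-! ### A spanning family for the words in the first three generators -/

namespace CubicSys

variable {k A : Type} [CommRing k] [Ring A] [Algebra k A] {D : CubicSys k A}

/-- The words spanning the algebra on four strands. -/
def Span4' (l : List ℤ) : Prop := Span4 l ∨ l = [3, 2, -1, 2, 3] ∨ l = [-3, -2, 1, -2, -3]

variable (D) in
/-- The span of these words. -/
abbrev W4' : Submodule k A := D.wspan Span4'

theorem W4_le : D.W4 ≤ D.W4' := by
  refine Submodule.span_mono ?_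
  rintro _ ⟨l, hl, rfl⟩
  exact ⟨l, Or.inl hl, rfl⟩

theorem wPlus_mem : D.w [3, 2, -1, 2, 3] ∈ D.W4' :=
    Submodule.subset_span ⟨_, Or.inr (Or.inl rfl), rfl⟩

theorem wMinus_mem : D.w [-3, -2, 1, -2, -3] ∈ D.W4' :=
    Submodule.subset_span ⟨_, Or.inr (Or.inr rfl), rfl⟩

/-- As 1 and 2 fix w₊ and w₋ modulo `W4`, adding these two single words already gives a submodule
stable under words in 1 and 2 on both sides. -/
theorem W4'_ctx {p q l : List ℤ} (hp : Low p) (hq : Low q) (h : D.c D.W4' l = 0) :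
    D.c D.W4' (p ++ (l ++ q)) = 0 := by
  rw [c_eq_zero] at h ⊢
  rw [D.w_append, D.w_append, ← mul_assoc]
  refine mul_w_mem 2 (by norm_num) ?_ hq (w_mul_mem 2 (by norm_num) ?_ hp h)
  · intro a ha₁ ha₂ x hx
    have ha : a = 1 ∨ a = 2 := by push_cast at ha₂; omega
    refine wspan_mul_right a ?_ hx
    rintro _ (hl | rfl | rfl) <;> rw [c_eq_zero, D.w_append]
    · refine W4_le ?_
      have := W4_ctx_mem (D := D) (p := []) (q := [a]) (by decide)
        (by rcases ha with rfl | rfl <;> decide) (Submodule.subset_span ⟨_, hl, rfl⟩)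
      rwa [D.w_nil, one_mul] at this
    · have e : D.w [a] = D.f a := by simp [D.w_cons]
      have := D.W4'.add_mem (W4_le (wPlus_mul_sub_mem a ha)) wPlus_mem
      rwa [sub_add_cancel, ← e] at this
    · have e : D.w [a] = D.f a := by simp [D.w_cons]
      have := D.W4'.add_mem (W4_le (wMinus_mul_sub_mem a ha)) wMinus_mem
      rwa [sub_add_cancel, ← e] at this
  · intro a ha₁ ha₂ x hx
    have ha : a = 1 ∨ a = 2 := by push_cast at ha₂; omega
    refine wspan_mul_left a ?_ hx
    rintro _ (hl | rfl | rfl) <;> rw [c_eq_zero, D.w_cons]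
    · refine W4_le ?_
      have e : D.w [a] = D.f a := by simp [D.w_cons]
      have := W4_ctx_mem (D := D) (p := [a]) (q := [])
        (by rcases ha with rfl | rfl <;> decide) (by decide) (Submodule.subset_span ⟨_, hl, rfl⟩)
      rwa [D.w_nil, mul_one, e] at this
    · have := D.W4'.add_mem (W4_le (mul_wPlus_sub_mem a ha)) wPlus_mem
      rwa [sub_add_cancel] at this
    · have := D.W4'.add_mem (W4_le (mul_wMinus_sub_mem a ha)) wMinus_mem
      rwa [sub_add_cancel] at this

theorem c_W4'_of_W4 {l : List ℤ} (h : D.c D.W4 l = 0) : D.c D.W4' l = 0 :=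
  D.c_eq_zero.2 (W4_le (D.c_eq_zero.1 h))

theorem W4'_word {p q : List ℤ} (e : List ℤ) (hp : Low p) (hq : Low q)
    (he : e = [0] ∨ e = [3] ∨ e = [-3] ∨ e = [3, -2, 3] ∨ e = [-3, 2, -3]) :
    D.c D.W4' (p ++ (e ++ q)) = 0 := c_W4'_of_W4 (W4_word hp hq he)

/-- `3^± p 3^±` for `p` in the first two generators. -/
theorem W4'_three {a b : ℤ} {p : List ℤ} (hp : Low p) (ha : a = 3 ∨ a = -3)
    (hb : b = 3 ∨ b = -3) : D.c D.W4' (a :: (p ++ [b])) = 0 := by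
  have := low_zero (D := D) 1 2 (by simp) (D.ctx D.W4' [a] [b]) (fun x y z hx hy hz => ?_) ?_ hp
  · rwa [D.ctx_w] at this
  · rw [D.ctx_w]
    exact c_W4'_of_W4 (W4_five (p := [x]) (q := [z]) (by rcases hx with rfl | rfl | rfl <;> decide)
      (by rcases hz with rfl | rfl | rfl <;> decide) ha hy hb)
  · rw [D.ctx_w]
    rcases ha with rfl | rfl <;> rcases hb with rfl | rfl
    · exact D.c_eq_zero.2 wPlus_mem
    · exact (c_eq [] [1, 4, 2, 0, 2, 3, 5] (by decide)).trans
        (W4'_word (p := [-2, -1]) (q := [1, 2]) [3, -2, 3] (by decide) (by decide) (by decide))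
    · exact (c_eq [] [1, 4, 2, 0, 2, 3, 5] (by decide)).trans
        (W4'_word (p := [2, 1]) (q := [-1, -2]) [3, -2, 3] (by decide) (by decide) (by decide))
    -- The gap 21'2 has the wrong sign for w₋; expanding it produces 2'12'1', whose last letter
    -- leaves the gap.
    · have h : D.c D.W4' [-3, 2, -1, 2, -3] = D.U • D.c D.W4' [-3, -2, 1, -2, -1, -3]
        + D.S • D.c D.W4' [-3, -1, 2, -3]
          - D.T • D.c D.W4' [-3, 1, -2, -1, -3] := D.c_cube_right D.W4' 1 2 (by decide) [-3] [-3]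
      have h₁ : D.c D.W4' [-3, -2, 1, -2, -1, -3] = 0 :=
        (c_eq [4] [] (by decide)).trans
          (W4'_ctx (p := []) (q := [-1]) (by decide) (by decide) (D.c_eq_zero.2 wMinus_mem))
      have h₂ : D.c D.W4' [-3, -1, 2, -3] = 0 := c_W4'_of_W4
        (W4_five (p := [-1]) (q := []) (a := -3) (b := 2) (c := -3) (by decide) (by decide)
          (by decide) (by decide) (by decide))
      have h₃ : D.c D.W4' [-3, 1, -2, -1, -3] = 0 := c_W4'_of_W4
        (W4_five (p := [1]) (q := [-1]) (a := -3) (b := -2) (c := -3) (by decide) (by decide)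
          (by decide) (by decide) (by decide))
      change D.c D.W4' [-3, 2, -1, 2, -3] = 0
      rw [h, h₁, h₂, h₃]
      simp

/-- `3 p x` for `p` in the first two generators. -/
theorem W4'_mul_x {p : List ℤ} (hp : Low p) : D.c D.W4' (3 :: (p ++ [3, -2, 3])) = 0 := by
  have t : ∀ {a b : ℤ} {p : List ℤ}, Low p → (a = 3 ∨ a = -3) → (b = 3 ∨ b = -3) →
    D.c D.W4' (a :: (p ++ [b])) = 0 := W4'_three
  have := low_zero (D := D) 1 2 (by simp) (D.ctx D.W4' [3] [3, -2, 3]) (fun x y z hx hy hz => ?_)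
      ?_ hp
  · rwa [D.ctx_w] at this
  · rw [D.ctx_w]
    have hx₁ : Low [x] := by rcases hx with rfl | rfl | rfl <;> decide
    have key : D.c D.W4' [3, y, z, 3, -2, 3] = 0 := by
      rcases hy with rfl | rfl | rfl
      · have h₀ : D.c D.W4' [3, 0, z, 3, -2, 3] = D.c D.W4' [z, 3, 3, -2, 3] := by
          rcases hz with rfl | rfl | rfl
          · exact D.c_filter _ (by decide)
          · exact (D.c_filter _ (l' := [3, 1, 3, -2, 3]) (by decide)).trans
              (c_eq [0] [] (by decide))
          · exact (D.c_filter _ (l' := [3, -1, 3, -2, 3]) (by decide)).trans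
              (c_eq [0] [] (by decide))
        rw [h₀]
        refine W4'_ctx (p := [z]) (q := []) (l := [3, 3, -2, 3])
            (by rcases hz with rfl | rfl | rfl <;> decide)
          (by decide) ?_
        have h₁ : D.c D.W4' [3, 3, -2, 3] = D.S • D.c D.W4' [3, -2, 3] - D.T • D.c D.W4' [3, -3, -2,
            3]
          + D.U • D.c D.W4' [3, -3, -3, -2, 3] := D.c_cubic _ 3 (by norm_num) [3] [-2, 3]
        have h₂ : D.c D.W4' [3, -3, -2, 3] = 0 := (c_eq [0] [] (by decide)).trans
          (W4'_word (p := [-2]) (q := []) [3] (by decide) (by decide) (by decide))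
        have h₃ : D.c D.W4' [3, -3, -3, -2, 3] = 0 := (c_eq [0] [0] (by decide)).trans
          (W4'_word (p := [2]) (q := [-2]) [-3] (by decide) (by decide) (by decide))
        have h₄ : D.c D.W4' [3, -2, 3] = 0 :=
          W4'_word (p := []) (q := []) [3, -2, 3] (by decide) (by decide) (by decide)
        rw [h₁, h₂, h₃, h₄]
        simp
      · have e : D.c D.W4' [3, 2, z, 3, -2, 3] = D.c D.W4' [2, 3, 2, z, -2, 3] := by
          rcases hz with rfl | rfl | rfl
          · exact (D.c_filter _ (l' := [3, 2, 3, -2, 3]) (by decide)).trans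
              ((c_eq (l' := [2, 3, 2, -2, 3]) [0] [] (by decide)).trans
                (D.c_filter _ (by decide)))
          · exact c_eq [2] [0] (by decide)
          · exact c_eq [2] [0] (by decide)
        rw [e]
        exact W4'_ctx (p := [2]) (q := []) (l := [3, 2, z, -2, 3]) (by decide) (by decide)
          (t (p := [2, z, -2]) (by rcases hz with rfl | rfl | rfl <;> decide) (by simp) (by simp))
      · have h : D.c D.W4' [3, -2, z, 3, -2, 3] = D.U • D.c D.W4' [3, -2, z, -3, 2, -3, -2]
          + D.S • D.c D.W4' [3, -2, z, -2, 3] - D.T • D.c D.W4' [3, -2, z, 2, -3, -2] :=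
          D.c_cube_right D.W4' 2 3 (by decide) [3, -2, z] []
        have e : D.c D.W4' [3, -2, z, -3, 2, -3, -2] = D.c D.W4' [-2, -3, 2, z, 2, -3, -2] := by
          rcases hz with rfl | rfl | rfl
          · exact (D.c_filter _ (l' := [3, -2, -3, 2, -3, -2]) (by decide)).trans
              ((c_eq (l' := [-2, -3, 2, 2, -3, -2]) [0] [] (by decide)).trans
                (D.c_filter _ (by decide)))
          · exact c_eq [2] [0] (by decide)
          · exact c_eq [2] [0] (by decide)
        have h₁ : D.c D.W4' [-2, -3, 2, z, 2, -3, -2] = 0 :=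
          W4'_ctx (p := [-2]) (q := [-2]) (l := [-3, 2, z, 2, -3]) (by decide) (by decide)
            (t (p := [2, z, 2]) (by rcases hz with rfl | rfl | rfl <;> decide) (by simp) (by simp))
        have h₂ : D.c D.W4' [3, -2, z, -2, 3] = 0 :=
          t (p := [-2, z, -2]) (by rcases hz with rfl | rfl | rfl <;> decide) (by simp) (by simp)
        have h₃ : D.c D.W4' [3, -2, z, 2, -3, -2] = 0 :=
          W4'_ctx (p := []) (q := [-2]) (l := [3, -2, z, 2, -3]) (by decide) (by decide)
            (t (p := [-2, z, 2]) (by rcases hz with rfl | rfl | rfl <;> decide) (by simp) (by simp))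
        rw [h, e, h₁, h₂, h₃]
        simp
    have h₁ := W4'_ctx (p := [x]) (q := []) hx₁ (by decide) key
    have h₂ := c_comm (D := D) (W := D.W4') 3 (One.far (q := [x]) (by norm_num)
      (by rcases hx with rfl | rfl | rfl <;> decide)) [] [y, z, 3, -2, 3]
    exact h₂.trans h₁
  · rw [D.ctx_w]
    have e : D.c D.W4' [3, 2, -1, 2, 3, -2, 3] = D.c D.W4' [-2, 3, 2, -1, 2, 3, 3] := c_eq [3, 2]
        [0] (by decide)
    have h : D.c D.W4' [-2, 3, 2, -1, 2, 3, 3] = D.S • D.c D.W4' [-2, 3, 2, -1, 2, 3]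
        - D.T • D.c D.W4' [-2, 3, 2, -1, 2, 3, -3]
      + D.U • D.c D.W4' [-2, 3, 2, -1, 2, 3, -3, -3] := D.c_cubic _ 3 (by norm_num) [-2, 3, 2, -1,
          2, 3] []
    have h₁ : D.c D.W4' [-2, 3, 2, -1, 2, 3] = 0 := W4'_ctx (p := [-2]) (q := []) (l := [3, 2, -1,
        2, 3]) (by decide)
      (by decide) (t (p := [2, -1, 2]) (by decide) (by simp) (by simp))
    have h₂ : D.c D.W4' [-2, 3, 2, -1, 2, 3, -3] = 0 := (c_eq [5] [] (by decide)).trans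
      (W4'_word (p := [-2]) (q := [2, -1, 2]) [3] (by decide) (by decide) (by decide))
    have h₃ : D.c D.W4' [-2, 3, 2, -1, 2, 3, -3, -3] = 0 := (c_eq [5] [] (by decide)).trans
      (W4'_ctx (p := [-2]) (q := []) (l := [3, 2, -1, 2, -3]) (by decide)
      (by decide) (t (p := [2, -1, 2]) (by decide) (by simp) (by simp)))
    change D.c D.W4' [3, 2, -1, 2, 3, -2, 3] = 0
    rw [e, h, h₁, h₂, h₃]
    simp

/-- The word 3'23' is first traded for x by `c_cube_inv`, so that only the products 3p3^± and 3px
are needed. For w₊ the cubic relation reduces 33, and for w₋ the letters cancel. -/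
theorem three_mul_mem {x : A} (hx : x ∈ D.W4') : D.f 3 * x ∈ D.W4' := by
  have t : ∀ {a b : ℤ} {p q : List ℤ}, Low p → Low q → (a = 3 ∨ a = -3) → (b = 3 ∨ b = -3) →
      D.c D.W4' (a :: (p ++ (b :: q))) = 0 := by
    intro a b p q hp hq ha hb
    have := W4'_ctx (D := D) (p := []) (by decide) hq (W4'_three hp ha hb)
    simpa using this
  have hX : ∀ {p q : List ℤ}, Low p → Low q → D.c D.W4' (3 :: (p ++ (3 :: (-2 :: (3 :: q))))) = 0 :=
      by
    intro p q hp hq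
    have := W4'_ctx (D := D) (p := []) (by decide) hq (W4'_mul_x hp)
    simpa using this
  refine wspan_mul_left 3 ?_ hx
  rintro _ (⟨p, e, q, hp, hq, he, rfl⟩ | rfl | rfl)
  · rcases he with rfl | rfl | rfl | rfl | rfl
    · have h := D.c_zero D.W4' (3 :: p) q
      have h₂ := W4'_word (D := D) (p := []) [3] (by decide) (hp.append hq) (by decide)
      simp only [List.cons_append, List.nil_append] at h h₂ ⊢
      rw [h, h₂]
    · exact t hp hq (by simp) (by simp)
    · exact t hp hq (by simp) (by simp)
    · exact hX hp hq
    · have h := D.c_cube_inv D.W4' 2 3 (by decide) (3 :: p) q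
      have h₁ := hX hp (hq.cons (a := 2) (by norm_num))
      have h₂ := t (a := 3) (b := 3) (hp.append (l' := [-2]) (by decide))
        (hq.cons (a := 2) (by norm_num)) (by simp) (by simp)
      have h₃ := t (a := 3) (b := -3) (hp.append (l' := [2]) (by decide)) hq (by simp) (by simp)
      simp only [List.cons_append, List.nil_append, List.append_assoc] at h h₁ h₂ h₃ ⊢
      rw [h, h₁, h₂, h₃]
      simp
  · have h : D.c D.W4' [3, 3, 2, -1, 2, 3] = D.S • D.c D.W4' [3, 2, -1, 2, 3] - D.T • D.c D.W4' [3,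
      -3, 2, -1, 2, 3]
      + D.U • D.c D.W4' [3, -3, -3, 2, -1, 2, 3] := D.c_cubic _ 3 (by norm_num) [3] [2, -1, 2, 3]
    have h₁ : D.c D.W4' [3, 2, -1, 2, 3] = 0 := D.c_eq_zero.2 wPlus_mem
    have h₂ : D.c D.W4' [3, -3, 2, -1, 2, 3] = 0 := (c_eq [0] [] (by decide)).trans
      (W4'_word (p := [2, -1, 2]) (q := []) [3] (by decide) (by decide) (by decide))
    have h₃ : D.c D.W4' [3, -3, -3, 2, -1, 2, 3] = 0 := (c_eq [0] [] (by decide)).trans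
      (W4'_three (p := [2, -1, 2]) (a := -3) (b := 3) (by decide) (by decide) (by decide))
    change D.c D.W4' [3, 3, 2, -1, 2, 3] = 0
    rw [h, h₁, h₂, h₃]
    simp
  · exact (c_eq [0] [] (by decide)).trans
      (W4'_word (p := [-2, 1, -2]) (q := []) [-3] (by decide) (by decide) (by decide))

/-- A linear map vanishing on the words `p 3^± q`, `p q` and `p 32'3 q` with `p` and `q` in the
first two generators, and on `w₊` and `w₋`, vanishes on all words in the first three generators. -/
theorem mid_zero {M : Type} [AddCommGroup M] [Module k M] (φ : A →ₗ[k] M)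
    (h₁ : ∀ p q a, Low p → Low q → (a = 0 ∨ a = 3 ∨ a = -3) → φ (D.w (p ++ (a :: q))) = 0)
    (h₂ : ∀ p q, Low p → Low q → φ (D.w (p ++ (3 :: (-2 :: (3 :: q))))) = 0)
    (h₃ : φ (D.w [3, 2, -1, 2, 3]) = 0) (h₄ : φ (D.w [-3, -2, 1, -2, -3]) = 0) {l : List ℤ}
        (hl : Mid l) :
    φ (D.w l) = 0 := by
  have key : D.W4' ≤ LinearMap.ker φ := by
    refine Submodule.span_le.2 ?_
    rintro _ ⟨_, ⟨p, e, q, hp, hq, he, rfl⟩ | rfl | rfl, rfl⟩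
    · rcases he with rfl | rfl | rfl | rfl | rfl
      · exact h₁ p q 0 hp hq (by simp)
      · exact h₁ p q 3 hp hq (by simp)
      · exact h₁ p q (-3) hp hq (by simp)
      · exact h₂ p q hp hq
      · have h := D.c_cube_inv (LinearMap.ker φ) 2 3 (by decide) p q
        have g₁ : D.c (LinearMap.ker φ) (p ++ (3 :: (-2 :: (3 :: (2 :: q))))) = 0 :=
          D.c_eq_zero.2 (h₂ p (2 :: q) hp (hq.cons (by norm_num)))
        have g₂ : D.c (LinearMap.ker φ) (p ++ (-2 :: (3 :: (2 :: q)))) = 0 := by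
          have := (D.c_eq_zero (W := LinearMap.ker φ)).2
              (h₁ (p ++ [-2]) (2 :: q) 3 (hp.append (by decide))
            (hq.cons (by norm_num)) (by simp))
          simpa using this
        have g₃ : D.c (LinearMap.ker φ) (p ++ (2 :: (-3 :: q))) = 0 := by
          have := (D.c_eq_zero (W := LinearMap.ker φ)).2
              (h₁ (p ++ [2]) q (-3) (hp.append (by decide)) hq (by simp))
          simpa using this
        rw [g₁, g₂, g₃] at h
        exact D.c_eq_zero.1 (h.trans (by simp))
    · exact h₃
    · exact h₄
  refine key ?_
  rw [← mul_one (D.w l), ← D.w_nil]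
  refine w_mul_mem 3 (by norm_num) ?_ hl (W := D.W4') ?_
  · intro a ha₁ ha₂ x hx
    push_cast at ha₂
    obtain rfl | ha : a = 3 ∨ a.natAbs ≤ 2 := by omega
    · exact three_mul_mem hx
    · have : x ∈ D.W4'.comap (LinearMap.mulLeft k (D.f a)) := by
        refine (Submodule.span_le (p := D.W4'.comap (LinearMap.mulLeft k (D.f a)))).2 ?_ hx
        rintro _ ⟨l, hl, rfl⟩
        have := W4'_ctx (p := [a]) (q := []) (by simpa [Low] using ha) (by decide) (c_wspan (D :=
            D) hl)
        rw [c_eq_zero] at this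
        simpa [D.w_cons] using this
      exact this
  · have := W4'_word (D := D) (p := []) (q := []) [0] (by decide) (by decide) (by decide)
    rw [c_eq_zero] at this
    simpa [D.w_cons, D.f_zero] using this

end CubicSys

namespace CubicSys

variable {k A : Type} [CommRing k] [Ring A] [Algebra k A] {D : CubicSys k A}

/-! ### Products `4^± l 43'4` with `l` in the first three generators -/

@[simp] theorem count4_nil : count4 [] = 0 := rfl

theorem m_append_zero {l : List ℤ} (q : List ℤ) (hq : Mid q) (h : D.m l = 0) :
    D.m (l ++ q) = 0 := by
  simpa using m_ctx_zero [] q (by decide) hq h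

theorem m_prepend_zero {l : List ℤ} (p : List ℤ) (hp : Mid p) (h : D.m l = 0) :
    D.m (p ++ l) = 0 := by
  simpa using m_ctx_zero p [] hp (by decide) h

/-- Words in 1 and 2 commute with 4^± and leave on the left, where multiplication preserves `N 2`.
-/
theorem peak_low_left {a : ℤ} (ha : a = 4 ∨ a = -4) {p l : List ℤ} (hp : Low p)
    (h : D.m (a :: (l ++ [4, -3, 4])) = 0) : D.m (a :: (p ++ (l ++ [4, -3, 4]))) = 0 := by
  have e := c_low_comm (D := D) (W := D.N 2) a (by rcases ha with rfl | rfl <;> rfl) hp []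
    (l ++ [4, -3, 4])
  exact e.trans (m_prepend_zero p hp.mid h)

/-- Words in 1 commute with the whole peak 43'4 and leave on the right. -/
theorem peak_one_right {a : ℤ} {q l : List ℤ} (hq : One q)
    (h : D.m (a :: (l ++ [4, -3, 4])) = 0) : D.m (a :: (l ++ (q ++ [4, -3, 4]))) = 0 := by
  have e₁ := c_comm (D := D) (W := D.N 2) 4 (hq.far (by norm_num)) (a :: l ++ [4, -3]) []
  have e₂ := c_comm (D := D) (W := D.N 2) (-3) (hq.far (by norm_num)) (a :: l ++ [4]) [4]
  have e₃ := c_comm (D := D) (W := D.N 2) 4 (hq.far (by norm_num)) (a :: l) [-3, 4]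
  have h' := m_append_zero q hq.low.mid h
  simp only [List.append_assoc, List.cons_append, List.nil_append, List.append_nil]
    at e₁ e₂ e₃ h'
  exact e₃.symm.trans (e₂.symm.trans (e₁.symm.trans h'))

/-- After a leading 4', commuting q past the next 4 gives 4'3^±4, which a braid relation rewrites
with a single 4^±. After a leading 4, the peak is first expanded as U 4'34'3' plus terms of `N 2`,
which creates the analogous 43^±4'. -/
theorem peak_three {a b : ℤ} (ha : a = 4 ∨ a = -4) (hb : b = 0 ∨ b = 3 ∨ b = -3) {q : List ℤ}
    (hq : Low q) : D.m (a :: (b :: (q ++ [4, -3, 4]))) = 0 := by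
  rcases ha with rfl | rfl
  · have h : D.m (4 :: (b :: (q ++ [4, -3, 4]))) = D.U • D.m (4 :: (b :: (q ++ [-4, 3, -4, -3])))
      + D.S • D.m (4 :: (b :: (q ++ [-3, 4])))
      - D.T • D.m (4 :: (b :: (q ++ [3, -4, -3]))) := D.c_cube_right (D.N 2) 3 4 (by decide)
          (4 :: b :: q) []
    have h₁ : D.m (4 :: (b :: (q ++ [-3, 4]))) = 0 := m_zero (by
      rcases hb with rfl | rfl | rfl <;> simp [count4_cons, count4_append, hq.count4])
    have h₂ : D.m (4 :: (b :: (q ++ [3, -4, -3]))) = 0 := m_zero (by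
      rcases hb with rfl | rfl | rfl <;> simp [count4_cons, count4_append, hq.count4])
    have h₃ : D.m (4 :: (b :: (q ++ [-4, 3, -4, -3]))) = D.m (4 :: (b :: (-4 :: (q ++ [3, -4,
        -3])))) :=
      (c_low_comm (-4) rfl hq [4, b] [3, -4, -3]).symm
    have h₄ : D.m (4 :: (b :: (-4 :: (q ++ [3, -4, -3])))) = 0 := by
      rcases hb with rfl | rfl | rfl
      · exact (D.c_zero _ [4] (-4 :: (q ++ [3, -4, -3]))).trans ((D.c_cancel _ 4 [] _).trans
          (m_zero (by simp [count4_cons, count4_append, hq.count4])))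
      · exact (c_eq (l' := (-3 :: (4 :: (3 :: (q ++ [3, -4, -3]))))) [0] [] rfl).trans
          (m_zero (by simp [count4_cons, count4_append, hq.count4]))
      · exact (c_eq (l' := (-3 :: (-4 :: (3 :: (q ++ [3, -4, -3]))))) [0] [] rfl).trans
          (m_zero (by simp [count4_cons, count4_append, hq.count4]))
    rw [h, h₁, h₂, h₃, h₄]
    simp
  · have h₃ : D.m (-4 :: (b :: (q ++ [4, -3, 4]))) = D.m (-4 :: (b :: (4 :: (q ++ [-3, 4])))) :=
      (c_low_comm 4 rfl hq [-4, b] [-3, 4]).symm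
    rw [h₃]
    rcases hb with rfl | rfl | rfl
    · exact (D.c_zero _ [-4] (4 :: (q ++ [-3, 4]))).trans ((D.c_cancel' _ 4 [] _).trans
        (m_zero (by simp [count4_cons, count4_append, hq.count4])))
    · exact (c_eq (l' := (3 :: (4 :: (-3 :: (q ++ [-3, 4]))))) [0] [] rfl).trans
        (m_zero (by simp [count4_cons, count4_append, hq.count4]))
    · exact (c_eq (l' := (3 :: (-4 :: (-3 :: (q ++ [-3, 4]))))) [0] [] rfl).trans
        (m_zero (by simp [count4_cons, count4_append, hq.count4]))

theorem peak_low {a b : ℤ} (ha : a = 4 ∨ a = -4) (hb : b = 0 ∨ b = 3 ∨ b = -3) {p q : List ℤ}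
    (hp : Low p) (hq : Low q) : D.m (a :: (p ++ (b :: (q ++ [4, -3, 4])))) = 0 :=
  peak_low_left (l := b :: q) ha hp (peak_three ha hb hq)

/-- Products with two letters `4^±`, one of them being squared. -/
theorem m_sq_zero {p q : List ℤ} (hp : count4 p ≤ 1) (hq : Mid q) :
    D.m (p ++ (4 :: (4 :: q))) = 0 := by
  have h := D.c_cubic (D.N 2) 4 (by norm_num) (p ++ [4]) q
  have e₁ := D.c_cancel (D.N 2) 4 p q
  have e₂ := D.c_cancel (D.N 2) 4 p (-4 :: q)
  simp only [List.append_assoc, List.cons_append, List.nil_append] at h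
  have z₀ : D.c (D.N 2) (p ++ 4 :: q) = 0 :=
    m_zero (by simp [count4_cons, count4_append, hq.count4]; omega)
  have z₁ : D.c (D.N 2) (p ++ q) = 0 := m_zero (by simp [count4_append, hq.count4]; omega)
  have z₂ : D.c (D.N 2) (p ++ -4 :: q) = 0 :=
    m_zero (by simp [count4_cons, count4_append, hq.count4]; omega)
  exact h.trans (by rw [e₁, e₂, z₀, z₁, z₂]; simp)

/-- Apart from the peak itself, the terms of `c_mul_peak` contain one letter 4^± or a square 44 that
the cubic relation reduces. Together with the leading letter this stays in `N 2`. -/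
theorem peak_absorb {a : ℤ} {l : List ℤ} (hl : Mid l) :
    D.m (a :: (l ++ [3, 4, -3, 4])) = D.m (a :: (l ++ [4, -3, 4])) := by
  have h := D.c_mul_peak (D.N 2) 3 4 (by decide) (a :: l) []
  have z : ∀ {l'}, count4 l' ≤ 1 → D.c (D.N 2) (a :: l ++ l') = 0 := by
    intro l' h'
    refine m_zero ?_
    rw [count4_append, count4_cons, hl.count4]
    split_ifs <;> omega
  have s : ∀ b : ℤ, b.natAbs ≤ 3 → D.c (D.N 2) (a :: l ++ b :: 4 :: 4 :: []) = 0 := by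
    intro b hb
    have := m_sq_zero (D := D) (p := a :: l ++ [b]) (q := []) (by
      rw [count4_append, count4_cons, hl.count4, count4_cons]
      have : b.natAbs ≠ 4 := by omega
      simp only [this, if_false]
      split_ifs <;> simp [count4]) (by decide)
    simpa using this
  rw [z (l' := [4, 3]) (by decide), z (l' := [3, 4, 3]) (by decide),
    z (l' := [3, 4, -3]) (by decide), z (l' := [3, -4, -3]) (by decide),
    z (l' := [3, 3, -4, -3]) (by decide), z (l' := [4, -3]) (by decide),
    s 3 (by norm_num), s (-3) (by norm_num), z (l' := [3]) (by decide),
    z (l' := [-3]) (by decide)] at h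
  simpa using h

theorem peak_absorb' {a : ℤ} {l : List ℤ} (hl : Mid l) :
    D.m (a :: (l ++ [-3, 4, -3, 4])) = D.m (a :: (l ++ [4, -3, 4])) := by
  have h := peak_absorb (D := D) (a := a) (hl.append (l' := [-3]) (by decide))
  have e := D.c_cancel' (D.N 2) 3 (a :: l) [4, -3, 4]
  simp only [List.append_assoc, List.cons_append, List.nil_append] at h e
  exact h.symm.trans e

/-- The mirror image of `peak_low`. -/
theorem peak_low_rev {a b : ℤ} (ha : a = 4 ∨ a = -4) (hb : b = 0 ∨ b = 3 ∨ b = -3) {p q : List ℤ}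
    (hp : Low p) (hq : Low q) : D.m (4 :: (-3 :: (4 :: (p ++ (b :: (q ++ [a])))))) = 0 := by
  have := op_m_eq_zero D (peak_low (D := D.op) ha hb hq.reverse hp.reverse)
  simpa using this

theorem peak_absorb_rev' {a : ℤ} {l : List ℤ} (hl : Mid l) :
    D.m (4 :: (-3 :: (4 :: (-3 :: (l ++ [a]))))) = D.m (4 :: (-3 :: (4 :: (l ++ [a])))) := by
  have := congrArg D.rev (peak_absorb' (D := D.op) (a := a) hl.reverse)
  rw [rev_m, rev_m] at this
  simpa using this

/-- Modulo a submodule containing the products of `3^±` with words in the first two generators,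
`x 2` may be replaced by `x`. -/
theorem c_x_two {W : Submodule k A}
    (hW : ∀ p q b, Low p → Low q → (b = 0 ∨ b = 3 ∨ b = -3) → D.c W (p ++ (b :: q)) = 0)
    {q : List ℤ} (hq : Low q) : D.c W (3 :: (-2 :: (3 :: (2 :: q)))) = D.c W (3 :: (-2 :: (3 :: q)))
        := by
  have h := D.c_peak_mul W 2 3 (by decide) [] q
  have z : ∀ {p r : List ℤ} (b : ℤ), Low p → Low r → (b = 0 ∨ b = 3 ∨ b = -3) →
      D.c W (p ++ b :: (r ++ q)) = 0 := fun b hp hr hb => hW _ _ b hp (hr.append hq) hb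
  have y : ∀ {r : List ℤ}, Low r → D.c W (r ++ q) = 0 := fun hr =>
    (D.c_zero W [] _).symm.trans (z (p := []) 0 (by decide) hr (by decide))
  have sq : ∀ {r : List ℤ}, Low r → D.c W (3 :: 3 :: (r ++ q)) = 0 := by
    intro r hr
    have h := D.c_cubic W 3 (by norm_num) [3] (r ++ q)
    have e₁ := D.c_cancel W 3 [] (r ++ q)
    have e₂ := D.c_cancel W 3 [] (-3 :: (r ++ q))
    have z₁ := z (p := []) 3 (by decide) hr (by decide)
    have z₂ := z (p := []) (-3) (by decide) hr (by decide)
    simp only [List.cons_append, List.nil_append] at h e₁ e₂ z₁ z₂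
    exact h.trans (by rw [e₁, e₂, z₁, z₂, y hr]; simp)
  have z₁ := z (p := [2]) (r := []) 3 (by decide) (by decide) (by decide)
  have z₂ := z (p := [2]) (r := [2]) 3 (by decide) (by decide) (by decide)
  have z₃ := z (p := [-2]) (r := [2]) 3 (by decide) (by decide) (by decide)
  have z₄ := z (p := [-2]) (r := [2]) (-3) (by decide) (by decide) (by decide)
  have z₅ := z (p := [-2]) (r := [2, 2]) (-3) (by decide) (by decide) (by decide)
  have z₆ := z (p := [-2]) (r := []) 3 (by decide) (by decide) (by decide)
  have z₇ := sq (r := [2]) (by decide)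
  have z₈ := sq (r := [-2]) (by decide)
  have z₉ := y (r := [2]) (by decide)
  have z₁₀ := y (r := [-2]) (by decide)
  simp only [List.cons_append, List.nil_append] at h z₁ z₂ z₃ z₄ z₅ z₆ z₇ z₈ z₉ z₁₀
  rw [z₁, z₂, z₃, z₄, z₅, z₆, z₇, z₈, z₉, z₁₀] at h
  simpa using h

/-- Absorption modulo any submodule containing the words i^a j^b i^c; it serves for the pairs (2, 3)
and (3, 4). -/
theorem c_mul_peak_eq {W : Submodule k A} (i j : ℤ) (h : Adj i j)
    (hW : ∀ p q b, (∀ a ∈ p, a.natAbs = i.natAbs) → (∀ a ∈ q, a.natAbs = i.natAbs) →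
      (b = 0 ∨ b = j ∨ b = -j) → D.c W (p ++ b :: q) = 0) :
    D.c W [i, j, -i, j] = D.c W [j, -i, j] := by
  have hj : 1 ≤ j ∧ j ≤ 4 := by unfold Adj at h; omega
  have h := D.c_mul_peak W i j h [] []
  have y : ∀ {r : List ℤ}, (∀ a ∈ r, a.natAbs = i.natAbs) → D.c W r = 0 := fun hr =>
    (D.c_zero W [] _).symm.trans (hW [] _ 0 (by simp) hr (by simp))
  have sq : ∀ {r : List ℤ}, (∀ a ∈ r, a.natAbs = i.natAbs) → D.c W (r ++ [j, j]) = 0 := by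
    intro r hr
    have h := D.c_cubic W j hj (r ++ [j]) []
    have e₁ := D.c_cancel W j r []
    have e₂ := D.c_cancel W j r [-j]
    have z₁ := hW r [] j hr (by simp) (by simp)
    have z₂ := hW r [] (-j) hr (by simp) (by simp)
    simp only [List.append_assoc, List.cons_append, List.nil_append, List.append_nil]
      at h e₁ e₂ z₁ z₂
    exact h.trans (by rw [e₁, e₂, z₁, z₂, y hr]; simp)
  have z₁ := hW [] [i] j (by simp) (by simp) (by simp)
  have z₂ := hW [i] [i] j (by simp) (by simp) (by simp)
  have z₃ := hW [i] [-i] j (by simp) (by simp) (by simp)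
  have z₄ := hW [i] [-i] (-j) (by simp) (by simp) (by simp)
  have z₅ := hW [i, i] [-i] (-j) (by simp) (by simp) (by simp)
  have z₆ := hW [] [-i] j (by simp) (by simp) (by simp)
  have z₇ := sq (r := [i]) (by simp)
  have z₈ := sq (r := [-i]) (by simp)
  have z₉ := y (r := [i]) (by simp)
  have z₁₀ := y (r := [-i]) (by simp)
  simp only [List.cons_append, List.nil_append] at h z₁ z₂ z₃ z₄ z₅ z₆ z₇ z₈
  rw [z₁, z₂, z₃, z₄, z₅, z₆, z₇, z₈, z₉, z₁₀] at h
  simpa using h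

theorem c_two_x {W : Submodule k A}
    (hW : ∀ p q b, Low p → Low q → (b = 0 ∨ b = 3 ∨ b = -3) → D.c W (p ++ (b :: q)) = 0) :
    D.c W [2, 3, -2, 3] = D.c W [3, -2, 3] :=
  c_mul_peak_eq 2 3 (by decide) fun p q b hp hq hb =>
    hW p q b (fun a ha => (hp a ha).le) (fun a ha => (hq a ha).le) hb

/-- In `c_cube_inv` only the term x2 survives, and x absorbs the 2. Up to the unit U, positive and
negative peaks become interchangeable. -/
theorem c_x_inv {W : Submodule k A}
    (hW : ∀ p q b, Low p → Low q → (b = 0 ∨ b = 3 ∨ b = -3) → D.c W (p ++ (b :: q)) = 0)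
    {q : List ℤ} (hq : Low q) : D.U • D.c W (-3 :: (2 :: (-3 :: q))) = D.c W (3 :: (-2 :: (3 :: q)))
        := by
  have h := D.c_cube_inv W 2 3 (by decide) [] q
  have z₁ := hW [-2] (2 :: q) 3 (by decide) (hq.cons (by decide)) (by decide)
  have z₂ := hW [2] q (-3) (by decide) hq (by decide)
  simp only [List.cons_append, List.nil_append] at h z₁ z₂
  rw [z₁, z₂] at h
  rw [h, ← c_x_two hW hq]
  linear_combination (norm := module) D.UV • D.c W (3 :: (-2 :: (3 :: (2 :: q))))

/-! ### The same absorption rules inside the kernel of a linear map -/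

section Functional

variable {M : Type} [AddCommGroup M] [Module k M] {φ : A →ₗ[k] M}

theorem c_ker_eq {l l' : List ℤ} :
    D.c (LinearMap.ker φ) l = D.c (LinearMap.ker φ) l' ↔ φ (D.w l) = φ (D.w l') := by
  simp only [c, Submodule.mkQ_apply]
  rw [Submodule.Quotient.eq, LinearMap.sub_mem_ker_iff]

theorem map_x_two
    (hφ : ∀ p q b, Low p → Low q → (b = 0 ∨ b = 3 ∨ b = -3) → φ (D.w (p ++ (b :: q))) = 0)
    {q : List ℤ} (hq : Low q) : φ (D.w (3 :: (-2 :: (3 :: (2 :: q))))) = φ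
        (D.w (3 :: (-2 :: (3 :: q)))) :=
  c_ker_eq.1 (c_x_two (fun p q b hp hq hb => D.c_eq_zero.2 (hφ p q b hp hq hb)) hq)

theorem map_two_x
    (hφ : ∀ p q b, Low p → Low q → (b = 0 ∨ b = 3 ∨ b = -3) → φ (D.w (p ++ (b :: q))) = 0) :
    φ (D.w [2, 3, -2, 3]) = φ (D.w [3, -2, 3]) :=
  c_ker_eq.1 (c_two_x (fun p q b hp hq hb => D.c_eq_zero.2 (hφ p q b hp hq hb)))

theorem map_x_inv
    (hφ : ∀ p q b, Low p → Low q → (b = 0 ∨ b = 3 ∨ b = -3) → φ (D.w (p ++ (b :: q))) = 0)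
    {q : List ℤ} (hq : Low q) : D.U • φ (D.w (-3 :: (2 :: (-3 :: q)))) = φ
        (D.w (3 :: (-2 :: (3 :: q)))) := by
  have h := c_x_inv (W := LinearMap.ker φ) (fun p q b hp hq hb => D.c_eq_zero.2 (hφ p q b hp hq hb))
      hq
  simp only [c, Submodule.mkQ_apply, ← Submodule.Quotient.mk_smul] at h
  rw [Submodule.Quotient.eq, LinearMap.sub_mem_ker_iff, map_smul] at h
  exact h

end Functional

theorem peak_x_two {a : ℤ} (ha : a = 4 ∨ a = -4) {q : List ℤ} (hq : Low q) :
    D.m (a :: (3 :: (-2 :: (3 :: (2 :: (q ++ [4, -3, 4])))))) = D.m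
        (a :: (3 :: (-2 :: (3 :: (q ++ [4, -3, 4]))))) := by
  have := map_x_two (D := D) (φ := D.ctx (D.N 2) [a] [4, -3, 4]) (fun p q b hp hq hb => ?_) hq
  · simpa only [D.ctx_w, List.cons_append, List.append_assoc, List.nil_append] using this
  · rw [D.ctx_w]
    simpa using peak_low (D := D) ha hb hp hq

theorem peak_x_two' {a : ℤ} (ha : a = 4 ∨ a = -4) {q : List ℤ} (hq : Low q) :
    D.m (a :: (3 :: (-2 :: (3 :: (-2 :: (q ++ [4, -3, 4])))))) = D.m
        (a :: (3 :: (-2 :: (3 :: (q ++ [4, -3, 4]))))) := by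
  have h := peak_x_two (D := D) ha (hq.cons (a := -2) (by norm_num))
  have e := D.c_cancel (D.N 2) 2 [a, 3, -2, 3] (q ++ [4, -3, 4])
  exact h.symm.trans e

/-- The last 3 of x is absorbed by 43'4, after which the gap contains a single letter 3. -/
theorem peak_x {a : ℤ} (ha : a = 4 ∨ a = -4) : D.m [a, 3, -2, 3, 4, -3, 4] = 0 := by
  have h₁ : D.m [a, 3, -2, 3, -3, 3, 4, -3, 4] = D.m [a, 3, -2, 3, -3, 4, -3, 4] := peak_absorb
      (l := [3, -2, 3, -3]) (by decide)
  have h₂ : D.m [a, 3, -2, 3, -3, 3, 4, -3, 4] = D.m [a, 3, -2, 3, 4, -3, 4] := D.c_cancel' (D.N 2)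
      3 [a, 3, -2, 3] [4, -3, 4]
  have h₃ : D.m [a, 3, -2, 3, -3, 4, -3, 4] = D.m [a, 3, -2, 4, -3, 4] := D.c_cancel (D.N 2) 3 [a,
      3, -2] [4, -3, 4]
  exact h₂.symm.trans (h₁.trans (h₃.trans (peak_three ha (q := [-2]) (by simp) (by decide))))

/-- The peak 43'4 can also emit a 3. As braids, x123 = 12321'2, a gap with a single letter 3. -/
theorem peak_x_one_two {a : ℤ} (ha : a = 4 ∨ a = -4) : D.m [a, 3, -2, 3, 1, 2, 4, -3, 4] = 0 := by
  have h₁ : D.m [a, 3, -2, 3, 1, 2, 3, 4, -3, 4] = D.m [a, 3, -2, 3, 1, 2, 4, -3, 4] := peak_absorb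
      (l := [3, -2, 3, 1, 2]) (by decide)
  have h₂ : D.m [a, 3, -2, 3, 1, 2, 3, 4, -3, 4] = D.m [a, 1, 2, 3, 2, -1, 2, 4, -3, 4] := by
    rcases ha with rfl | rfl
    · exact c_eq [3, 4, 2] [2, 1, 4] (by decide)
    · exact c_eq [3, 4, 2] [2, 1, 4] (by decide)
  exact h₁.symm.trans (h₂.trans (peak_low ha (p := [1, 2]) (b := 3) (q := [2, -1, 2])
    (by decide) (by decide) (by decide)))

theorem peak_x_one_two_rev {a : ℤ} (ha : a = 4 ∨ a = -4) : D.m [4, -3, 4, 2, 1, 3, -2, 3, a] = 0 :=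
    by
  have := op_m_eq_zero D (peak_x_one_two (D := D.op) ha)
  simpa using this

theorem peak_x_one'_two' {a : ℤ} (ha : a = 4 ∨ a = -4) : D.m [a, 3, -2, 3, -1, -2, 4, -3, 4] = 0 :=
    by
  have h : D.m [a, 3, -2, 3, -1, -2, 4, -3, 4] = D.U • D.m [a, -2, -3, 2, -3, -1, -2, 4, -3, 4]
      + D.S • D.m [a, 3, -2, -1, -2, 4, -3, 4]
      - D.T • D.m [a, -2, -3, 2, -1, -2, 4, -3, 4] :=
    D.c_cube_left (D.N 2) 2 3 (by decide) [a] [-1, -2, 4, -3, 4]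
  have h₁ : D.m [a, 3, -2, -1, -2, 4, -3, 4] = 0 :=
    peak_low ha (p := []) (b := 3) (q := [-2, -1, -2]) (by decide) (by decide) (by decide)
  have h₂ : D.m [a, -2, -3, 2, -1, -2, 4, -3, 4] = 0 :=
    peak_low ha (p := [-2]) (b := -3) (q := [2, -1, -2]) (by decide) (by decide) (by decide)
  have h₃ : D.m [a, -2, -3, 2, -3, -1, -2, -3, 4, -3, 4] = D.m [a, -2, -3, 2, -3, -1, -2, 4, -3, 4]
      :=
    peak_absorb' (l := [-2, -3, 2, -3, -1, -2]) (by decide)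
  have h₄ : D.m [a, -2, -3, 2, -3, -1, -2, -3, 4, -3, 4] = D.m [a, -2, -1, -2, -3, -2, 1, -2, 4, -3,
      4] := by
    rcases ha with rfl | rfl
    · exact c_eq [4, 5, 3] [3, 2, 5] (by decide)
    · exact c_eq [4, 5, 3] [3, 2, 5] (by decide)
  have h₅ : D.m [a, -2, -1, -2, -3, -2, 1, -2, 4, -3, 4] = 0 :=
    peak_low ha (p := [-2, -1, -2]) (b := -3) (q := [-2, 1, -2]) (by decide) (by decide) (by decide)
  rw [h, ← h₃, h₄, h₅, h₁, h₂]
  simp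

/-- For a = 4, the peak is expanded and the main term is, as a braid, a word with only two letters
4^±. For a = 4', a braid relation moves the peak to the left; it then emits a 3', which leaves a
single letter 3' in the gap. -/
theorem peak_x_one'_two {a : ℤ} (ha : a = 4 ∨ a = -4) : D.m [a, 3, -2, 3, -1, 2, 4, -3, 4] = 0 := by
  rcases ha with rfl | rfl
  · have h : D.m [4, 3, -2, 3, -1, 2, 4, -3, 4] = D.U • D.m [4, 3, -2, 3, -1, 2, -4, 3, -4, -3]
      + D.S • D.m [4, 3, -2, 3, -1, 2, -3, 4]
      - D.T • D.m [4, 3, -2, 3, -1, 2, 3, -4, -3] := D.c_cube_right (D.N 2) 3 4 (by decide) [4, 3,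
          -2, 3, -1, 2] []
    have h₁ : D.m [4, 3, -2, 3, -1, 2, -4, 3, -4, -3] = 0 :=
      (c_eq (l' := [-3, -2, 4, -3, 2, -1, 2, -3, 4, 3, 2, -3]) [3, 5] [1, 2, 0, 2, 4, 3, 7, 6, 4, 6,
          8, 9] (by decide)).trans (m_zero (by decide))
    have h₂ : D.m [4, 3, -2, 3, -1, 2, -3, 4] = 0 := m_zero (by decide)
    have h₃ : D.m [4, 3, -2, 3, -1, 2, 3, -4, -3] = 0 := m_zero (by decide)
    rw [h, h₁, h₂, h₃]
    simp
  · have h₁ : D.m [-4, 3, -2, 3, -1, 2, 4, -3, 4] = D.m [3, 2, 4, -3, 4, -2, -1, -3, 2, -3, 4] :=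
      c_eq [5, 4] [1, 4, 2, 0, 2, 3, 5, 6] (by decide)
    have h₂ : D.m [4, -3, 4, -3, -2, -1, -3, 2, -3, 4] = D.m [4, -3, 4, -2, -1, -3, 2, -3, 4] :=
      peak_absorb_rev' (l := [-2, -1, -3, 2, -3]) (by decide)
    have h₃ : D.m [4, -3, 4, -3, -2, -1, -3, 2, -3, 4] = D.m [4, -3, 4, -2, 1, -2, -3, -2, -1, 4] :=
      c_eq [5, 3, 5] [5, 4, 7] (by decide)
    have h₄ : D.m [4, -3, 4, -2, 1, -2, -3, -2, -1, 4] = 0 :=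
      peak_low_rev (p := [-2, 1, -2]) (b := -3) (q := [-2, -1]) (by decide) (by decide) (by decide)
        (by decide)
    rw [h₁]
    exact m_prepend_zero [3, 2] (by decide) (h₂.symm.trans (h₃.trans h₄))

theorem peak_x_one_two' {a : ℤ} (ha : a = 4 ∨ a = -4) : D.m [a, 3, -2, 3, 1, -2, 4, -3, 4] = 0 := by
  rcases ha with rfl | rfl
  · have h : D.m [4, 3, -2, 3, 1, -2, 4, -3, 4] = D.U • D.m [4, 3, -2, 3, 1, -2, -4, 3, -4, -3]
      + D.S • D.m [4, 3, -2, 3, 1, -2, -3, 4]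
      - D.T • D.m [4, 3, -2, 3, 1, -2, 3, -4, -3] := D.c_cube_right (D.N 2) 3 4 (by decide) [4, 3,
          -2, 3, 1, -2] []
    have h₁ : D.m [4, 3, -2, 3, 1, -2, -4, 3, -4, -3] = 0 :=
      (c_eq [5, 4] [1, 4, 2, 0, 2, 3, 5, 6] (by decide)).trans
        (m_ctx_zero [-3, -2] [-3] (by decide) (by decide) (peak_x_one_two_rev (a := -4) (by simp)))
    have h₂ : D.m [4, 3, -2, 3, 1, -2, -3, 4] = 0 := m_zero (by decide)
    have h₃ : D.m [4, 3, -2, 3, 1, -2, 3, -4, -3] = 0 := m_zero (by decide)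
    rw [h, h₁, h₂, h₃]
    simp
  · have h₁ : D.m [-4, 3, -2, 3, 1, -2, 4, -3, 4] = D.m [3, 2, 4, -3, 4, -2, 1, -2, -3, -2, 4] :=
      c_eq [5, 4] [1, 4, 2, 0, 2, 3, 5, 6, 8] (by decide)
    rw [h₁]
    exact m_prepend_zero [3, 2] (by decide) (peak_low_rev (p := [-2, 1, -2]) (b := -3) (q := [-2])
      (by decide) (by decide) (by decide) (by decide))

/-- The word q is reduced to 2^a 1^b 2^c or 12'1. In this gap x absorbs the first power of 2,
leaving one case for each pair of exponents b, c; in 12'1 the last 1 passes through the peak. -/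
theorem peak_x_low {a : ℤ} (ha : a = 4 ∨ a = -4) {q : List ℤ} (hq : Low q) :
    D.m (a :: (3 :: (-2 :: (3 :: (q ++ [4, -3, 4]))))) = 0 := by
  have := low_zero (D := D) 2 1 (by simp) (D.ctx (D.N 2) [a, 3, -2, 3] [4, -3, 4])
      (fun i j c hi hj hc => ?_) ?_
    hq
  · rwa [D.ctx_w] at this
  · rw [D.ctx_w]
    have key : D.m [a, 3, -2, 3, j, c, 4, -3, 4] = 0 := by
      rcases hj with rfl | rfl | rfl
      · have e := D.c_zero (D.N 2) [a, 3, -2, 3] [c, 4, -3, 4]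
        refine e.trans ?_
        rcases hc with rfl | rfl | rfl
        · exact (D.c_zero (D.N 2) [a, 3, -2, 3] [4, -3, 4]).trans (peak_x ha)
        · exact (peak_x_two ha (q := []) (by decide)).trans (peak_x ha)
        · exact (peak_x_two' ha (q := []) (by decide)).trans (peak_x ha)
      · rcases hc with rfl | rfl | rfl
        · exact (D.c_zero (D.N 2) [a, 3, -2, 3, 1] [4, -3, 4]).trans
            (peak_one_right (l := [3, -2, 3]) (q := [1]) (by decide) (peak_x ha))
        · exact peak_x_one_two ha
        · exact peak_x_one_two' ha
      · rcases hc with rfl | rfl | rfl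
        · exact (D.c_zero (D.N 2) [a, 3, -2, 3, -1] [4, -3, 4]).trans
            (peak_one_right (l := [3, -2, 3]) (q := [-1]) (by decide) (peak_x ha))
        · exact peak_x_one'_two ha
        · exact peak_x_one'_two' ha
    have hl : Low [j, c] := by
      rcases hj with rfl | rfl | rfl <;> rcases hc with rfl | rfl | rfl <;> decide
    rcases hi with rfl | rfl | rfl
    · exact (D.c_zero (D.N 2) [a, 3, -2, 3] [j, c, 4, -3, 4]).trans key
    · exact (peak_x_two ha hl).trans key
    · exact (peak_x_two' ha hl).trans key
  · rw [D.ctx_w]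
    exact peak_one_right (l := [3, -2, 3, 1, -2]) (q := [1]) (by decide) (peak_x_one_two' ha)

/-- The products `4^± l 43'4` have at most two factors `4^±` modulo shorter words. -/
theorem peak_zero {a : ℤ} (ha : a = 4 ∨ a = -4) {l : List ℤ} (hl : Mid l) :
    D.m (a :: (l ++ [4, -3, 4])) = 0 := by
  have := mid_zero (D := D) (D.ctx (D.N 2) [a] [4, -3, 4]) (fun p q b hp hq hb => ?_)
    (fun p q hp hq => ?_) ?_ ?_ hl
  · rwa [D.ctx_w] at this
  · rw [D.ctx_w]
    simpa using peak_low (D := D) ha hb hp hq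
  · rw [D.ctx_w]
    simpa using peak_low_left (D := D) (l := (3 :: (-2 :: (3 :: q)))) ha hp (peak_x_low ha hq)
  · rw [D.ctx_w]
    have h₁ : D.m [a, 3, 2, -1, 2, 3, 4, -3, 4] = D.m [a, 3, 2, -1, 2, 4, -3, 4] := peak_absorb
        (l := [3, 2, -1, 2]) (by decide)
    exact h₁.trans (peak_three ha (q := [2, -1, 2]) (by simp) (by decide))
  · rw [D.ctx_w]
    have h₁ : D.m [a, -3, -2, 1, -2, -3, 4, -3, 4] = D.m [a, -3, -2, 1, -2, 4, -3, 4] :=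
        peak_absorb' (l := [-3, -2, 1, -2]) (by decide)
    exact h₁.trans (peak_three ha (q := [-2, 1, -2]) (by simp) (by decide))

theorem peak_zero_rev {a : ℤ} (ha : a = 4 ∨ a = -4) {l : List ℤ} (hl : Mid l) :
    D.m (4 :: (-3 :: (4 :: (l ++ [a])))) = 0 := by
  have := op_m_eq_zero D (peak_zero (D := D.op) ha hl.reverse)
  simpa using this

end CubicSys

namespace CubicSys

variable {k A : Type} [CommRing k] [Ring A] [Algebra k A] {D : CubicSys k A}

/-! ### The products with three factors `4^±` -/

theorem peak_inv_zero {a : ℤ} (ha : a = 4 ∨ a = -4) {l : List ℤ} (hl : Mid l) :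
    D.m (a :: (l ++ [-4, 3, -4])) = 0 := by
  have := bar_m_eq_zero D (peak_zero (D := D.bar) (a := -a) (by omega) hl.neg)
  simpa [Function.comp_def] using this

theorem peak_inv_zero_rev {a : ℤ} (ha : a = 4 ∨ a = -4) {l : List ℤ} (hl : Mid l) :
    D.m (-4 :: (3 :: (-4 :: (l ++ [a])))) = 0 := by
  have := op_m_eq_zero D (peak_inv_zero (D := D.op) ha hl.reverse)
  simpa using this

/-- With at most one letter 3^± between them, the last two letters 4^± either lose one by a cubic or
braid relation, or form 43'4 or 4'34', to which `peak_zero` or its image under `bar` applies. -/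
theorem short_right_three {a b c d : ℤ} (ha : a = 4 ∨ a = -4) (hb : b = 4 ∨ b = -4)
    (hc : c = 4 ∨ c = -4) (hd : d = 0 ∨ d = 3 ∨ d = -3) {l : List ℤ} (hl : Mid l) :
    D.m (a :: (l ++ [b, d, c])) = 0 := by
  have short : ∀ {b' c' d' : ℤ}, b'.natAbs ≤ 3 → d'.natAbs ≤ 3 →
      D.m (a :: (l ++ [b', c', d'])) = 0 := by
    intro b' c' d' h h'
    refine m_zero ?_
    simp only [count4_cons, count4_append, hl.count4, count4_nil]
    split_ifs <;> omega
  have sq : ∀ {b' c' : ℤ}, count4 [b', c'] ≤ 1 → D.m (a :: (l ++ [b', c'])) = 0 := by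
    intro b' c' h
    refine m_zero ?_
    rw [count4_cons, count4_append, hl.count4]
    split_ifs <;> omega
  have nil : D.m (a :: l) = 0 := m_zero (by
    rw [count4_cons, hl.count4]
    split_ifs <;> omega)
  have one : ∀ {b' : ℤ}, D.m (a :: (l ++ [b'])) = 0 := m_zero (by
    simp only [count4_cons, count4_append, hl.count4, count4_nil]
    split_ifs <;> omega)
  rcases hd with rfl | rfl | rfl
  · have e : D.m (a :: (l ++ [b, 0, c])) = D.m (a :: (l ++ [b, c])) := by
      simpa using D.c_zero (D.N 2) (a :: (l ++ [b])) [c]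
    rw [e]
    rcases hb with rfl | rfl <;> rcases hc with rfl | rfl
    · have h := D.c_cubic (D.N 2) 4 (by norm_num) (a :: (l ++ [4])) []
      have e₁ := D.c_cancel (D.N 2) 4 (a :: l) []
      have e₂ := D.c_cancel (D.N 2) 4 (a :: l) [-4]
      simp only [List.append_assoc, List.cons_append, List.nil_append, List.append_nil]
        at h e₁ e₂
      rw [e₁, e₂] at h
      exact h.trans (by rw [← m, ← m, ← m, nil, one, one]; simp)
    · have e₁ := D.c_cancel (D.N 2) 4 (a :: l) []
      simp only [List.cons_append, List.append_nil] at e₁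
      exact e₁.trans nil
    · have e₁ := D.c_cancel' (D.N 2) 4 (a :: l) []
      simp only [List.cons_append, List.append_nil] at e₁
      exact e₁.trans nil
    · have h := D.c_cubic' (D.N 2) 4 (by norm_num) (a :: (l ++ [-4])) []
      have e₁ := D.c_cancel' (D.N 2) 4 (a :: l) []
      have e₂ := D.c_cancel' (D.N 2) 4 (a :: l) [4]
      simp only [List.append_assoc, List.cons_append, List.nil_append, List.append_nil]
        at h e₁ e₂
      rw [e₁, e₂] at h
      exact h.trans (by rw [← m, ← m, ← m, nil, one, one]; simp)
  · rcases hb with rfl | rfl <;> rcases hc with rfl | rfl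
    · have := c_eq_ctx (D := D) (W := D.N 2) (l := [4, 3, 4]) (l' := [3, 4, 3]) (a :: l) []
        [0] [] (by decide)
      exact this.trans (short (by decide) (by decide))
    · have := c_eq_ctx (D := D) (W := D.N 2) (l := [4, 3, -4]) (l' := [-3, 4, 3]) (a :: l) []
        [0] [] (by decide)
      exact this.trans (short (by decide) (by decide))
    · have := c_eq_ctx (D := D) (W := D.N 2) (l := [-4, 3, 4]) (l' := [3, 4, -3]) (a :: l) []
        [0] [] (by decide)
      exact this.trans (short (by decide) (by decide))
    · exact peak_inv_zero ha hl
  · rcases hb with rfl | rfl <;> rcases hc with rfl | rfl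
    · exact peak_zero ha hl
    · have := c_eq_ctx (D := D) (W := D.N 2) (l := [4, -3, -4]) (l' := [-3, -4, 3]) (a :: l) []
        [0] [] (by decide)
      exact this.trans (short (by decide) (by decide))
    · have := c_eq_ctx (D := D) (W := D.N 2) (l := [-4, -3, 4]) (l' := [3, -4, -3]) (a :: l) []
        [0] [] (by decide)
      exact this.trans (short (by decide) (by decide))
    · have := c_eq_ctx (D := D) (W := D.N 2) (l := [-4, -3, -4]) (l' := [-3, -4, -3]) (a :: l) []
        [0] [] (by decide)
      exact this.trans (short (by decide) (by decide))

theorem short_right {a b c d : ℤ} (ha : a = 4 ∨ a = -4) (hb : b = 4 ∨ b = -4)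
    (hc : c = 4 ∨ c = -4) (hd : d = 0 ∨ d = 3 ∨ d = -3) {l p q : List ℤ} (hl : Mid l)
    (hp : Low p) (hq : Low q) : D.m (a :: (l ++ (b :: (p ++ (d :: (q ++ [c])))))) = 0 := by
  have e₁ := c_low_comm (D := D) (W := D.N 2) b (by omega) hp (a :: l) (d :: (q ++ [c]))
  have e₂ := c_low_comm (D := D) (W := D.N 2) c (by omega) hq (a :: (l ++ (p ++ [b, d]))) []
  have h := m_append_zero q hq.mid (short_right_three (D := D) ha hb hc hd (hl.append hp.mid))
  simp only [List.append_assoc, List.cons_append, List.nil_append, List.append_nil] at e₁ e₂ h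
  exact e₁.trans (e₂.symm.trans h)

theorem short_left {a b c d : ℤ} (ha : a = 4 ∨ a = -4) (hb : b = 4 ∨ b = -4)
    (hc : c = 4 ∨ c = -4) (hd : d = 0 ∨ d = 3 ∨ d = -3) {l p q : List ℤ} (hl : Mid l)
    (hp : Low p) (hq : Low q) : D.m (a :: (p ++ (d :: (q ++ (b :: (l ++ [c])))))) = 0 := by
  have := op_m_eq_zero D (short_right (D := D.op) hc hb ha hd hl.reverse hq.reverse hp.reverse)
  simpa using this

/-- The context of the first factor of a product with three factors `4^±`. -/
theorem left_short {a b c : ℤ} (ha : a = 4 ∨ a = -4) (hb : b = 4 ∨ b = -4)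
    (hc : c = 4 ∨ c = -4) {p r l : List ℤ} (hp : Low p) (hr : Low r) (hl : Mid l) :
    ∀ p' q d, Low p' → Low q → (d = 0 ∨ d = 3 ∨ d = -3) →
      D.ctx (D.N 2) (a :: p) (r ++ (b :: (l ++ [c]))) (D.w (p' ++ (d :: q))) = 0 := by
  intro p' q d hp' hq hd
  rw [D.ctx_w]
  simpa using short_left (D := D) ha hb hc hd hl (hp.append hp') (hq.append hr)

/-- The context of the second factor of a product with three factors `4^±`. -/
theorem right_short {a b c : ℤ} (ha : a = 4 ∨ a = -4) (hb : b = 4 ∨ b = -4)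
    (hc : c = 4 ∨ c = -4) {p r l : List ℤ} (hp : Low p) (hr : Low r) (hl : Mid l) :
    ∀ p' q d, Low p' → Low q → (d = 0 ∨ d = 3 ∨ d = -3) →
      D.ctx (D.N 2) (a :: (l ++ (b :: p))) (r ++ [c]) (D.w (p' ++ (d :: q))) = 0 := by
  intro p' q d hp' hq hd
  rw [D.ctx_w]
  simpa using short_right (D := D) ha hb hc hd hl (hp.append hp') (hq.append hr)

/-! ### The products `4x q 4x4` -/

/-- All gaps with at most one letter 3^± vanish, which is exactly the hypothesis under which x
absorbs 2. -/
theorem left_x_two {a b c : ℤ} (ha : a = 4 ∨ a = -4) (hb : b = 4 ∨ b = -4)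
    (hc : c = 4 ∨ c = -4) {q l : List ℤ} (hq : Low q) (hl : Mid l) :
    D.m (a :: (3 :: (-2 :: (3 :: (2 :: (q ++ (b :: (l ++ [c])))))))) = D.m
        (a :: (3 :: (-2 :: (3 :: (q ++ (b :: (l ++ [c]))))))) := by
  have := map_x_two (left_short (D := D) (p := []) (r := []) ha hb hc (by decide) (by decide) hl) hq
  simpa only [D.ctx_w, List.cons_append, List.append_assoc, List.nil_append] using this

theorem right_two_x {a b c : ℤ} (ha : a = 4 ∨ a = -4) (hb : b = 4 ∨ b = -4)
    (hc : c = 4 ∨ c = -4) {l : List ℤ} (hl : Mid l) :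
    D.m (a :: (l ++ [b, 2, 3, -2, 3, c])) = D.m (a :: (l ++ [b, 3, -2, 3, c])) := by
  have := map_two_x (right_short (D := D) (p := []) (r := []) ha hb hc (by decide) (by decide) hl)
  simpa only [D.ctx_w, List.cons_append, List.append_assoc, List.nil_append] using this

theorem x_two_left {q : List ℤ} (hq : Low q) : D.m (4 :: (3 :: (-2 :: (3 :: (2 :: (q ++ [4, 3, -2,
    3, 4])))))) = D.m (4 :: (3 :: (-2 :: (3 :: (q ++ [4, 3, -2, 3, 4]))))) :=
  left_x_two (l := [3, -2, 3]) (by simp) (by simp) (by simp) hq (by decide)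

theorem x_inv_left {q : List ℤ} (hq : Low q) : D.m (4 :: (3 :: (-2 :: (3 :: (-2 :: (q ++ [4, 3, -2,
    3, 4])))))) = D.m (4 :: (3 :: (-2 :: (3 :: (q ++ [4, 3, -2, 3, 4]))))) := by
  have h := x_two_left (D := D) (hq.cons (a := -2) (by decide))
  have e := D.c_cancel (D.N 2) 2 [4, 3, -2, 3] (q ++ [4, 3, -2, 3, 4])
  simp only [List.cons_append, List.nil_append] at e h
  exact h.symm.trans e

theorem x_two_right {q : List ℤ} (hq : Low q) : D.m (4 :: (3 :: (-2 :: (3 :: (q ++ [2, 4, 3, -2, 3,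
    4]))))) = D.m (4 :: (3 :: (-2 :: (3 :: (q ++ [4, 3, -2, 3, 4]))))) := by
  have h := right_two_x (D := D) (a := 4) (b := 4) (c := 4) (l := (3 :: (-2 :: (3 :: q)))) (by simp)
      (by simp)
    (by simp) (hq.mid.cons (by decide) |>.cons (by decide) |>.cons (by decide))
  have e := c_low_comm (D := D) (W := D.N 2) 4 rfl (q := [2]) (by decide)
      (4 :: (3 :: (-2 :: (3 :: q)))) [3, -2, 3, 4]
  simp only [List.cons_append, List.nil_append] at e h
  exact e.symm.trans h

theorem x_inv_right {q : List ℤ} (hq : Low q) : D.m (4 :: (3 :: (-2 :: (3 :: (q ++ [-2, 4, 3, -2, 3,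
    4]))))) = D.m (4 :: (3 :: (-2 :: (3 :: (q ++ [4, 3, -2, 3, 4]))))) := by
  have h := x_two_right (D := D) (hq.append (l' := [-2]) (by decide))
  have e := D.c_cancel' (D.N 2) 2 (4 :: (3 :: (-2 :: (3 :: q)))) [4, 3, -2, 3, 4]
  simp only [List.append_assoc, List.cons_append, List.nil_append] at e h
  exact h.symm.trans e

/-- The product `4x4` in terms of products with mixed signs. -/
theorem c_x_left (W : Submodule k A) (p r : List ℤ) :
    D.c W (p ++ (4 :: (3 :: (-2 :: (3 :: (4 :: r)))))) = D.S • D.c W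
        (p ++ (3 :: (-2 :: (3 :: (4 :: r))))) - D.T • D.c W
        (p ++ (3 :: (2 :: (4 :: (-3 :: (4 :: (-2 :: (-3 :: r))))))))
      + D.U • D.c W (p ++ (3 :: (4 :: (-3 :: (2 :: (-3 :: (4 :: (-2 :: (-3 :: r))))))))) := by
  have h := D.c_cubic W 4 (by norm_num) p (3 :: (-2 :: (3 :: (4 :: r))))
  have h₁ := c_eq_ctx (D := D) (W := W) (l := [-4, 3, -2, 3, 4]) (l' := [3, 2, 4, -3, 4, -2, -3])
      p r [] [1, 4, 2, 0, 2, 3, 5] (by decide)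
  have h₂ := c_eq_ctx (D := D) (W := W) (l := [-4, -4, 3, -2, 3, 4]) (l' := [3, 4, -3, 2, -3, 4, -2,
      -3]) p r [] [0, 5, 3, 1, 3, 4, 6] (by decide)
  simp only [List.cons_append, List.nil_append] at h₁ h₂
  rw [h, h₁, h₂]

theorem c_x_right (W : Submodule k A) (p r : List ℤ) :
    D.c W (p ++ (4 :: (3 :: (-2 :: (3 :: (4 :: r)))))) = D.S • D.c W
        (p ++ (4 :: (3 :: (-2 :: (3 :: r))))) - D.T • D.c W
        (p ++ (-3 :: (-2 :: (4 :: (-3 :: (4 :: (2 :: (3 :: r))))))))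
      + D.U • D.c W (p ++ (-3 :: (-2 :: (4 :: (-3 :: (2 :: (-3 :: (4 :: (3 :: r))))))))) := by
  have h := D.c_cubic W 4 (by norm_num) (p ++ [4, 3, -2, 3]) r
  have h₁ := c_eq_ctx (D := D) (W := W) (l := [4, 3, -2, 3, -4]) (l' := [-3, -2, 4, -3, 4, 2, 3])
      p r [] [1, 4, 2, 0, 2, 3, 5] (by decide)
  have h₂ := c_eq_ctx (D := D) (W := W) (l := [4, 3, -2, 3, -4, -4]) (l' := [-3, -2, 4, -3, 2, -3,
      4, 3]) p r [] [1, 2, 0, 2, 5, 3, 5] (by decide)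
  simp only [List.append_assoc, List.cons_append, List.nil_append] at h h₁ h₂
  rw [h, h₁, h₂]

/-- The power of 1 commutes past 4, and 4x4 is expanded by `c_x_left`. The first term is short, the
second contains 43'4, and in the third a braid relation leaves a single 3 in the last gap. -/
theorem x_one {j : ℤ} (hj : j = 0 ∨ j = 1 ∨ j = -1) : D.m [4, 3, -2, 3, j, 4, 3, -2, 3, 4] = 0 := by
  have hl : Low [j] := by rcases hj with rfl | rfl | rfl <;> decide
  have e := c_low_comm (D := D) (W := D.N 2) 4 rfl hl [4, 3, -2, 3] [3, -2, 3, 4]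
  refine e.symm.trans ?_
  have h : D.m [4, 3, -2, 3, 4, j, 3, -2, 3, 4] = D.S • D.m [3, -2, 3, 4, j, 3, -2, 3, 4]
      - D.T • D.m [3, 2, 4, -3, 4, -2, -3, j, 3, -2, 3, 4]
      + D.U • D.m [3, 4, -3, 2, -3, 4, -2, -3, j, 3, -2, 3, 4] := D.c_x_left (D.N 2) [] [j, 3, -2,
          3, 4]
  have h₁ : D.m [3, -2, 3, 4, j, 3, -2, 3, 4] = 0 := m_zero
      (by rcases hj with rfl | rfl | rfl <;> decide)
  have h₂ : D.m [4, -3, 4, -2, -3, j, 3, -2, 3, 4] = 0 :=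
    peak_zero_rev (l := [-2, -3, j, 3, -2, 3]) (by simp)
        (by rcases hj with rfl | rfl | rfl <;> decide)
  have h₃ : D.m [3, 2, 4, -3, 4, -2, -3, j, 3, -2, 3, 4] = 0 := m_prepend_zero [3, 2] (by decide) h₂
  have h₄ : D.m [4, -3, 2, -3, 4, -2, -3, j, 3, -2, 3, 4] = 0 := by
    have e : D.m [4, -3, 2, -3, 4, -2, -3, j, 3, -2, 3, 4] = D.m [4, -3, 2, -3, 4, -2, j, -2, 3, 4]
        := by
      rcases hj with rfl | rfl | rfl
      · have e₁ : D.m [4, -3, 2, -3, 4, -2, -3, 0, 3, -2, 3, 4] = D.m [4, -3, 2, -3, 4, -2, -3, 3,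
          -2, 3, 4] := D.c_zero (D.N 2) [4, -3, 2, -3, 4, -2, -3] [3, -2, 3, 4]
        have e₂ : D.m [4, -3, 2, -3, 4, -2, 0, -2, 3, 4] = D.m [4, -3, 2, -3, 4, -2, -2, 3, 4] :=
            D.c_zero (D.N 2) [4, -3, 2, -3, 4, -2] [-2, 3, 4]
        have e₃ : D.m [4, -3, 2, -3, 4, -2, -3, 3, -2, 3, 4] = D.m [4, -3, 2, -3, 4, -2, -2, 3, 4]
            := c_eq [6] [] (by decide)
        rw [e₁, e₂, e₃]
      · exact c_eq [6, 7] [] (by decide)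
      · exact c_eq [6, 7] [] (by decide)
    rw [e]
    exact short_right (l := [-3, 2, -3]) (p := [-2, j, -2]) (q := []) (by simp) (by simp) (by simp)
        (by simp)
      (by decide) (by rcases hj with rfl | rfl | rfl <;> decide) (by decide)
  have h₅ : D.m [3, 4, -3, 2, -3, 4, -2, -3, j, 3, -2, 3, 4] = 0 := m_prepend_zero [3] (by decide)
      h₄
  exact h.trans (by rw [h₁, h₃, h₅]; simp)

/-- The products `4x q 4x4` are multiples of `4xy4x4` modulo shorter products. -/
theorem x_low_mem {q : List ℤ} (hq : Low q) :
    D.m (4 :: (3 :: (-2 :: (3 :: (q ++ [4, 3, -2, 3, 4]))))) ∈ Submodule.span k {D.m [4, 3, -2, 3,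
        1, -2, 1, 4, 3, -2, 3, 4]} := by
  have := low_zero (D := D) 2 1 (by simp)
    ((Submodule.span k {D.m [4, 3, -2, 3, 1, -2, 1, 4, 3, -2, 3, 4]}).mkQ ∘ₗ D.ctx (D.N 2) [4, 3,
        -2, 3] [4, 3, -2, 3, 4]) (fun a b c ha hb hc => ?_) ?_
    hq
  · rw [LinearMap.comp_apply, D.ctx_w, Submodule.mkQ_apply, Submodule.Quotient.mk_eq_zero] at this
    simpa only [List.cons_append, List.nil_append] using this
  · rw [LinearMap.comp_apply, D.ctx_w, Submodule.mkQ_apply, Submodule.Quotient.mk_eq_zero]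
    suffices h : D.m [4, 3, -2, 3, a, b, c, 4, 3, -2, 3, 4] = 0 by
      simp only [List.cons_append, List.nil_append]
      rw [← m, h]
      exact Submodule.zero_mem _
    have h₁ : D.m [4, 3, -2, 3, b, c, 4, 3, -2, 3, 4] = 0 := by
      have hl : Low [b] := by rcases hb with rfl | rfl | rfl <;> decide
      rcases hc with rfl | rfl | rfl
      · exact (D.c_zero (D.N 2) [4, 3, -2, 3, b] [4, 3, -2, 3, 4]).trans (x_one hb)
      · exact (x_two_right hl).trans (x_one hb)
      · exact (x_inv_right hl).trans (x_one hb)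
    have hl : Low [b, c] := by
      rcases hb with rfl | rfl | rfl <;> rcases hc with rfl | rfl | rfl <;> decide
    rcases ha with rfl | rfl | rfl
    · exact (D.c_zero (D.N 2) [4, 3, -2, 3] [b, c, 4, 3, -2, 3, 4]).trans h₁
    · exact (x_two_left hl).trans h₁
    · exact (x_inv_left hl).trans h₁
  · rw [LinearMap.comp_apply, D.ctx_w, Submodule.mkQ_apply, Submodule.Quotient.mk_eq_zero]
    exact Submodule.subset_span rfl

/-! ### Invariance of `4xy4x4` -/

/-- The 2 commutes with the last 4 and is absorbed by the second x. -/
theorem z_two : D.m [4, 3, -2, 3, 1, -2, 1, 4, 3, -2, 3, 4, 2] = D.m [4, 3, -2, 3, 1, -2, 1, 4, 3,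
    -2, 3, 4] := by
  have h := map_x_two (right_short (D := D) (a := 4) (b := 4) (c := 4) (p := []) (r := [])
    (l := [3, -2, 3, 1, -2, 1]) (by simp) (by simp) (by simp) (by decide) (by decide) (by decide))
        (q := [])
    (by decide)
  simp only [D.ctx_w, List.cons_append, List.nil_append] at h
  have e : D.m [4, 3, -2, 3, 1, -2, 1, 4, 3, -2, 3, 4, 2] = D.m [4, 3, -2, 3, 1, -2, 1, 4, 3, -2, 3,
      2, 4] := c_eq [11] [] (by decide)
  exact e.trans h

/-- Expanding one letter of 22 gives 121, 11 and U 12'1. Since 121 = 212, the first two vanish by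
absorption of 2, the cubic relation for 1 and `x_one`. -/
theorem x_one_two_two_one : D.m [4, 3, -2, 3, 1, 2, 2, 1, 4, 3, -2, 3, 4] = D.U • D.m [4, 3, -2, 3,
    1, -2, 1, 4, 3, -2, 3, 4] := by
  have h : D.m [4, 3, -2, 3, 1, 2, 2, 1, 4, 3, -2, 3, 4] = D.S • D.m [4, 3, -2, 3, 1, 2, 1, 4, 3,
      -2, 3, 4] - D.T • D.m [4, 3, -2, 3, 1, -2, 2, 1, 4, 3, -2, 3, 4]
      + D.U • D.m [4, 3, -2, 3, 1, -2, -2, 2, 1, 4, 3, -2, 3, 4] := D.c_cubic (D.N 2) 2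
          (by norm_num) [4, 3, -2, 3, 1] [2, 1, 4, 3, -2, 3, 4]
  have h₁ : D.m [4, 3, -2, 3, 1, 2, 1, 4, 3, -2, 3, 4] = 0 := by
    have e : D.m [4, 3, -2, 3, 1, 2, 1, 4, 3, -2, 3, 4] = D.m [4, 3, -2, 3, 2, 1, 2, 4, 3, -2, 3, 4]
        := c_eq [4] [] (by decide)
    exact e.trans ((x_two_left (q := [1, 2]) (by decide)).trans
      ((x_two_right (q := [1]) (by decide)).trans (x_one (by simp))))
  have h₂ : D.m [4, 3, -2, 3, 1, -2, 2, 1, 4, 3, -2, 3, 4] = 0 := by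
    have e : D.m [4, 3, -2, 3, 1, -2, 2, 1, 4, 3, -2, 3, 4] = D.m [4, 3, -2, 3, 1, 1, 4, 3, -2, 3,
        4] := c_eq [5] [] (by decide)
    have h : D.m [4, 3, -2, 3, 1, 1, 4, 3, -2, 3, 4] = D.S • D.m [4, 3, -2, 3, 1, 4, 3, -2, 3, 4]
        - D.T • D.m [4, 3, -2, 3, -1, 1, 4, 3, -2, 3, 4]
      + D.U • D.m [4, 3, -2, 3, -1, -1, 1, 4, 3, -2, 3, 4] := D.c_cubic (D.N 2) 1 (by norm_num) [4,
          3, -2, 3] [1, 4, 3, -2, 3, 4]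
    have z₁ : D.m [4, 3, -2, 3, 1, 4, 3, -2, 3, 4] = 0 := x_one (by simp)
    have z₂ : D.m [4, 3, -2, 3, -1, 1, 4, 3, -2, 3, 4] = 0 := by
      have e : D.m [4, 3, -2, 3, -1, 1, 4, 3, -2, 3, 4] = D.m [4, 3, -2, 3, 4, 3, -2, 3, 4] := c_eq
          [4] [] (by decide)
      have e' : D.m [4, 3, -2, 3, 0, 4, 3, -2, 3, 4] = D.m [4, 3, -2, 3, 4, 3, -2, 3, 4] := D.c_zero
          (D.N 2) [4, 3, -2, 3] [4, 3, -2, 3, 4]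
      exact e.trans (e'.symm.trans (x_one (by simp)))
    have z₃ : D.m [4, 3, -2, 3, -1, -1, 1, 4, 3, -2, 3, 4] = 0 := by
      have e : D.m [4, 3, -2, 3, -1, -1, 1, 4, 3, -2, 3, 4] = D.m [4, 3, -2, 3, -1, 4, 3, -2, 3, 4]
          := c_eq [5] [] (by decide)
      exact e.trans (x_one (by simp))
    rw [e, h, z₁, z₂, z₃]
    simp
  have h₃ : D.m [4, 3, -2, 3, 1, -2, -2, 2, 1, 4, 3, -2, 3, 4] = D.m [4, 3, -2, 3, 1, -2, 1, 4, 3,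
      -2, 3, 4] := c_eq [6] [] (by decide)
  rw [h, h₁, h₂, h₃]
  simp

/-- The key relation between left and right multiplication. -/
theorem three_z_right : D.m [3, 4, 3, -2, 3, 1, -2, 1, 4, 3, -2, 3, 4, -1, -2, 1] = D.m [4, 3, -2,
    3, 1, -2, 1, 4, 3, -2, 3, 4] := by
  have h₁ : D.m [4, 3, -2, 3, 1, -2, 1, 4, 3, -2, 3, 4] = D.m [4, 3, -2, 3, 4, 1, -2, 1, 3, -2, 3,
      4] := c_eq [6, 5] [4] (by decide)
  have h₂ : D.m [4, 3, -2, 3, 4, 1, -2, 1, 3, -2, 3, 4] = D.S • D.m [3, -2, 3, 4, 1, -2, 1, 3, -2,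
      3, 4] - D.T • D.m [3, 2, 4, -3, 4, -2, -3, 1, -2, 1, 3, -2, 3, 4]
      + D.U • D.m [3, 4, -3, 2, -3, 4, -2, -3, 1, -2, 1, 3, -2, 3, 4] := D.c_x_left (D.N 2) [] [1,
          -2, 1, 3, -2, 3, 4]
  have z₁ : D.m [3, -2, 3, 4, 1, -2, 1, 3, -2, 3, 4] = 0 := m_zero (by decide)
  have z₂ : D.m [3, 2, 4, -3, 4, -2, -3, 1, -2, 1, 3, -2, 3, 4] = 0 := m_prepend_zero [3, 2]
      (by decide)
    (peak_zero_rev (l := [-2, -3, 1, -2, 1, 3, -2, 3]) (by simp) (by decide))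
  have h₃ : D.m [3, 4, -3, 2, -3, 4, -2, -3, 1, -2, 1, 3, -2, 3, 4] = D.m [3, 4, -3, 2, -3, 4, -2,
      1, 2, -3, -2, 1, -2, 3, 4] :=
    c_eq [7, 10] [8] (by decide)
  -- Replacing 2'12' by V 21'21 turns the main term, as a braid, into 4·3'23'·2'1221·4x4·1'2'1; the
  -- two other terms have a short last gap.
  have h₄ : D.m [4, -3, 2, -3, 4, -2, 1, 2, -3, -2, 1, -2, 3, 4] = D.V • D.m [4, -3, 2, -3, 4, -2,
      1, 2, -3, 2, -1, 2, 1, 3, 4]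
      - (D.V * D.S) • D.m [4, -3, 2, -3, 4, -2, 1, 2, -3, -1, 2, 1, 3, 4] + (D.V * D.T) • D.m [4,
          -3, 2, -3, 4, -2, 1, 2, -3, 1, -2, 3, 4] :=
    D.c_cube_inv (D.N 2) 1 2 (by decide) [4, -3, 2, -3, 4, -2, 1, 2, -3] [3, 4]
  have z₃ : D.m [4, -3, 2, -3, 4, -2, 1, 2, -3, -1, 2, 1, 3, 4] = 0 := by
    have e : D.m [4, -3, 2, -3, 4, -2, 1, 2, -3, -1, 2, 1, 3, 4] = D.m [4, -3, 2, -3, 4, -2, 1, 2,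
        -1, 2, 3, -2, 1, 4] :=
      c_eq [8, 11] [9] (by decide)
    exact e.trans (short_right (l := [-3, 2, -3]) (p := [-2, 1, 2, -1, 2]) (d := 3) (q := [-2,
        1]) (by simp) (by simp)
      (by simp) (by simp) (by decide) (by decide) (by decide))
  have z₄ : D.m [4, -3, 2, -3, 4, -2, 1, 2, -3, 1, -2, 3, 4] = 0 := by
    have e : D.m [4, -3, 2, -3, 4, -2, 1, 2, -3, 1, -2, 3, 4] = D.m [4, -3, 2, -3, 4, -2, 1, 2, 1,
        2, -3, -2, 4] :=
      c_eq [8] [9] (by decide)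
    exact e.trans (short_right (l := [-3, 2, -3]) (p := [-2, 1, 2, 1, 2]) (d := -3) (q :=
        [-2]) (by simp) (by simp)
      (by simp) (by simp) (by decide) (by decide) (by decide))
  have h₅ : D.m [4, -3, 2, -3, 4, -2, 1, 2, -3, 2, -1, 2, 1, 3, 4] = D.m [4, -3, 2, -3, -2, 1, 2, 2,
      1, 4, 3, -2, 3, 4, -1, -2, 1] :=
    c_eq [4, 5, 6, 12, 13] [8, 7, 9, 13, 12, 10, 8, 10, 11, 13, 14] (by decide)
  -- U 3'23' becomes x, which absorbs 2'. What remains is 4x·1221·4x4 = U z, so the two factors U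
  -- cancel.
  have h₆ : D.U • D.m [4, -3, 2, -3, -2, 1, 2, 2, 1, 4, 3, -2, 3, 4] = D.m [4, 3, -2, 3, -2, 1, 2,
      2, 1, 4, 3, -2, 3, 4] := by
    have := map_x_inv (left_short (D := D) (a := 4) (b := 4) (c := 4) (p := []) (r := [])
      (l := [3, -2, 3]) (by simp) (by simp) (by simp) (by decide) (by decide) (by decide)) (q :=
          [-2, 1, 2, 2, 1])
      (by decide)
    simpa only [D.ctx_w, List.cons_append, List.nil_append] using this
  have h₇ : D.m [4, 3, -2, 3, -2, 1, 2, 2, 1, 4, 3, -2, 3, 4] = D.m [4, 3, -2, 3, 1, 2, 2, 1, 4, 3,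
      -2, 3, 4] := x_inv_left (q := [1, 2, 2, 1]) (by decide)
  rw [h₇, x_one_two_two_one] at h₆
  have h₈ : D.m [4, -3, 2, -3, -2, 1, 2, 2, 1, 4, 3, -2, 3, 4] = D.m [4, 3, -2, 3, 1, -2, 1, 4, 3,
      -2, 3, 4] := by
    have := congrArg (D.V • ·) h₆
    simpa only [smul_smul, D.VU, one_smul] using this
  have h₉ := congrArg (D.act [3] [-1, -2, 1] (by decide) (by decide)) h₈
  have h₁₀ := congrArg (D.act [3] [] (by decide) (by decide)) h₄
  simp only [map_add, map_sub, map_smul, z₃, z₄, map_zero, smul_zero, act_m, List.cons_append,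
    List.nil_append, List.append_nil] at h₉ h₁₀
  have h₁₁ : D.m [3, 4, -3, 2, -3, 4, -2, 1, 2, -3, 2, -1, 2, 1, 3, 4] = D.m [3, 4, -3, 2, -3, -2,
      1, 2, 2, 1, 4, 3, -2, 3, 4, -1, -2, 1] := by
    have := congrArg (D.act [3] [] (by decide) (by decide)) h₅
    simpa only [act_m, List.cons_append, List.nil_append, List.append_nil] using this
  rw [h₁, h₂, z₁, z₂, h₃, h₁₀, h₁₁, h₉, add_zero, sub_zero, smul_zero, smul_zero, sub_zero,
    zero_add, smul_smul, D.UV, one_smul]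

/-- From 3z = z1'21, multiplication by 2 gives 3z2 = z1'212 = z21, and 2 acts trivially on z from
the right. -/
theorem z_one_eq_three_z : D.m [4, 3, -2, 3, 1, -2, 1, 4, 3, -2, 3, 4, 1] = D.m [3, 4, 3, -2, 3, 1,
    -2, 1, 4, 3, -2, 3, 4] := by
  have h₁ := congrArg (D.act [] [-1, 2, 1, 2] (by decide) (by decide)) (three_z_right (D := D))
  have h₂ := congrArg (D.act [] [1] (by decide) (by decide)) (z_two (D := D))
  have h₃ := congrArg (D.act [3] [] (by decide) (by decide)) (z_two (D := D))
  simp only [act_m, List.cons_append, List.nil_append, List.append_nil] at h₁ h₂ h₃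
  have e₁ : D.m [3, 4, 3, -2, 3, 1, -2, 1, 4, 3, -2, 3, 4, -1, -2, 1, -1, 2, 1, 2] = D.m [3, 4, 3,
      -2, 3, 1, -2, 1, 4, 3, -2, 3, 4, 2] := c_eq [15, 14, 13] [] (by decide)
  have e₂ : D.m [4, 3, -2, 3, 1, -2, 1, 4, 3, -2, 3, 4, -1, 2, 1, 2] = D.m [4, 3, -2, 3, 1, -2, 1,
      4, 3, -2, 3, 4, 2, 1] :=
    c_eq [12, 14] [] (by decide)
  rw [← h₂, ← e₂, ← h₁, e₁, h₃]

/-- By z1 = 3z and z2 = z, z121 equals 33z and z212 equals 3z. The braid relation therefore gives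
33z = 3z, and 3 is invertible. -/
theorem three_z : D.m [3, 4, 3, -2, 3, 1, -2, 1, 4, 3, -2, 3, 4] = D.m [4, 3, -2, 3, 1, -2, 1, 4, 3,
    -2, 3, 4] := by
  have a := z_one_eq_three_z (D := D)
  have h₁ := congrArg (D.act [] [2, 1] (by decide) (by decide)) a
  have h₂ := congrArg (D.act [3] [1] (by decide) (by decide)) (z_two (D := D))
  have h₃ := congrArg (D.act [3] [] (by decide) (by decide)) a
  have h₄ := congrArg (D.act [] [1, 2] (by decide) (by decide)) (z_two (D := D))
  have h₅ := congrArg (D.act [] [2] (by decide) (by decide)) a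
  have h₆ := congrArg (D.act [3] [] (by decide) (by decide)) (z_two (D := D))
  simp only [act_m, List.cons_append, List.nil_append, List.append_nil] at h₁ h₂ h₃ h₄ h₅ h₆
  have e : D.m [4, 3, -2, 3, 1, -2, 1, 4, 3, -2, 3, 4, 1, 2, 1] = D.m [4, 3, -2, 3, 1, -2, 1, 4, 3,
      -2, 3, 4, 2, 1, 2] := c_eq [12] [] (by decide)
  have h : D.m [3, 3, 4, 3, -2, 3, 1, -2, 1, 4, 3, -2, 3, 4] = D.m [3, 4, 3, -2, 3, 1, -2, 1, 4, 3,
      -2, 3, 4] := by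
    rw [← h₃, ← h₂, ← h₁, e, h₄, h₅, h₆]
  have h₇ := congrArg (D.act [-3] [] (by decide) (by decide)) h
  simp only [act_m, List.cons_append, List.nil_append, List.append_nil] at h₇
  have e₁ : D.m [-3, 3, 3, 4, 3, -2, 3, 1, -2, 1, 4, 3, -2, 3, 4] = D.m [3, 4, 3, -2, 3, 1, -2, 1,
      4, 3, -2, 3, 4] := c_eq [0] [] (by decide)
  have e₂ : D.m [-3, 3, 4, 3, -2, 3, 1, -2, 1, 4, 3, -2, 3, 4] = D.m [4, 3, -2, 3, 1, -2, 1, 4, 3,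
      -2, 3, 4] := c_eq [0] [] (by decide)
  rw [← e₁, h₇, e₂]

theorem z_mul_letter {a : ℤ} (ha : a = 1 ∨ a = 2 ∨ a = 3) :
    D.m [4, 3, -2, 3, 1, -2, 1, 4, 3, -2, 3, 4, a] = D.m [4, 3, -2, 3, 1, -2, 1, 4, 3, -2, 3, 4] :=
        by
  rcases ha with rfl | rfl | rfl
  · exact z_one_eq_three_z.trans three_z
  · exact z_two
  · have h := congrArg D.rev (three_z (D := D.op))
    rw [rev_m, rev_m] at h
    have e₁ : D.m [4, 3, -2, 3, 1, -2, 1, 4, 3, -2, 3, 4, 3] = D.m [4, 3, -2, 3, 4, 1, -2, 1, 3, -2,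
        3, 4, 3] := c_eq [6, 5] [4] (by decide)
    have e₂ : D.m [4, 3, -2, 3, 1, -2, 1, 4, 3, -2, 3, 4] = D.m [4, 3, -2, 3, 4, 1, -2, 1, 3, -2, 3,
        4] := c_eq [6, 5] [4] (by decide)
    exact e₁.trans (h.trans e₂.symm)

end CubicSys

namespace CubicSys

variable {k A : Type} [CommRing k] [Ring A] [Algebra k A] {D : CubicSys k A}

/-! ### The line spanned by `4xy4x4` -/

variable (D) in
/-- The span of the class of `4xy4x4`. -/
def K : Submodule k (A ⧸ D.N 2) := Submodule.span k {D.m [4, 3, -2, 3, 1, -2, 1, 4, 3, -2, 3, 4]}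

theorem z_mem_K : D.m [4, 3, -2, 3, 1, -2, 1, 4, 3, -2, 3, 4] ∈ D.K := Submodule.subset_span rfl

theorem z_append {q : List ℤ} (hq : Mid q) : D.m ([4, 3, -2, 3, 1, -2, 1, 4, 3, -2, 3, 4] ++ q) =
    D.m [4, 3, -2, 3, 1, -2, 1, 4, 3, -2, 3, 4] := by
  have pos : ∀ {a : ℤ}, (a = 1 ∨ a = 2 ∨ a = 3) → D.m [4, 3, -2, 3, 1, -2, 1, 4, 3, -2, 3, 4, -a] =
      D.m [4, 3, -2, 3, 1, -2, 1, 4, 3, -2, 3, 4] := by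
    intro a ha
    have h := congrArg (D.act [] [-a] (by decide) (by
      rcases ha with rfl | rfl | rfl <;> decide)) (z_mul_letter (D := D) ha)
    have e := D.c_cancel (D.N 2) a [4, 3, -2, 3, 1, -2, 1, 4, 3, -2, 3, 4] []
    simp only [act_m, List.cons_append, List.nil_append, List.append_nil] at h e
    exact h.symm.trans e
  have letter : ∀ {a : ℤ}, a.natAbs ≤ 3 → D.m [4, 3, -2, 3, 1, -2, 1, 4, 3, -2, 3, 4, a] = D.m [4,
      3, -2, 3, 1, -2, 1, 4, 3, -2, 3, 4] := by
    intro a ha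
    obtain rfl | h | ⟨b, hb, rfl⟩ : a = 0 ∨ (a = 1 ∨ a = 2 ∨ a = 3) ∨
        ∃ b, (b = 1 ∨ b = 2 ∨ b = 3) ∧ a = -b := by
      by_cases h : a = 0
      · exact Or.inl h
      · by_cases h' : 0 < a
        · exact Or.inr (Or.inl (by omega))
        · exact Or.inr (Or.inr ⟨-a, by omega, by omega⟩)
    · exact D.c_zero (D.N 2) [4, 3, -2, 3, 1, -2, 1, 4, 3, -2, 3, 4] []
    · exact z_mul_letter h
    · exact pos hb
  induction q with
  | nil => rfl
  | cons a q ih =>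
    have hq' : Mid q := fun b hb => hq b (List.mem_cons_of_mem _ hb)
    have h := congrArg (D.act [] q (by decide) hq') (letter (hq a (by simp)))
    simp only [act_m, List.cons_append, List.nil_append] at h
    exact h.trans (ih hq')

/-- The words x and y are palindromes, and y commutes with 4. -/
theorem z_reverse : D.m [4, 3, -2, 3, 1, -2, 1, 4, 3, -2, 3, 4].reverse = D.m [4, 3, -2, 3, 1, -2,
    1, 4, 3, -2, 3, 4] :=
  c_eq [4, 5] [6] (by decide)

theorem z_prepend {p : List ℤ} (hp : Mid p) : D.m (p ++ [4, 3, -2, 3, 1, -2, 1, 4, 3, -2, 3, 4]) =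
    D.m [4, 3, -2, 3, 1, -2, 1, 4, 3, -2, 3, 4] := by
  have h := congrArg D.rev (z_append (D := D.op) hp.reverse)
  rw [rev_m, rev_m, List.reverse_append, List.reverse_reverse] at h
  have e := congrArg (D.act p [] hp (by decide)) (z_reverse (D := D))
  simp only [act_m, List.append_nil] at e
  exact e.symm.trans (h.trans z_reverse)

/-- Multiplication by words in the first three generators is trivial on the line. -/
theorem act_of_mem {t : A ⧸ D.N 2} (ht : t ∈ D.K) {p q : List ℤ} (hp : Mid p) (hq : Mid q) :
    D.act p q hp hq t = t := by
  obtain ⟨r, rfl⟩ := Submodule.mem_span_singleton.1 ht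
  have h := congrArg (D.act p [] hp (by decide)) (z_append (D := D) hq)
  simp only [act_m, List.append_nil] at h
  rw [map_smul, act_m, h, z_prepend hp]

theorem ctx_of_mem {l : List ℤ} (h : D.m l ∈ D.K) {p q : List ℤ} (hp : Mid p) (hq : Mid q) :
    D.m (p ++ (l ++ q)) = D.m l := by
  rw [← D.act_m p q hp hq, act_of_mem h]

/-! ### The products `43'4 n 43'4` -/

/-- Here two letters 4 precede the second peak, so the error terms are controlled by the vanishing
of 43'4 l 4^± rather than by counting letters. -/
theorem peak_mul_three {l : List ℤ} (hl : Mid l) : D.m (4 :: (-3 :: (4 :: (l ++ [3, 4, -3, 4])))) =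
    D.m (4 :: (-3 :: (4 :: (l ++ [4, -3, 4])))) := by
  have := c_ker_eq (D := D) (φ := D.ctx (D.N 2) (4 :: (-3 :: (4 :: l))) []) (l := [3, 4, -3, 4])
    (l' := [4, -3, 4]) |>.1 (c_mul_peak_eq 3 4 (by decide) fun p q b hp hq hb => ?_)
  · simpa only [D.ctx_w, List.cons_append, List.append_assoc, List.nil_append, List.append_nil]
      using this
  · rw [c_eq_zero, LinearMap.mem_ker, ctx_w]
    have hp' : Mid p := fun a ha => (hp a ha).le
    have hq' : Mid q := fun a ha => (hq a ha).le
    rcases hb with rfl | hb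
    · exact m_zero (by
        simp [count4_cons, count4_append, hl.count4, hp'.count4, hq'.count4])
    · have := m_append_zero q hq' (peak_zero_rev (D := D) hb (hl.append hp'))
      simpa using this

theorem three_mul_peak {l : List ℤ} (hl : Mid l) : D.m (4 :: (-3 :: (4 :: (3 :: (l ++ [4, -3,
    4]))))) = D.m (4 :: (-3 :: (4 :: (l ++ [4, -3, 4])))) := by
  have h := congrArg D.rev (peak_mul_three (D := D.op) hl.reverse)
  rw [rev_m, rev_m] at h
  simpa using h

/-- Moving q to the right brings two letters 4 together; each term of the cubic relation then
vanishes. -/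
theorem peak_low_peak {q : List ℤ} (hq : Low q) : D.m (4 :: (-3 :: (4 :: (q ++ [4, -3, 4])))) = 0 :=
    by
  have e := c_low_comm (D := D) (W := D.N 2) 4 rfl hq [4, -3, 4] [-3, 4]
  have h : D.m (4 :: (-3 :: (4 :: (4 :: (q ++ [-3, 4]))))) = D.S • D.m (4 :: (-3 :: (4 :: (q ++ [-3,
      4])))) - D.T • D.m (4 :: (-3 :: (4 :: (-4 :: (q ++ [-3, 4])))))
      + D.U • D.m (4 :: (-3 :: (4 :: (-4 :: (-4 :: (q ++ [-3, 4])))))) := D.c_cubic (D.N 2) 4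
          (by norm_num) [4, -3, 4] (q ++ [-3, 4])
  have h₁ : D.m (4 :: (-3 :: (4 :: (q ++ [-3, 4])))) = 0 := by
    have := peak_zero_rev (D := D) (a := 4) (by simp) (hq.mid.append (l' := [-3]) (by decide))
    simpa using this
  have h₂ : D.m (4 :: (-3 :: (4 :: (-4 :: (q ++ [-3, 4]))))) = 0 := (D.c_cancel (D.N 2) 4 [4,
      -3] (q ++ [-3, 4])).trans
    (m_zero (by simp [count4_cons, count4_append, hq.count4]))
  have h₃ : D.m (4 :: (-3 :: (4 :: (-4 :: (-4 :: (q ++ [-3, 4])))))) = 0 :=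
    (D.c_cancel (D.N 2) 4 [4, -3] (-4 :: (q ++ [-3, 4]))).trans ((c_eq (l' :=
        (-3 :: (-4 :: (3 :: (q ++ [-3, 4]))))) [0] [] rfl).trans
      (m_zero (by simp [count4_cons, count4_append, hq.count4])))
  simp only [List.cons_append, List.nil_append] at e
  exact e.symm.trans (h.trans (by rw [h₁, h₂, h₃]; simp))

/-- This is the one term of `peak_three_peak` not settled by short gaps. Trading x for U 3'23' and
expanding the first 4' leaves a shorter word, a word containing 4'34', and one with a short last
gap. -/
theorem mixed_peak {q : List ℤ} (hq : Low q) : D.m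
    (-4 :: (3 :: (-2 :: (3 :: (-4 :: (-3 :: (q ++ [-3, 4]))))))) = 0 := by
  have hm : Mid (-3 :: (q ++ [-3])) := (hq.mid.append (l' := [-3]) (by decide)).cons (by decide)
  have h₀ : D.U • D.m (-4 :: (-3 :: (2 :: (-3 :: (-4 :: (-3 :: (q ++ [-3, 4]))))))) = D.m
      (-4 :: (3 :: (-2 :: (3 :: (-4 :: (-3 :: (q ++ [-3, 4]))))))) := by
    have := map_x_inv (left_short (D := D) (a := -4) (b := -4) (c := 4) (p := []) (r := [])
      (l := (-3 :: (q ++ [-3]))) (by simp) (by simp) (by simp) (by decide) (by decide) hm) (q := [])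
      (by decide)
    simpa only [D.ctx_w, List.cons_append, List.append_assoc, List.nil_append, List.append_nil]
      using this
  have h : D.m (-4 :: (-3 :: (2 :: (-3 :: (-4 :: (-3 :: (q ++ [-3, 4]))))))) = (D.T * D.V) • D.m
      (-3 :: (2 :: (-3 :: (-4 :: (-3 :: (q ++ [-3, 4]))))))
      - (D.S * D.V) • D.m (-3 :: (-2 :: (-4 :: (3 :: (-4 :: (2 :: (3 :: (-3 :: (q ++ [-3,
          4]))))))))) + D.V • D.m
          (-3 :: (-4 :: (3 :: (-2 :: (3 :: (-4 :: (2 :: (3 :: (-3 :: (q ++ [-3, 4])))))))))) := by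
    have h := D.c_cubic' (D.N 2) 4 (by norm_num) [] (-3 :: (2 :: (-3 :: (-4 :: (-3 :: (q ++ [-3,
        4]))))))
    have h₁ := c_eq_ctx (D := D) (W := D.N 2) (l := [4, -3, 2, -3, -4]) (l' := [-3, -2, -4, 3, -4,
        2, 3]) []
      (-3 :: (q ++ [-3, 4])) [] [1, 4, 2, 0, 2, 3, 5] (by decide)
    have h₂ := c_eq_ctx (D := D) (W := D.N 2) (l := [4, 4, -3, 2, -3, -4]) (l' := [-3, -4, 3, -2, 3,
        -4, 2, 3]) []
      (-3 :: (q ++ [-3, 4])) [] [0, 5, 3, 1, 3, 4, 6] (by decide)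
    simp only [List.cons_append, List.nil_append] at h h₁ h₂
    exact h.trans (by rw [h₁, h₂])
  have z₁ : D.m (-3 :: (2 :: (-3 :: (-4 :: (-3 :: (q ++ [-3, 4])))))) = 0 := m_zero
      (by simp [count4_cons, count4_append, hq.count4])
  have z₂ : D.m (-3 :: (-2 :: (-4 :: (3 :: (-4 :: (2 :: (3 :: (-3 :: (q ++ [-3, 4]))))))))) = 0 :=
      by
    have := peak_inv_zero_rev (D := D) (a := 4) (by simp)
      (l := (2 :: (3 :: (-3 :: (q ++ [-3]))))) ((hm.cons (by decide)).cons (by decide))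
    have := m_prepend_zero [-3, -2] (by decide) this
    simpa using this
  have z₃ : D.m (-3 :: (-4 :: (3 :: (-2 :: (3 :: (-4 :: (2 :: (3 :: (-3 :: (q ++ [-3, 4])))))))))) =
      0 := by
    refine (D.c_cancel (D.N 2) 3 [-3, -4, 3, -2, 3, -4, 2] (q ++ [-3, 4])).trans ?_
    exact m_prepend_zero [-3] (by decide) (short_right (l := [3, -2, 3]) (p := 2 :: q) (d :=
        -3) (q := [])
      (by simp) (by simp) (by simp) (by simp) (by decide) (hq.cons (by decide)) (by decide))
  rw [← h₀, h, z₁, z₂, z₃]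
  simp

/-- When e and d are nontrivial, e and q are moved through 4 to give 43'e·4d4·q3'4. For d = 3, 434 =
343 and 3'e3 is a conjugate of 3^± by 2, so a short gap appears. For d = 3' the middle peak is
expanded first. -/
theorem peak_three_peak {e d : ℤ} (he : e = 0 ∨ e = 2 ∨ e = -2) (hd : d = 0 ∨ d = 3 ∨ d = -3)
    {q : List ℤ} (hq : Low q) : D.m (4 :: (-3 :: (4 :: (e :: (d :: (q ++ [4, -3, 4])))))) = 0 := by
  have h₃ : Mid (q ++ [-3]) := hq.mid.append (by decide)
  rcases hd with rfl | rfl | rfl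
  · have hl : Low [e] := by rcases he with rfl | rfl | rfl <;> decide
    exact (D.c_zero (D.N 2) [4, -3, 4, e] (q ++ [4, -3, 4])).trans (peak_low_peak (hl.append hq))
  · have e₂ : D.m (4 :: (-3 :: (e :: (4 :: (3 :: (4 :: (q ++ [-3, 4]))))))) = D.m
      (4 :: (-3 :: (e :: (4 :: (3 :: (q ++ [4, -3, 4])))))) :=
      c_low_comm 4 rfl hq [4, -3, e, 4, 3] [-3, 4]
    rcases he with rfl | rfl | rfl
    · exact (D.c_zero (D.N 2) [4, -3, 4] (3 :: (q ++ [4, -3, 4]))).trans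
        ((three_mul_peak hq.mid).trans (peak_low_peak hq))
    · have e₁ : D.m (4 :: (-3 :: (4 :: (2 :: (3 :: (q ++ [4, -3, 4])))))) = D.m
        (4 :: (-3 :: (2 :: (4 :: (3 :: (q ++ [4, -3, 4])))))) := c_eq [2] [] rfl
      have e₃ : D.m (4 :: (-3 :: (2 :: (4 :: (3 :: (4 :: (q ++ [-3, 4]))))))) = D.m
          (4 :: (2 :: (3 :: (-2 :: (4 :: (3 :: (q ++ [-3, 4]))))))) := c_eq [3, 1] [] rfl
      have e₄ := short_left (D := D) (a := 4) (b := 4) (c := 4) (p := [2]) (d := 3) (q := [-2])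
        (by simp) (by simp) (by simp) (by simp) (h₃.cons (a := 3) (by decide)) (by decide)
            (by decide)
      rw [e₁, ← e₂, e₃]
      simpa using e₄
    · have e₁ : D.m (4 :: (-3 :: (4 :: (-2 :: (3 :: (q ++ [4, -3, 4])))))) = D.m
        (4 :: (-3 :: (-2 :: (4 :: (3 :: (q ++ [4, -3, 4])))))) := c_eq [2] [] rfl
      have e₃ : D.m (4 :: (-3 :: (-2 :: (4 :: (3 :: (4 :: (q ++ [-3, 4]))))))) = D.m
          (4 :: (2 :: (-3 :: (-2 :: (4 :: (3 :: (q ++ [-3, 4]))))))) := c_eq [3, 1] [] rfl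
      have e₄ := short_left (D := D) (a := 4) (b := 4) (c := 4) (p := [2]) (d := -3) (q := [-2])
        (by simp) (by simp) (by simp) (by simp) (h₃.cons (a := 3) (by decide)) (by decide)
            (by decide)
      rw [e₁, ← e₂, e₃]
      simpa using e₄
  · have e₂ : D.m (4 :: (-3 :: (e :: (4 :: (-3 :: (4 :: (q ++ [-3, 4]))))))) = D.m
      (4 :: (-3 :: (e :: (4 :: (-3 :: (q ++ [4, -3, 4])))))) :=
      c_low_comm 4 rfl hq [4, -3, e, 4, -3] [-3, 4]
    have h : D.m (4 :: (-3 :: (e :: (4 :: (-3 :: (4 :: (q ++ [-3, 4]))))))) = D.U • D.m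
        (4 :: (-3 :: (e :: (-4 :: (3 :: (-4 :: (-3 :: (q ++ [-3, 4]))))))))
        + D.S • D.m (4 :: (-3 :: (e :: (-3 :: (4 :: (q ++ [-3, 4])))))) - D.T • D.m
            (4 :: (-3 :: (e :: (3 :: (-4 :: (-3 :: (q ++ [-3, 4]))))))) :=
      D.c_cube_right (D.N 2) 3 4 (by decide) [4, -3, e] (q ++ [-3, 4])
    have z₁ : D.m (4 :: (-3 :: (e :: (-3 :: (4 :: (q ++ [-3, 4])))))) = 0 := short_right (l := [-3,
        e, -3]) (d := -3) (q := [])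
      (by simp) (by simp) (by simp) (by simp) (by rcases he with rfl | rfl | rfl <;> decide) hq
      (by decide)
    rcases he with rfl | rfl | rfl
    · have e₄ := D.c_cancel (D.N 2) 3 [4, -3, 4] (q ++ [4, -3, 4])
      have e₅ := three_mul_peak (D := D) (hq.mid.cons (a := -3) (by decide))
      have e₆ := D.c_zero (D.N 2) [4, -3, 4] (-3 :: (q ++ [4, -3, 4]))
      exact e₆.trans (e₅.symm.trans (e₄.trans (peak_low_peak hq)))
    · have e₁ : D.m (4 :: (-3 :: (4 :: (2 :: (-3 :: (q ++ [4, -3, 4])))))) = D.m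
        (4 :: (-3 :: (2 :: (4 :: (-3 :: (q ++ [4, -3, 4])))))) := c_eq [2] [] rfl
      have z₂ : D.m (4 :: (-3 :: (2 :: (3 :: (-4 :: (-3 :: (q ++ [-3, 4]))))))) = 0 := by
        have e₃ : D.m (4 :: (-3 :: (2 :: (3 :: (-4 :: (-3 :: (q ++ [-3, 4]))))))) = D.m
            (4 :: (2 :: (3 :: (-2 :: (-4 :: (-3 :: (q ++ [-3, 4]))))))) := c_eq [1] [] rfl
        have e₄ := short_left (D := D) (a := 4) (b := -4) (c := 4) (p := [2]) (d := 3) (q := [-2])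
          (by simp) (by simp) (by simp) (by simp) (h₃.cons (a := -3) (by decide)) (by decide)
          (by decide)
        rw [e₃]
        simpa using e₄
      have z₃ : D.m (4 :: (-3 :: (2 :: (-4 :: (3 :: (-4 :: (-3 :: (q ++ [-3, 4])))))))) = 0 := by
        have e₃ : D.m (4 :: (-3 :: (2 :: (-4 :: (3 :: (-4 :: (-3 :: (q ++ [-3, 4])))))))) = D.m
            (-3 :: (-4 :: (2 :: (3 :: (2 :: (-4 :: (-3 :: (q ++ [-3, 4])))))))) := c_eq [2, 0, 2] []
            rfl
        have e₄ := short_left (D := D) (a := -4) (b := -4) (c := 4) (p := [2]) (d := 3) (q := [2])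
          (by simp) (by simp) (by simp) (by simp) (h₃.cons (a := -3) (by decide)) (by decide)
          (by decide)
        rw [e₃]
        exact m_prepend_zero [-3] (by decide) (by simpa using e₄)
      rw [e₁, ← e₂, h, z₁, z₂, z₃]
      simp
    · have e₁ : D.m (4 :: (-3 :: (4 :: (-2 :: (-3 :: (q ++ [4, -3, 4])))))) = D.m
        (4 :: (-3 :: (-2 :: (4 :: (-3 :: (q ++ [4, -3, 4])))))) := c_eq [2] [] rfl
      have z₂ : D.m (4 :: (-3 :: (-2 :: (3 :: (-4 :: (-3 :: (q ++ [-3, 4]))))))) = 0 := by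
        have e₃ : D.m (4 :: (-3 :: (-2 :: (3 :: (-4 :: (-3 :: (q ++ [-3, 4]))))))) = D.m
            (4 :: (2 :: (-3 :: (-2 :: (-4 :: (-3 :: (q ++ [-3, 4]))))))) := c_eq [1] [] rfl
        have e₄ := short_left (D := D) (a := 4) (b := -4) (c := 4) (p := [2]) (d := -3) (q := [-2])
          (by simp) (by simp) (by simp) (by simp) (h₃.cons (a := -3) (by decide)) (by decide)
          (by decide)
        rw [e₃]
        simpa using e₄
      have z₃ : D.m (4 :: (-3 :: (-2 :: (-4 :: (3 :: (-4 :: (-3 :: (q ++ [-3, 4])))))))) = 0 := by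
        have e₃ : D.m (4 :: (-3 :: (-2 :: (-4 :: (3 :: (-4 :: (-3 :: (q ++ [-3, 4])))))))) = D.m
            (-3 :: (-4 :: (3 :: (-2 :: (3 :: (-4 :: (-3 :: (q ++ [-3, 4])))))))) := c_eq [2, 0] []
            rfl
        rw [e₃]
        exact m_prepend_zero [-3] (by decide) (mixed_peak hq)
      rw [e₁, ← e₂, h, z₁, z₂, z₃]
      simp

/-- A product `43'4 n 43'4` vanishes if `n = p 3^± q` with one of `p`, `q` of the form `1^j 2^±`. -/
theorem peak_mul_peak_zero {e d : ℤ} {p q : List ℤ} (hp : One p) (he : e = 0 ∨ e = 2 ∨ e = -2)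
    (hd : d = 0 ∨ d = 3 ∨ d = -3) (hq : Low q) : D.m (4 :: (-3 :: (4 :: (p ++ (e :: (d :: (q ++ [4,
        -3, 4]))))))) = 0 := by
  have h := m_prepend_zero p hp.low.mid (peak_three_peak (D := D) he hd hq)
  have e₁ := c_comm (D := D) (W := D.N 2) 4 (hp.far (by norm_num)) [4, -3] (e :: (d :: (q ++ [4, -3,
      4])))
  have e₂ := c_comm (D := D) (W := D.N 2) (-3) (hp.far (by norm_num)) [4]
      (4 :: (e :: (d :: (q ++ [4, -3, 4]))))
  have e₃ := c_comm (D := D) (W := D.N 2) 4 (hp.far (by norm_num)) []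
      (-3 :: (4 :: (e :: (d :: (q ++ [4, -3, 4])))))
  simp only [List.cons_append, List.nil_append] at e₁ e₂ e₃ h
  exact e₁.trans (e₂.trans (e₃.trans h))

theorem peak_mul_peak_zero_rev {e d : ℤ} {p q : List ℤ} (hp : One p) (he : e = 0 ∨ e = 2 ∨ e = -2)
    (hd : d = 0 ∨ d = 3 ∨ d = -3) (hq : Low q) : D.m (4 :: (-3 :: (4 :: (q ++ (d :: (e :: (p ++ [4,
        -3, 4]))))))) = 0 := by
  have := op_m_eq_zero D (peak_mul_peak_zero (D := D.op) (p := p.reverse) (fun a ha =>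
    hp a (List.mem_reverse.1 ha)) he hd hq.reverse)
  simpa using this

end CubicSys

namespace CubicSys

variable {k A : Type} [CommRing k] [Ring A] [Algebra k A] {D : CubicSys k A}

/-! ### Values of the products `43'4 n 43'4` -/

/-- The inverse analogue of 1221: the cubic relation for 2' leaves V·1'21', and this equals V·12'1
once 2 is absorbed by the second x. -/
theorem x_one_inv_sq : D.m [4, 3, -2, 3, -1, -2, -2, -1, 4, 3, -2, 3, 4] = (D.V * D.V) • D.m [4, 3,
    -2, 3, 1, -2, 1, 4, 3, -2, 3, 4] := by
  have h : D.m [4, 3, -2, 3, -1, -2, -2, -1, 4, 3, -2, 3, 4] = (D.T * D.V) • D.m [4, 3, -2, 3, -1,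
      -2, -1, 4, 3, -2, 3, 4]
      - (D.S * D.V) • D.m [4, 3, -2, 3, -1, 2, -2, -1, 4, 3, -2, 3, 4] + D.V • D.m [4, 3, -2, 3, -1,
          2, 2, -2, -1, 4, 3, -2, 3, 4] :=
    D.c_cubic' (D.N 2) 2 (by norm_num) [4, 3, -2, 3, -1] [-2, -1, 4, 3, -2, 3, 4]
  have z₁ : D.m [4, 3, -2, 3, -1, -2, -1, 4, 3, -2, 3, 4] = 0 := by
    have e : D.m [4, 3, -2, 3, -1, -2, -1, 4, 3, -2, 3, 4] = D.m [4, 3, -2, 3, -2, -1, -2, 4, 3, -2,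
        3, 4] := c_eq [4] [] (by decide)
    exact e.trans ((x_inv_left (q := [-1, -2]) (by decide)).trans
      ((x_inv_right (q := [-1]) (by decide)).trans (x_one (by simp))))
  have z₂ : D.m [4, 3, -2, 3, -1, 2, -2, -1, 4, 3, -2, 3, 4] = 0 := by
    have e : D.m [4, 3, -2, 3, -1, 2, -2, -1, 4, 3, -2, 3, 4] = D.m [4, 3, -2, 3, -1, -1, 4, 3, -2,
        3, 4] := c_eq [5] [] (by decide)
    have h : D.m [4, 3, -2, 3, -1, -1, 4, 3, -2, 3, 4] = (D.T * D.V) • D.m [4, 3, -2, 3, -1, 4, 3,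
        -2, 3, 4]
        - (D.S * D.V) • D.m [4, 3, -2, 3, -1, 1, 4, 3, -2, 3, 4] + D.V • D.m [4, 3, -2, 3, -1, 1, 1,
            4, 3, -2, 3, 4] :=
      D.c_cubic' (D.N 2) 1 (by norm_num) [4, 3, -2, 3, -1] [4, 3, -2, 3, 4]
    have z₁ : D.m [4, 3, -2, 3, -1, 4, 3, -2, 3, 4] = 0 := x_one (by simp)
    have z₂ : D.m [4, 3, -2, 3, -1, 1, 4, 3, -2, 3, 4] = 0 := by
      have e : D.m [4, 3, -2, 3, -1, 1, 4, 3, -2, 3, 4] = D.m [4, 3, -2, 3, 4, 3, -2, 3, 4] := c_eq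
          [4] [] (by decide)
      have e' : D.m [4, 3, -2, 3, 0, 4, 3, -2, 3, 4] = D.m [4, 3, -2, 3, 4, 3, -2, 3, 4] := D.c_zero
          (D.N 2) [4, 3, -2, 3] [4, 3, -2, 3, 4]
      exact e.trans (e'.symm.trans (x_one (by simp)))
    have z₃ : D.m [4, 3, -2, 3, -1, 1, 1, 4, 3, -2, 3, 4] = 0 := by
      have e : D.m [4, 3, -2, 3, -1, 1, 1, 4, 3, -2, 3, 4] = D.m [4, 3, -2, 3, 1, 4, 3, -2, 3, 4] :=
          c_eq [4] [] (by decide)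
      exact e.trans (x_one (by simp))
    rw [e, h, z₁, z₂, z₃]
    simp
  have h₃ : D.m [4, 3, -2, 3, -1, 2, 2, -2, -1, 4, 3, -2, 3, 4] = D.V • D.m [4, 3, -2, 3, 1, -2, 1,
      4, 3, -2, 3, 4] := by
    have e : D.m [4, 3, -2, 3, -1, 2, 2, -2, -1, 4, 3, -2, 3, 4] = D.m [4, 3, -2, 3, -1, 2, -1, 4,
        3, -2, 3, 4] :=
      c_eq [6] [] (by decide)
    have h : D.m [4, 3, -2, 3, -1, 2, -1, 4, 3, -2, 3, 4] = D.V • D.m [4, 3, -2, 3, 1, -2, 1, 2, 4,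
        3, -2, 3, 4]
        - (D.V * D.S) • D.m [4, 3, -2, 3, -2, 1, 2, 4, 3, -2, 3, 4] + (D.V * D.T) • D.m [4, 3, -2,
            3, 2, -1, 4, 3, -2, 3, 4] :=
      D.c_cube_inv (D.N 2) 2 1 (by decide) [4, 3, -2, 3] [4, 3, -2, 3, 4]
    have z₁ : D.m [4, 3, -2, 3, -2, 1, 2, 4, 3, -2, 3, 4] = 0 := (x_inv_left (q := [1,
        2]) (by decide)).trans
      ((x_two_right (q := [1]) (by decide)).trans (x_one (by simp)))
    have z₂ : D.m [4, 3, -2, 3, 2, -1, 4, 3, -2, 3, 4] = 0 := (x_two_left (q :=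
        [-1]) (by decide)).trans (x_one (by simp))
    have h₁ : D.m [4, 3, -2, 3, 1, -2, 1, 2, 4, 3, -2, 3, 4] = D.m [4, 3, -2, 3, 1, -2, 1, 4, 3, -2,
        3, 4] := x_two_right (q := [1, -2, 1]) (by decide)
    rw [e, h, z₁, z₂, h₁]
    simp
  rw [h, z₁, z₂, h₃]
  simp [smul_smul]

/-- As a braid this is 21·(4x·1'2'2'1'·4x4)·12. The inner factor is on the line spanned by z, where
the outer words act trivially. -/
theorem peak_v_three_v : D.m [4, -3, 4, 2, -1, 2, 3, 2, -1, 2, 4, -3, 4] = (D.V * D.V) • D.m [4, 3,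
    -2, 3, 1, -2, 1, 4, 3, -2, 3, 4] := by
  have e : D.m [4, -3, 4, 2, -1, 2, 3, 2, -1, 2, 4, -3, 4] = D.m [2, 1, 4, 3, -2, 3, -1, -2, -2, -1,
      4, 3, -2, 3, 4, 1, 2] :=
    c_eq [2, 3, 4, 9, 8, 7, 5] [1, 0, 2, 5, 3, 1, 3, 4, 6, 7, 6, 8, 12, 11, 9, 7, 9, 10, 12, 13]
        (by decide)
  have h : D.m [4, 3, -2, 3, -1, -2, -2, -1, 4, 3, -2, 3, 4] ∈ D.K := by
    rw [x_one_inv_sq]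
    exact D.K.smul_mem _ z_mem_K
  rw [e, ← x_one_inv_sq]
  exact ctx_of_mem h (p := [2, 1]) (q := [1, 2]) (by decide) (by decide)

/-- Expanding the last 2'12' gives V 21'21, whose final 1 passes through the peak; the two other
terms vanish. -/
theorem peak_v_three_v' {d : ℤ} (hd : d = 3 ∨ d = -3) :
    D.m [4, -3, 4, 2, -1, 2, d, -2, 1, -2, 4, -3, 4] = D.V • D.m [4, -3, 4, 2, -1, 2, d, 2, -1, 2,
        4, -3, 4, 1] := by
  have h : D.m [4, -3, 4, 2, -1, 2, d, -2, 1, -2, 4, -3, 4] = D.V • D.m [4, -3, 4, 2, -1, 2, d, 2,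
      -1, 2, 1, 4, -3, 4]
      - (D.V * D.S) • D.m [4, -3, 4, 2, -1, 2, d, -1, 2, 1, 4, -3, 4] + (D.V * D.T) • D.m [4, -3, 4,
          2, -1, 2, d, 1, -2, 4, -3, 4] :=
    D.c_cube_inv (D.N 2) 1 2 (by decide) [4, -3, 4, 2, -1, 2, d] [4, -3, 4]
  have e : D.m [4, -3, 4, 2, -1, 2, d, 2, -1, 2, 1, 4, -3, 4] = D.m [4, -3, 4, 2, -1, 2, d, 2, -1,
      2, 4, -3, 4, 1] := by
    rcases hd with rfl | rfl
    · exact c_eq [10, 11] [12] (by decide)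
    · exact c_eq [10, 11] [12] (by decide)
  have z₁ : D.m [4, -3, 4, 2, -1, 2, d, -1, 2, 1, 4, -3, 4] = 0 := by
    rcases hd with rfl | rfl
    · exact ((c_eq (l' := [4, -3, 4, 2, -1, 2, -1, 3, 2, 1, 4, -3, 4]) [6] [] (by decide)).trans 
      (peak_mul_peak_zero_rev (p := [1]) (e := 2) (d := 3) (q := [2, -1, 2, -1])
      (by decide) (by decide) (by decide) (by decide)))
    · exact ((c_eq (l' := [4, -3, 4, 2, -1, 2, -1, -3, 2, 1, 4, -3, 4]) [6] [] (by decide)).trans 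
      (peak_mul_peak_zero_rev (p := [1]) (e := 2) (d := -3) (q := [2, -1, 2, -1])
      (by decide) (by decide) (by decide) (by decide)))
  have z₂ : D.m [4, -3, 4, 2, -1, 2, d, 1, -2, 4, -3, 4] = 0 := by
    rcases hd with rfl | rfl
    · exact ((c_eq (l' := [4, -3, 4, 2, -1, 2, 1, 3, -2, 4, -3, 4]) [6] [] (by decide)).trans 
      (peak_mul_peak_zero_rev (p := []) (e := -2) (d := 3) (q := [2, -1, 2, 1])
      (by decide) (by decide) (by decide) (by decide)))
    · exact ((c_eq (l' := [4, -3, 4, 2, -1, 2, 1, -3, -2, 4, -3, 4]) [6] [] (by decide)).trans 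
      (peak_mul_peak_zero_rev (p := []) (e := -2) (d := -3) (q := [2, -1, 2, 1])
      (by decide) (by decide) (by decide) (by decide)))
  rw [h, e, z₁, z₂]
  simp

theorem peak_v'_three_v {d : ℤ} (hd : d = 3 ∨ d = -3) {q : List ℤ} (hq : Low q) :
    D.m (4 :: (-3 :: (4 :: (-2 :: (1 :: (-2 :: (d :: (q ++ [4, -3, 4])))))))) = D.V • D.m
        (1 :: (4 :: (-3 :: (4 :: (2 :: (-1 :: (2 :: (d :: (q ++ [4, -3, 4]))))))))) := by
  have h : D.m (4 :: (-3 :: (4 :: (-2 :: (1 :: (-2 :: (d :: (q ++ [4, -3, 4])))))))) = D.V • D.m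
      (4 :: (-3 :: (4 :: (1 :: (2 :: (-1 :: (2 :: (d :: (q ++ [4, -3, 4])))))))))
      - (D.V * D.S) • D.m (4 :: (-3 :: (4 :: (1 :: (2 :: (-1 :: (d :: (q ++ [4, -3, 4])))))))) +
          (D.V * D.T) • D.m (4 :: (-3 :: (4 :: (-2 :: (1 :: (d :: (q ++ [4, -3, 4]))))))) :=
    D.c_cube_inv_left (D.N 2) 1 2 (by decide) [4, -3, 4] (d :: (q ++ [4, -3, 4]))
  have e : D.m (4 :: (-3 :: (4 :: (1 :: (2 :: (-1 :: (2 :: (d :: (q ++ [4, -3, 4]))))))))) = D.m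
      (1 :: (4 :: (-3 :: (4 :: (2 :: (-1 :: (2 :: (d :: (q ++ [4, -3, 4]))))))))) := c_eq [2, 1, 0]
      [] rfl
  have z₁ : D.m (4 :: (-3 :: (4 :: (1 :: (2 :: (-1 :: (d :: (q ++ [4, -3, 4])))))))) = 0 := by
    have := peak_mul_peak_zero (D := D) (p := [1]) (e := 2) (d := d) (q := -1 :: q) (by decide)
      (by decide) (by omega) (hq.cons (by decide))
    refine Eq.trans ?_ this
    have key : ∀ b : ℤ, D.w [-1, b] = D.w [b, -1] →
        D.m (4 :: (-3 :: (4 :: (1 :: (2 :: (-1 :: (b :: (q ++ [4, -3, 4])))))))) = D.m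
            (4 :: (-3 :: (4 :: (1 :: (2 :: (b :: (-1 :: (q ++ [4, -3, 4])))))))) := by
      intro b hb
      have := congrArg (D.ctx (D.N 2) [4, -3, 4, 1, 2] (q ++ [4, -3, 4])) hb
      rwa [D.ctx_w, D.ctx_w] at this
    rcases hd with rfl | rfl <;> exact key _ (D.w_eq [0] [] (by decide))
  have z₂ : D.m (4 :: (-3 :: (4 :: (-2 :: (1 :: (d :: (q ++ [4, -3, 4]))))))) = 0 := by
    have := peak_mul_peak_zero (D := D) (p := []) (e := -2) (d := d) (q := 1 :: q) (by decide)
      (by decide) (by omega) (hq.cons (by decide))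
    refine Eq.trans ?_ this
    have key : ∀ b : ℤ, D.w [1, b] = D.w [b, 1] →
        D.m (4 :: (-3 :: (4 :: (-2 :: (1 :: (b :: (q ++ [4, -3, 4]))))))) = D.m
            (4 :: (-3 :: (4 :: (-2 :: (b :: (1 :: (q ++ [4, -3, 4]))))))) := by
      intro b hb
      have := congrArg (D.ctx (D.N 2) [4, -3, 4, -2] (q ++ [4, -3, 4])) hb
      rwa [D.ctx_w, D.ctx_w] at this
    rcases hd with rfl | rfl <;> exact key _ (D.w_eq [0] [] (by decide))
  rw [h, e, z₁, z₂]
  simp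

/-- The three-strand relation for 2, 3 is inserted between the prefix 43'421' and the suffix
12'43'4. All terms vanish except v3v' and v3'v', where v' = 2'12', so these two agree.
`peak_v_three_v'` converts both into products ending in v, and V and the final 1 cancel. -/
theorem peak_v_three_inv_v : D.m [4, -3, 4, 2, -1, 2, -3, 2, -1, 2, 4, -3, 4] = (D.V * D.V) • D.m
    [4, 3, -2, 3, 1, -2, 1, 4, 3, -2, 3, 4] := by
  have h : D.m [4, -3, 4, 2, -1, -2, 3, 2, 1, -2, 4, -3, 4] = D.m [4, -3, 4, 2, -1, 2, 3, -2, 1, -2,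
      4, -3, 4] - D.m [4, -3, 4, 2, -1, 2, 3, 1, -2, 4, -3, 4]
      + D.m [4, -3, 4, 2, -1, 2, -3, 1, -2, 4, -3, 4] + D.m [4, -3, 4, 2, -1, -2, 3, 1, -2, 4, -3,
          4] - D.m [4, -3, 4, 2, -1, -2, -3, 1, -2, 4, -3, 4]
      + D.m [4, -3, 4, 2, -1, 3, 2, 1, -2, 4, -3, 4] - D.m [4, -3, 4, 2, -1, 3, -2, 1, -2, 4, -3, 4]
          - D.m [4, -3, 4, 2, -1, -3, 2, 1, -2, 4, -3, 4]
      + D.m [4, -3, 4, 2, -1, -3, -2, 1, -2, 4, -3, 4] + D.m [4, -3, 4, 2, -1, -2, -3, 2, 1, -2, 4,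
          -3, 4] - D.m [4, -3, 4, 2, -1, 2, -3, -2, 1, -2, 4, -3, 4] :=
    D.c_three (D.N 2) 2 3 (by decide) [4, -3, 4, 2, -1] [1, -2, 4, -3, 4]
  have z₀ : D.m [4, -3, 4, 2, -1, -2, 3, 2, 1, -2, 4, -3, 4] = 0 := ((c_eq (l' := [4, -3, 4, -1, -2,
      3, 1, 2, 1, -2, 4, -3, 4]) [3, 5] [] (by decide)).trans 
      (peak_mul_peak_zero (p := [-1]) (e := -2) (d := 3) (q := [1, 2, 1, -2])
      (by decide) (by decide) (by decide) (by decide)))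
  have z₁ : D.m [4, -3, 4, 2, -1, 2, 3, 1, -2, 4, -3, 4] = 0 := ((c_eq (l' := [4, -3, 4, 2, -1, 2,
      1, 3, -2, 4, -3, 4]) [6] [] (by decide)).trans 
      (peak_mul_peak_zero_rev (p := []) (e := -2) (d := 3) (q := [2, -1, 2, 1])
      (by decide) (by decide) (by decide) (by decide)))
  have z₂ : D.m [4, -3, 4, 2, -1, 2, -3, 1, -2, 4, -3, 4] = 0 := ((c_eq (l' := [4, -3, 4, 2, -1, 2,
      1, -3, -2, 4, -3, 4]) [6] [] (by decide)).trans 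
      (peak_mul_peak_zero_rev (p := []) (e := -2) (d := -3) (q := [2, -1, 2, 1])
      (by decide) (by decide) (by decide) (by decide)))
  have z₃ : D.m [4, -3, 4, 2, -1, -2, 3, 1, -2, 4, -3, 4] = 0 := ((c_eq (l' := [4, -3, 4, 2, -1, -2,
      1, 3, -2, 4, -3, 4]) [6] [] (by decide)).trans 
      (peak_mul_peak_zero_rev (p := []) (e := -2) (d := 3) (q := [2, -1, -2, 1])
      (by decide) (by decide) (by decide) (by decide)))
  have z₄ : D.m [4, -3, 4, 2, -1, -2, -3, 1, -2, 4, -3, 4] = 0 := ((c_eq (l' := [4, -3, 4, 2, -1,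
      -2, 1, -3, -2, 4, -3, 4]) [6] [] (by decide)).trans 
      (peak_mul_peak_zero_rev (p := []) (e := -2) (d := -3) (q := [2, -1, -2, 1])
      (by decide) (by decide) (by decide) (by decide)))
  have z₅ : D.m [4, -3, 4, 2, -1, 3, 2, 1, -2, 4, -3, 4] = 0 := ((c_eq (l' := [4, -3, 4, 2, 3, -1,
      2, 1, -2, 4, -3, 4]) [4] [] (by decide)).trans 
      (peak_mul_peak_zero (p := []) (e := 2) (d := 3) (q := [-1, 2, 1, -2])
      (by decide) (by decide) (by decide) (by decide)))
  have z₆ : D.m [4, -3, 4, 2, -1, 3, -2, 1, -2, 4, -3, 4] = 0 := ((c_eq (l' := [4, -3, 4, 2, 3, -1,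
      -2, 1, -2, 4, -3, 4]) [4] [] (by decide)).trans 
      (peak_mul_peak_zero (p := []) (e := 2) (d := 3) (q := [-1, -2, 1, -2])
      (by decide) (by decide) (by decide) (by decide)))
  have z₇ : D.m [4, -3, 4, 2, -1, -3, 2, 1, -2, 4, -3, 4] = 0 := ((c_eq (l' := [4, -3, 4, 2, -3, -1,
      2, 1, -2, 4, -3, 4]) [4] [] (by decide)).trans 
      (peak_mul_peak_zero (p := []) (e := 2) (d := -3) (q := [-1, 2, 1, -2])
      (by decide) (by decide) (by decide) (by decide)))
  have z₈ : D.m [4, -3, 4, 2, -1, -3, -2, 1, -2, 4, -3, 4] = 0 := ((c_eq (l' := [4, -3, 4, 2, -3,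
      -1, -2, 1, -2, 4, -3, 4]) [4] [] (by decide)).trans 
      (peak_mul_peak_zero (p := []) (e := 2) (d := -3) (q := [-1, -2, 1, -2])
      (by decide) (by decide) (by decide) (by decide)))
  have z₉ : D.m [4, -3, 4, 2, -1, -2, -3, 2, 1, -2, 4, -3, 4] = 0 := ((c_eq (l' := [4, -3, 4, -1,
      -2, -3, 1, 2, 1, -2, 4, -3, 4]) [3, 5] [] (by decide)).trans 
      (peak_mul_peak_zero (p := [-1]) (e := -2) (d := -3) (q := [1, 2, 1, -2])
      (by decide) (by decide) (by decide) (by decide)))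
  have e₁ : D.m [4, -3, 4, 2, -1, 2, 3, -2, 1, -2, 4, -3, 4] = D.V • D.m [4, -3, 4, 2, -1, 2, 3, 2,
      -1, 2, 4, -3, 4, 1] := peak_v_three_v' (by simp)
  have e₂ : D.m [4, -3, 4, 2, -1, 2, -3, -2, 1, -2, 4, -3, 4] = D.V • D.m [4, -3, 4, 2, -1, 2, -3,
      2, -1, 2, 4, -3, 4, 1] := peak_v_three_v' (by simp)
  have e₃ : D.m [4, -3, 4, 2, -1, 2, 3, 2, -1, 2, 4, -3, 4, 1] = (D.V * D.V) • D.m [4, 3, -2, 3, 1,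
      -2, 1, 4, 3, -2, 3, 4] := by
    have h := congrArg (D.act [] [1] (by decide) (by decide)) (peak_v_three_v (D := D))
    rwa [act_of_mem (D.K.smul_mem _ z_mem_K), act_m] at h
  have h₁ : D.V • D.m [4, -3, 4, 2, -1, 2, -3, 2, -1, 2, 4, -3, 4, 1] = D.V • (D.V * D.V) • D.m [4,
      3, -2, 3, 1, -2, 1, 4, 3, -2, 3, 4] := by
    rw [z₀, z₁, z₂, z₃, z₄, z₅, z₆, z₇, z₈, z₉, e₁, e₂, e₃] at h
    simp only [sub_zero, add_zero] at h
    exact (sub_eq_zero.1 h.symm).symm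
  have h₂ : D.m [4, -3, 4, 2, -1, 2, -3, 2, -1, 2, 4, -3, 4, 1] = (D.V * D.V) • D.m [4, 3, -2, 3, 1,
      -2, 1, 4, 3, -2, 3, 4] := by
    have := congrArg (D.U • ·) h₁
    simpa only [smul_smul, ← mul_assoc, D.UV, one_mul, one_smul] using this
  have h₃ := congrArg (D.act [] [-1] (by decide) (by decide)) h₂
  rw [act_of_mem (D.K.smul_mem _ z_mem_K), act_m] at h₃
  have e₄ : D.m [4, -3, 4, 2, -1, 2, -3, 2, -1, 2, 4, -3, 4, 1, -1] = D.m [4, -3, 4, 2, -1, 2, -3,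
      2, -1, 2, 4, -3, 4] :=
    c_eq [13] [] (by decide)
  exact e₄.symm.trans h₃

theorem peak_v'_three_inv_v :
    D.m [4, -3, 4, -2, 1, -2, -3, 2, -1, 2, 4, -3, 4] = (D.V * D.V * D.V) • D.m [4, 3, -2, 3, 1, -2,
        1, 4, 3, -2, 3, 4] := by
  have h := congrArg (D.act [1] [] (by decide) (by decide)) (peak_v_three_inv_v (D := D))
  rw [act_of_mem (D.K.smul_mem _ z_mem_K), act_m] at h
  have h' : D.m [4, -3, 4, -2, 1, -2, -3, 2, -1, 2, 4, -3, 4] = D.V • D.m [1, 4, -3, 4, 2, -1, 2,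
      -3, 2, -1, 2, 4, -3, 4] :=
    peak_v'_three_v (by simp) (q := [2, -1, 2]) (by decide)
  exact h'.trans ((congrArg (D.V • ·) h).trans (by simp only [smul_smul]; congr 1; ring))

theorem peak_v'_three_inv_v' :
    D.m [4, -3, 4, -2, 1, -2, -3, -2, 1, -2, 4, -3, 4] = (D.V * D.V * D.V * D.V) • D.m [4, 3, -2, 3,
        1, -2, 1, 4, 3, -2, 3, 4] := by
  have h₁ : D.m [4, -3, 4, 2, -1, 2, -3, 2, -1, 2, 4, -3, 4, 1] = (D.V * D.V) • D.m [4, 3, -2, 3, 1,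
      -2, 1, 4, 3, -2, 3, 4] := by
    have h := congrArg (D.act [] [1] (by decide) (by decide)) (peak_v_three_inv_v (D := D))
    rwa [act_of_mem (D.K.smul_mem _ z_mem_K), act_m] at h
  have h₂ : D.m [4, -3, 4, 2, -1, 2, -3, -2, 1, -2, 4, -3, 4] = (D.V * D.V * D.V) • D.m [4, 3, -2,
      3, 1, -2, 1, 4, 3, -2, 3, 4] := by
    rw [peak_v_three_v' (by simp), h₁, smul_smul]
    congr 1
    ring
  have h := congrArg (D.act [1] [] (by decide) (by decide)) h₂
  rw [act_of_mem (D.K.smul_mem _ z_mem_K), act_m] at h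
  have h' : D.m [4, -3, 4, -2, 1, -2, -3, -2, 1, -2, 4, -3, 4] = D.V • D.m [1, 4, -3, 4, 2, -1, 2,
      -3, -2, 1, -2, 4, -3, 4] :=
    peak_v'_three_v (by simp) (q := [-2, 1, -2]) (by decide)
  exact h'.trans ((congrArg (D.V • ·) h).trans (by simp only [smul_smul]; congr 1; ring))

/-! ### Exchange of the generators with their inverses -/

/-- A second peak 43'4 may be replaced by U 4'34'3', because the remaining terms of its expansion
contain the first peak and one further 4^±. -/
theorem peak_mul_peak_eq_right {l : List ℤ} (hl : Mid l) :
    D.m (4 :: (-3 :: (4 :: (l ++ [4, -3, 4])))) = D.U • D.m (4 :: (-3 :: (4 :: (l ++ [-4, 3, -4,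
        -3])))) := by
  have h : D.m (4 :: (-3 :: (4 :: (l ++ [4, -3, 4])))) = D.U • D.m (4 :: (-3 :: (4 :: (l ++ [-4, 3,
      -4, -3])))) + D.S • D.m (4 :: (-3 :: (4 :: (l ++ [-3, 4]))))
      - D.T • D.m (4 :: (-3 :: (4 :: (l ++ [3, -4, -3])))) := by
    have := D.c_cube_right (D.N 2) 3 4 (by decide) (4 :: (-3 :: (4 :: l))) []
    simpa using this
  have z₁ : D.m (4 :: (-3 :: (4 :: (l ++ [-3, 4])))) = 0 := by
    have := peak_zero_rev (D := D) (a := 4) (by simp) (hl.append (l' := [-3]) (by decide))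
    simpa using this
  have z₂ : D.m (4 :: (-3 :: (4 :: (l ++ [3, -4, -3])))) = 0 := by
    have := m_append_zero [-3] (by decide)
      (peak_zero_rev (D := D) (a := -4) (by simp) (hl.append (l' := [3]) (by decide)))
    simpa using this
  rw [h, z₁, z₂]
  simp

theorem peak_mul_peak_eq_left {l : List ℤ} (hl : Mid l) :
    D.m (4 :: (-3 :: (4 :: (l ++ [-4, 3, -4])))) = D.U • D.m (-3 :: (-4 :: (3 :: (-4 :: (l ++ [-4,
        3, -4]))))) := by
  have h : D.m (4 :: (-3 :: (4 :: (l ++ [-4, 3, -4])))) = D.U • D.m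
      (-3 :: (-4 :: (3 :: (-4 :: (l ++ [-4, 3, -4]))))) + D.S • D.m (4 :: (-3 :: (l ++ [-4, 3,
      -4])))
      - D.T • D.m (-3 :: (-4 :: (3 :: (l ++ [-4, 3, -4])))) := by
    have := D.c_cube_left (D.N 2) 3 4 (by decide) [] (l ++ [-4, 3, -4])
    simpa using this
  have z₁ : D.m (4 :: (-3 :: (l ++ [-4, 3, -4]))) = 0 :=
    peak_inv_zero (a := 4) (l := -3 :: l) (by simp) (hl.cons (by decide))
  have z₂ : D.m (-3 :: (-4 :: (3 :: (l ++ [-4, 3, -4])))) = 0 := m_prepend_zero [-3] (by decide)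
    (peak_inv_zero (a := -4) (l := 3 :: l) (by simp) (hl.cons (by decide)))
  rw [h, z₁, z₂]
  simp

/-- With v' = 2'12', the product 43'4·v'3'v'·43'4 equals V⁴ z. Turning each peak into 4'34' costs a
factor U, and `peak_v_three_v` for the inverted generators evaluates the result as U² times the
inverted z. Hence V⁴ z is U⁴ times the inverted z. -/
theorem z_bar : D.m [-4, -3, 2, -3, -1, 2, -1, -4, -3, 2, -3, -4] =
    (D.V * D.V * D.V * D.V * (D.V * D.V * D.V * D.V)) • D.m [4, 3, -2, 3, 1, -2, 1, 4, 3, -2, 3, 4]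
        := by
  have h₁ : D.m [4, -3, 4, -2, 1, -2, -3, -2, 1, -2, 4, -3, 4] = D.U • D.m [4, -3, 4, -2, 1, -2, -3,
      -2, 1, -2, -4, 3, -4, -3] :=
    peak_mul_peak_eq_right (l := [-2, 1, -2, -3, -2, 1, -2]) (by decide)
  have h₂ : D.m [4, -3, 4, -2, 1, -2, -3, -2, 1, -2, -4, 3, -4] = D.U • D.m [-3, -4, 3, -4, -2, 1,
      -2, -3, -2, 1, -2, -4, 3, -4] :=
    peak_mul_peak_eq_left (l := [-2, 1, -2, -3, -2, 1, -2]) (by decide)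
  have h₃ : D.m [-4, 3, -4, -2, 1, -2, -3, -2, 1, -2, -4, 3, -4] = (D.U * D.U) • D.m [-4, -3, 2, -3,
      -1, 2, -1, -4, -3, 2, -3, -4] := by
    have := congrArg D.inv (peak_v_three_v (D := D.bar))
    rw [map_smul, inv_m, inv_m] at this
    exact this
  have h₄ := congrArg (D.act [3] [3] (by decide) (by decide)) h₁
  have h₅ := congrArg (D.act [3] [-3, 3] (by decide) (by decide)) h₂
  rw [peak_v'_three_inv_v', act_of_mem (D.K.smul_mem _ z_mem_K), map_smul, act_m] at h₄
  rw [map_smul, act_m, act_m] at h₅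
  have e : D.m [3, -3, -4, 3, -4, -2, 1, -2, -3, -2, 1, -2, -4, 3, -4, -3, 3] = D.m [-4, 3, -4, -2,
      1, -2, -3, -2, 1, -2, -4, 3, -4] :=
    c_eq [0, 13] [] (by decide)
  have h₆ : (D.V * D.V * D.V * D.V) • D.m [4, 3, -2, 3, 1, -2, 1, 4, 3, -2, 3, 4]
      = D.U • D.U • (D.U * D.U) • D.m [-4, -3, 2, -3, -1, 2, -1, -4, -3, 2, -3, -4] := by
    rw [← h₃, ← e]
    exact h₄.trans (congrArg (D.U • ·) h₅)
  have h₇ := congrArg ((D.V * D.V * D.V * D.V) • ·) h₆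
  have hu : D.V * D.V * D.V * D.V * (D.U * (D.U * (D.U * D.U))) = 1 := by
    calc _ = (D.V * D.U) * (D.V * D.U) * (D.V * D.U) * (D.V * D.U) := by ring
      _ = 1 := by simp [D.VU]
  simp only [smul_smul, hu, one_smul] at h₇
  exact h₇.symm

/-- By `z_bar` inversion of the generators preserves the line, so it can be used as a symmetry in
the remaining cases. -/
theorem inv_mem_K {t : A ⧸ D.bar.N 2} (ht : t ∈ D.bar.K) : D.inv t ∈ D.K := by
  obtain ⟨r, rfl⟩ := Submodule.mem_span_singleton.1 ht
  rw [map_smul, inv_m]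
  refine D.K.smul_mem _ ?_
  have h := z_bar (D := D)
  have h' : D.m ([4, 3, -2, 3, 1, -2, 1, 4, 3, -2, 3, 4].map Neg.neg) = _ := h
  rw [h']
  exact D.K.smul_mem _ z_mem_K

theorem rev_mem_K {t : Aᵐᵒᵖ ⧸ D.op.N 2} (ht : t ∈ D.op.K) : D.rev t ∈ D.K := by
  obtain ⟨r, rfl⟩ := Submodule.mem_span_singleton.1 ht
  rw [map_smul, rev_m, z_reverse]
  exact D.K.smul_mem _ z_mem_K

theorem mem_K_of_bar {l : List ℤ} (h : D.bar.m l ∈ D.bar.K) : D.m (l.map Neg.neg) ∈ D.K := by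
  rw [← inv_m]
  exact inv_mem_K h

theorem mem_K_of_op {l : List ℤ} (h : D.op.m l ∈ D.op.K) : D.m l.reverse ∈ D.K := by
  rw [← rev_m]
  exact rev_mem_K h

/-! ### The products `4'w+4'w+4'` and `4w-4w-4` -/

/-- The absorption formula for the inverted peak 3'23', applied before 2' 2 and solved for the term
3'23'2. The error terms are kept because one of them does not vanish later. -/
theorem x_two_inv (q : List ℤ) (W : Submodule k A) (p : List ℤ) :
    D.c W (p ++ (-3 :: (2 :: (-3 :: (2 :: q))))) = D.c W (p ++ (-3 :: (2 :: (-3 :: q)))) - D.c W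
        (p ++ (-2 :: (-3 :: (2 :: q))))
      + D.c W (p ++ (-2 :: (-3 :: q))) - D.c W (p ++ (2 :: (-3 :: q))) + D.c W
          (p ++ (2 :: (3 :: q)))
      - D.c W (p ++ (2 :: (3 :: (-2 :: q)))) + D.c W (p ++ (2 :: (-3 :: (2 :: q)))) - D.c W
          (p ++ (-3 :: (-3 :: q)))
      + D.c W (p ++ (-3 :: (-3 :: (2 :: (2 :: q))))) + D.c W (p ++ q) - D.c W (p ++ (2 :: (2 :: q)))
          := by
  have h := D.bar.c_peak_mul W 2 3 (by decide) (p.map Neg.neg) (-2 :: q.map Neg.neg)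
  simp only [c_bar, List.map_append, List.map_cons, List.map_map, neg_neg, Function.comp_def,
    List.map_id'] at h
  have e₁ := D.c_cancel' W 2 (p ++ [-3, 2, -3]) q
  have e₂ := D.c_cancel' W 2 (p ++ [-2, -3]) q
  have e₃ := D.c_cancel' W 2 (p ++ [2, -3]) q
  have e₄ := D.c_cancel' W 2 (p ++ [2, 3]) q
  have e₅ := D.c_cancel' W 2 (p ++ [2, 3, -2]) q
  have e₆ := D.c_cancel' W 2 (p ++ [-3, -3]) q
  have e₇ := D.c_cancel' W 2 p q
  simp only [List.append_assoc, List.cons_append, List.nil_append] at e₁ e₂ e₃ e₄ e₅ e₆ e₇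
  rw [e₁, e₂, e₃, e₄, e₅, e₆, e₇] at h
  rw [h]
  abel

/-- `43'4 n 43'4` with `n = p 3'3' q`. -/
theorem peak_sq_peak {e : ℤ} {q : List ℤ} (he : e = 0 ∨ e = 2 ∨ e = -2) (hq : Low q) :
    D.m (4 :: (-3 :: (4 :: (e :: (-3 :: (-3 :: (q ++ [4, -3, 4]))))))) = 0 := by
  have h : D.m (4 :: (-3 :: (4 :: (e :: (-3 :: (-3 :: (q ++ [4, -3, 4]))))))) = (D.T * D.V) • D.m
      (4 :: (-3 :: (4 :: (e :: (-3 :: (q ++ [4, -3, 4]))))))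
      - (D.S * D.V) • D.m (4 :: (-3 :: (4 :: (e :: (-3 :: (3 :: (q ++ [4, -3, 4]))))))) + D.V • D.m
          (4 :: (-3 :: (4 :: (e :: (-3 :: (3 :: (3 :: (q ++ [4, -3, 4])))))))) :=
    D.c_cubic' (D.N 2) 3 (by norm_num) [4, -3, 4, e, -3] (q ++ [4, -3, 4])
  have e₁ := D.c_cancel' (D.N 2) 3 [4, -3, 4, e] (q ++ [4, -3, 4])
  have e₂ := D.c_cancel' (D.N 2) 3 [4, -3, 4, e] (3 :: (q ++ [4, -3, 4]))
  have e₀ := D.c_zero (D.N 2) [4, -3, 4, e] (q ++ [4, -3, 4])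
  have z₁ := peak_three_peak (D := D) he (d := 0) (by simp) hq
  have z₂ := peak_three_peak (D := D) he (d := 3) (by simp) hq
  have z₃ := peak_three_peak (D := D) he (d := -3) (by simp) hq
  simp only [List.cons_append, List.nil_append] at e₀ e₁ e₂
  refine h.trans ?_
  rw [z₃, m, e₁, m, e₂, ← e₀, ← m, z₁, ← m, z₂]
  simp

/-- Expanding 3'23'2, the term with 2'3'2 gives 2'12'·3'·21'2 with coefficient -1, hence -V³ z. The
term without that last 2 becomes, when the first peak emits a 3, a similar product; expanded again,
it has only vanishing terms. -/
theorem peak_x_inv_peak : D.m [4, -3, 4, -2, 1, -3, 2, -3, 2, -1, 2, 4, -3, 4] =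
    -((D.V * D.V * D.V) • D.m [4, 3, -2, 3, 1, -2, 1, 4, 3, -2, 3, 4]) := by
  have h₁ : D.m [4, -3, 4, -2, 1, -3, 2, -3, 2, -1, 2, 4, -3, 4] = D.m [4, -3, 4, -2, 1, -3, 2, -3,
      -1, 2, 4, -3, 4]
      - D.m [4, -3, 4, -2, 1, -2, -3, 2, -1, 2, 4, -3, 4] + D.m [4, -3, 4, -2, 1, -2, -3, -1, 2, 4,
          -3, 4] - D.m [4, -3, 4, -2, 1, 2, -3, -1, 2, 4, -3, 4]
      + D.m [4, -3, 4, -2, 1, 2, 3, -1, 2, 4, -3, 4] - D.m [4, -3, 4, -2, 1, 2, 3, -2, -1, 2, 4, -3,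
          4] + D.m [4, -3, 4, -2, 1, 2, -3, 2, -1, 2, 4, -3, 4]
      - D.m [4, -3, 4, -2, 1, -3, -3, -1, 2, 4, -3, 4] + D.m [4, -3, 4, -2, 1, -3, -3, 2, 2, -1, 2,
          4, -3, 4] + D.m [4, -3, 4, -2, 1, -1, 2, 4, -3, 4]
      - D.m [4, -3, 4, -2, 1, 2, 2, -1, 2, 4, -3, 4] := x_two_inv [-1, 2, 4, -3, 4] (D.N 2) [4, -3,
          4, -2, 1]
  have h₂ : D.m [4, -3, 4, -2, 1, -3, 2, -3, 2, 4, -3, 4] = D.m [4, -3, 4, -2, 1, -3, 2, -3, 4, -3,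
      4]
      - D.m [4, -3, 4, -2, 1, -2, -3, 2, 4, -3, 4] + D.m [4, -3, 4, -2, 1, -2, -3, 4, -3, 4] - D.m
          [4, -3, 4, -2, 1, 2, -3, 4, -3, 4]
      + D.m [4, -3, 4, -2, 1, 2, 3, 4, -3, 4] - D.m [4, -3, 4, -2, 1, 2, 3, -2, 4, -3, 4] + D.m [4,
          -3, 4, -2, 1, 2, -3, 2, 4, -3, 4]
      - D.m [4, -3, 4, -2, 1, -3, -3, 4, -3, 4] + D.m [4, -3, 4, -2, 1, -3, -3, 2, 2, 4, -3, 4]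
          + D.m [4, -3, 4, -2, 1, 4, -3, 4]
      - D.m [4, -3, 4, -2, 1, 2, 2, 4, -3, 4] := x_two_inv [2, 4, -3, 4].tail (D.N 2) [4, -3, 4, -2,
          1]
  have a₁ : D.m [4, -3, 4, -2, 1, -3, 2, -3, -1, 2, 4, -3, 4] = D.m [4, -3, 4, -2, 1, -3, 2, -3, 2,
      4, -3, 4] := by
    have e : D.m [4, -3, 4, 3, -2, 1, -3, 2, -3, -1, 2, 4, -3, 4] = D.m [4, -3, 4, -2, 1, -3, 2, -3,
        2, 4, -3, 4] :=
      c_eq [5, 3, 5, 7, 8] [4] (by decide)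
    exact (three_mul_peak (l := [-2, 1, -3, 2, -3, -1, 2]) (by decide)).symm.trans e
  have a₂ : D.m [4, -3, 4, -2, 1, -3, 2, -3, 4, -3, 4] = 0 := by
    have e : D.m [4, -3, 4, -2, 1, -3, 2, -3, 3, 4, -3, 4] = D.m [4, -3, 4, -2, 1, -3, 2, 4, -3, 4]
        :=
      D.c_cancel' (D.N 2) 3 [4, -3, 4, -2, 1, -3, 2] [4, -3, 4]
    exact (peak_mul_three (l := [-2, 1, -3, 2, -3]) (by decide)).symm.trans
        (e.trans (peak_mul_peak_zero_rev (p := []) (e := 2) (d := -3) (q := [-2, 1])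
      (by decide) (by decide) (by decide) (by decide)))
  have m₁ : D.m [4, -3, 4, -2, 1, -2, -3, 2, -1, 2, 4, -3, 4] = (D.V * D.V * D.V) • D.m [4, 3, -2,
      3, 1, -2, 1, 4, 3, -2, 3, 4] := peak_v'_three_inv_v
  have b₁ : D.m [4, -3, 4, -2, 1, -2, -3, -1, 2, 4, -3, 4] = 0 := ((c_eq (l' := [4, -3, 4, -2, 1,
      -2, -1, -3, 2, 4, -3, 4]) [6] [] (by decide)).trans 
      (peak_mul_peak_zero_rev (p := []) (e := 2) (d := -3) (q := [-2, 1, -2, -1])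
      (by decide) (by decide) (by decide) (by decide)))
  have b₂ : D.m [4, -3, 4, -2, 1, 2, -3, -1, 2, 4, -3, 4] = 0 := ((c_eq (l' := [4, -3, 4, -2, 1, 2,
      -1, -3, 2, 4, -3, 4]) [6] [] (by decide)).trans 
      (peak_mul_peak_zero_rev (p := []) (e := 2) (d := -3) (q := [-2, 1, 2, -1])
      (by decide) (by decide) (by decide) (by decide)))
  have b₃ : D.m [4, -3, 4, -2, 1, 2, 3, -1, 2, 4, -3, 4] = 0 := ((c_eq (l' := [4, -3, 4, -2, 1, 2,
      -1, 3, 2, 4, -3, 4]) [6] [] (by decide)).trans 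
      (peak_mul_peak_zero_rev (p := []) (e := 2) (d := 3) (q := [-2, 1, 2, -1])
      (by decide) (by decide) (by decide) (by decide)))
  have b₄ : D.m [4, -3, 4, -2, 1, 2, 3, -2, -1, 2, 4, -3, 4] = 0 := ((c_eq (l' := [4, -3, 4, 1, 2,
      3, -1, -2, -1, 2, 4, -3, 4]) [3, 5] [] (by decide)).trans 
      (peak_mul_peak_zero (p := [1]) (e := 2) (d := 3) (q := [-1, -2, -1, 2])
      (by decide) (by decide) (by decide) (by decide)))
  have b₅ : D.m [4, -3, 4, -2, 1, 2, -3, 2, -1, 2, 4, -3, 4] = 0 := ((c_eq (l' := [4, -3, 4, 1, 2,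
      -3, -1, 2, -1, 2, 4, -3, 4]) [3, 5] [] (by decide)).trans 
      (peak_mul_peak_zero (p := [1]) (e := 2) (d := -3) (q := [-1, 2, -1, 2])
      (by decide) (by decide) (by decide) (by decide)))
  have b₆ : D.m [4, -3, 4, -2, 1, -3, -3, -1, 2, 4, -3, 4] = 0 :=
    (c_eq [4] [5] (by decide)).trans
      (peak_sq_peak (e := -2) (q := [1, -1, 2]) (by simp) (by decide))
  have b₇ : D.m [4, -3, 4, -2, 1, -3, -3, 2, 2, -1, 2, 4, -3, 4] = 0 :=
    (c_eq [4] [5] (by decide)).trans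
      (peak_sq_peak (e := -2) (q := [1, 2, 2, -1, 2]) (by simp) (by decide))
  have b₈ : D.m [4, -3, 4, -2, 1, -1, 2, 4, -3, 4] = 0 := peak_low_peak (q := [-2, 1, -1, 2])
      (by decide)
  have b₉ : D.m [4, -3, 4, -2, 1, 2, 2, -1, 2, 4, -3, 4] = 0 := peak_low_peak (q := [-2, 1, 2, 2,
      -1, 2]) (by decide)
  have d₀ : D.m [4, -3, 4, -2, 1, -2, -3, 2, 4, -3, 4] = 0 := (peak_mul_peak_zero_rev (p :=
      []) (e := 2) (d := -3) (q := [-2, 1, -2])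
      (by decide) (by decide) (by decide) (by decide))
  have d₁ : D.m [4, -3, 4, -2, 1, -2, -3, 4, -3, 4] = 0 := (D.c_zero (D.N 2) [4, -3, 4, -2, 1, -2,
      -3] [4, -3, 4]).symm.trans
    (peak_mul_peak_zero_rev (p := []) (e := 0) (d := -3) (q := [-2, 1, -2])
      (by decide) (by decide) (by decide) (by decide))
  have d₂ : D.m [4, -3, 4, -2, 1, 2, -3, 4, -3, 4] = 0 := ((c_eq (l' := [4, -3, 4, 1, 2, -3, -1, 4,
      -3, 4]) [3, 5] [] (by decide)).trans 
      (peak_mul_peak_zero (p := [1]) (e := 2) (d := -3) (q := [-1])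
      (by decide) (by decide) (by decide) (by decide)))
  have d₃ : D.m [4, -3, 4, -2, 1, 2, 3, 4, -3, 4] = 0 := ((c_eq (l' := [4, -3, 4, 1, 2, 3, -1, 4,
      -3, 4]) [3, 5] [] (by decide)).trans 
      (peak_mul_peak_zero (p := [1]) (e := 2) (d := 3) (q := [-1])
      (by decide) (by decide) (by decide) (by decide)))
  have d₄ : D.m [4, -3, 4, -2, 1, 2, 3, -2, 4, -3, 4] = 0 := (peak_mul_peak_zero_rev (p := []) (e :=
      -2) (d := 3) (q := [-2, 1, 2])
      (by decide) (by decide) (by decide) (by decide))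
  have d₅ : D.m [4, -3, 4, -2, 1, 2, -3, 2, 4, -3, 4] = 0 := (peak_mul_peak_zero_rev (p := []) (e :=
      2) (d := -3) (q := [-2, 1, 2])
      (by decide) (by decide) (by decide) (by decide))
  have d₆ : D.m [4, -3, 4, -2, 1, -3, -3, 4, -3, 4] = 0 :=
    (c_eq [4] [5] (by decide)).trans
      (peak_sq_peak (e := -2) (q := [1]) (by simp) (by decide))
  have d₇ : D.m [4, -3, 4, -2, 1, -3, -3, 2, 2, 4, -3, 4] = 0 :=
    (c_eq [4] [5] (by decide)).trans
      (peak_sq_peak (e := -2) (q := [1, 2, 2]) (by simp) (by decide))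
  have d₈ : D.m [4, -3, 4, -2, 1, 4, -3, 4] = 0 := peak_low_peak (q := [-2, 1]) (by decide)
  have d₉ : D.m [4, -3, 4, -2, 1, 2, 2, 4, -3, 4] = 0 := peak_low_peak (q := [-2, 1, 2, 2])
      (by decide)
  rw [a₂, d₀, d₁, d₂, d₃, d₄, d₅, d₆, d₇, d₈, d₉] at h₂
  rw [a₁, h₂, m₁, b₁, b₂, b₃, b₄, b₅, b₆, b₇, b₈, b₉] at h₁
  refine h₁.trans ?_
  abel

theorem peak_mul_peak_inv {l : List ℤ} (hl : Mid l) :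
    D.m (4 :: (-3 :: (4 :: (l ++ [-4, 3, -4, -3])))) = D.V • D.m (4 :: (-3 :: (4 :: (l ++ [4, -3,
        4])))) := by
  rw [peak_mul_peak_eq_right hl, smul_smul, D.VU, one_smul]

/-- Expand the central 34'3. The S and T terms vanish, and the U term is, as a braid, the product of
`peak_x_inv_peak` with its second peak inverted, between words acting trivially. Inverting that peak
gives a factor V, which cancels U. -/
theorem zPlus_eq : D.m [-4, 3, 2, -1, 2, 3, -4, 3, 2, -1, 2, 3, -4] = -((D.V * D.V * D.V) • D.m [4,
    3, -2, 3, 1, -2, 1, 4, 3, -2, 3, 4]) := by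
  have h : D.m [-4, 3, 2, -1, 2, 3, -4, 3, 2, -1, 2, 3, -4] = D.U • D.m [-4, 3, 2, -1, 2, -3, 4, -3,
      -4, 2, -1, 2, 3, -4] + D.S • D.m [-4, 3, 2, -1, 2, -4, 3, 2, -1, 2, 3, -4]
      - D.T • D.m [-4, 3, 2, -1, 2, 4, -3, -4, 2, -1, 2, 3, -4] := D.c_cube_right (D.N 2) 4 3
          (by decide) [-4, 3, 2, -1, 2] [2, -1, 2, 3, -4]
  have z₁ : D.m [-4, 3, 2, -1, 2, -4, 3, 2, -1, 2, 3, -4] = 0 := short_left (p := []) (d := 3) (q :=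
      [2, -1, 2]) (l := [3, 2, -1, 2, 3])
    (by simp) (by simp) (by simp) (by simp) (by decide) (by decide) (by decide)
  have z₂ : D.m [-4, 3, 2, -1, 2, 4, -3, -4, 2, -1, 2, 3, -4] = 0 := by
    have e : D.m [-4, 3, 2, -1, 2, 4, -3, -4, 2, -1, 2, 3, -4] = D.m [3, 4, -3, 2, -1, 2, -3, 2, -1,
        2, -4, 3, -4] :=
      c_eq [4, 3, 2, 0] [9, 8, 7] (by decide)
    exact e.trans (m_prepend_zero [3] (by decide)
      (peak_inv_zero (a := 4) (l := [-3, 2, -1, 2, -3, 2, -1, 2]) (by simp) (by decide)))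
  have e : D.m [-4, 3, 2, -1, 2, -3, 4, -3, -4, 2, -1, 2, 3, -4] = D.m [-2, -1, 3, 2, 4, -3, 4, -2,
      1, -3, 2, -3, 2, -1, 2, -4, 3, -4, -3, 3] :=
    c_eq [8, 9, 10] [3, 6, 4, 2, 1, 0, 2, 4, 5, 7, 6, 5, 3, 1, 3, 4, 6, 8, 7, 14] (by decide)
  have h₁ : D.m [4, -3, 4, -2, 1, -3, 2, -3, 2, -1, 2, -4, 3, -4, -3] =
      D.V • -((D.V * D.V * D.V) • D.m [4, 3, -2, 3, 1, -2, 1, 4, 3, -2, 3, 4]) := by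
    rw [← peak_x_inv_peak]
    exact peak_mul_peak_inv (l := [-2, 1, -3, 2, -3, 2, -1, 2]) (by decide)
  have h₂ : D.m [-2, -1, 3, 2, 4, -3, 4, -2, 1, -3, 2, -3, 2, -1, 2, -4, 3, -4, -3, 3] = D.m [4, -3,
      4, -2, 1, -3, 2, -3, 2, -1, 2, -4, 3, -4, -3] := by
    refine ctx_of_mem (l := [4, -3, 4, -2, 1, -3, 2, -3, 2, -1, 2, -4, 3, -4, -3]) ?_ (p := [-2, -1,
        3, 2]) (q := [3]) (by decide) (by decide)
    rw [h₁]
    exact D.K.smul_mem _ (D.K.neg_mem (D.K.smul_mem _ z_mem_K))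
  rw [h, z₁, z₂, e, h₂, h₁, smul_smul, D.UV]
  simp

/-- This is `zPlus_eq` for the inverted generators: the coefficient is -U³ times the inverted z, and
U³V⁸ = V⁵ by `z_bar`. -/
theorem zMinus_eq :
    D.m [4, -3, -2, 1, -2, -3, 4, -3, -2, 1, -2, -3, 4] = -((D.V * D.V * D.V * D.V * D.V) • D.m [4,
        3, -2, 3, 1, -2, 1, 4, 3, -2, 3, 4]) := by
  have h := congrArg D.inv (zPlus_eq (D := D.bar))
  rw [map_neg, map_smul, inv_m, inv_m] at h
  have h' : D.m [4, -3, -2, 1, -2, -3, 4, -3, -2, 1, -2, -3, 4] = -((D.U * D.U * D.U) • D.m [-4, -3,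
      2, -3, -1, 2, -1, -4, -3, 2, -3, -4]) := h
  rw [h', z_bar, smul_smul]
  congr 2
  calc D.U * D.U * D.U * (D.V * D.V * D.V * D.V * (D.V * D.V * D.V * D.V))
      = (D.U * D.V) * (D.U * D.V) * (D.U * D.V) * (D.V * D.V * D.V * D.V * D.V) := by ring
    _ = _ := by rw [D.UV]; ring

end CubicSys

namespace CubicSys

variable {k A : Type} [CommRing k] [Ring A] [Algebra k A] {D : CubicSys k A}

/-! ### All products with three factors `4^±` -/

theorem mem_K_of_zero {l : List ℤ} (h : D.m l = 0) : D.m l ∈ D.K := h ▸ D.K.zero_mem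

theorem mem_K_congr {l l' : List ℤ} (h : D.m l = D.m l') (h' : D.m l' ∈ D.K) : D.m l ∈ D.K :=
  h ▸ h'

theorem mem_K_congr_smul {l l' : List ℤ} {r : k} (h : D.m l = r • D.m l') (h' : D.m l' ∈ D.K) :
    D.m l ∈ D.K := h ▸ D.K.smul_mem r h'

theorem mid_mem {p q : List ℤ}
    (h₁ : ∀ p' q' a, Low p' → Low q' → (a = 0 ∨ a = 3 ∨ a = -3) →
      D.m (p ++ ((p' ++ (a :: q')) ++ q)) = 0)
    (h₂ : ∀ p' q', Low p' → Low q' → D.m (p ++ ((p' ++ (3 :: (-2 :: (3 :: q')))) ++ q)) ∈ D.K)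
    (h₃ : D.m (p ++ ([3, 2, -1, 2, 3] ++ q)) ∈ D.K) (h₄ : D.m (p ++ ([-3, -2, 1, -2,
        -3] ++ q)) ∈ D.K) {l : List ℤ}
    (hl : Mid l) : D.m (p ++ (l ++ q)) ∈ D.K := by
  have := mid_zero (D := D) (D.K.mkQ ∘ₗ D.ctx (D.N 2) p q) (fun p' q' a hp hq ha => ?_)
    (fun p' q' hp hq => ?_) ?_ ?_ hl
  · rwa [LinearMap.comp_apply, D.ctx_w, Submodule.mkQ_apply, Submodule.Quotient.mk_eq_zero] at this
  all_goals rw [LinearMap.comp_apply, D.ctx_w, Submodule.mkQ_apply, Submodule.Quotient.mk_eq_zero]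
  · exact mem_K_of_zero (h₁ p' q' a hp hq ha)
  · exact h₂ p' q' hp hq
  · exact h₃
  · exact h₄

/-- As braids, 4x4' and 4'x4 are 43'4 multiplied on both sides by words in 2 and 3, so `peak_zero`
applies. -/
theorem mid_mixed_zero {a : ℤ} (ha : a = 4 ∨ a = -4) {l : List ℤ} (hl : Mid l) :
    D.m (a :: (l ++ [4, 3, -2, 3, -4])) = 0 ∧ D.m (a :: (l ++ [-4, 3, -2, 3, 4])) = 0 := by
  constructor
  · have h := c_eq_ctx (D := D) (W := D.N 2) (l := [4, 3, -2, 3, -4]) (l' := [-3, -2, 4, -3, 4, 2,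
      3]) (a :: l) []
      [] [1, 4, 2, 0, 2, 3, 5] (by decide)
    have z := m_append_zero [2, 3] (by decide)
      (peak_zero (D := D) ha (hl.append (l' := [-3, -2]) (by decide)))
    simp only [List.append_assoc, List.cons_append, List.nil_append, List.append_nil] at h z
    exact h.trans z
  · have h := c_eq_ctx (D := D) (W := D.N 2) (l := [-4, 3, -2, 3, 4]) (l' := [3, 2, 4, -3, 4, -2,
      -3]) (a :: l) []
      [] [1, 4, 2, 0, 2, 3, 5] (by decide)
    have z := m_append_zero [-2, -3] (by decide)
      (peak_zero (D := D) ha (hl.append (l' := [3, 2]) (by decide)))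
    simp only [List.append_assoc, List.cons_append, List.nil_append, List.append_nil] at h z
    exact h.trans z

theorem mixed_mid_zero {c : ℤ} (hc : c = 4 ∨ c = -4) {l : List ℤ} (hl : Mid l) :
    D.m (4 :: (3 :: (-2 :: (3 :: (-4 :: (l ++ [c])))))) = 0 ∧ D.m
        (-4 :: (3 :: (-2 :: (3 :: (4 :: (l ++ [c])))))) = 0 := by
  have h := mid_mixed_zero (D := D.op) hc hl.reverse
  exact ⟨by simpa using op_m_eq_zero D h.2, by simpa using op_m_eq_zero D h.1⟩

/-- Both factors x are traded for U 3'23', giving the inverted form of `x_low_mem`. -/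
theorem x_x_neg_mem {q : List ℤ} (hq : Low q) : D.m (-4 :: (3 :: (-2 :: (3 :: (q ++ [-4, 3, -2, 3,
    -4]))))) ∈ D.K := by
  have h₁ : D.U • D.m (-4 :: (-3 :: (2 :: (-3 :: (q ++ [-4, 3, -2, 3, -4]))))) = D.m
      (-4 :: (3 :: (-2 :: (3 :: (q ++ [-4, 3, -2, 3, -4]))))) := by
    have := map_x_inv (left_short (D := D) (a := -4) (b := -4) (c := -4) (p := []) (r := [])
      (l := [3, -2, 3]) (by simp) (by simp) (by simp) (by decide) (by decide) (by decide)) hq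
    simpa only [D.ctx_w, List.cons_append, List.append_assoc, List.nil_append, List.append_nil]
      using this
  have h₂ : D.U • D.m (-4 :: (-3 :: (2 :: (-3 :: (q ++ [-4, -3, 2, -3, -4]))))) = D.m
      (-4 :: (-3 :: (2 :: (-3 :: (q ++ [-4, 3, -2, 3, -4]))))) := by
    have := map_x_inv (right_short (D := D) (a := -4) (b := -4) (c := -4) (p := []) (r := [])
      (l := (-3 :: (2 :: (-3 :: q)))) (by simp) (by simp) (by simp) (by decide) (by decide)
      (hq.mid.cons (by decide) |>.cons (by decide) |>.cons (by decide))) (q := []) (by decide)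
    simpa only [D.ctx_w, List.cons_append, List.append_assoc, List.nil_append, List.append_nil]
      using this
  have h₃ : D.m (-4 :: (-3 :: (2 :: (-3 :: (q ++ [-4, -3, 2, -3, -4]))))) ∈ D.K := by
    have := mem_K_of_bar (x_low_mem (D := D.bar) hq.neg)
    simpa [Function.comp_def] using this
  rw [← h₁, ← h₂]
  exact D.K.smul_mem _ (D.K.smul_mem _ h₃)

theorem x_x_mem {a b c : ℤ} (ha : a = 4 ∨ a = -4) (hb : b = 4 ∨ b = -4) (hc : c = 4 ∨ c = -4)
    {q : List ℤ} (hq : Low q) : D.m (a :: (3 :: (-2 :: (3 :: (q ++ [b, 3, -2, 3, c]))))) ∈ D.K := by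
  have hx : Mid (3 :: (-2 :: (3 :: q))) := hq.mid.cons (by decide) |>.cons (by decide) |>.cons
      (by decide)
  have hx' : Mid (q ++ [3, -2, 3]) := hq.mid.append (by decide)
  have e : D.m (a :: (3 :: (-2 :: (3 :: (b :: (q ++ [3, -2, 3, c])))))) = D.m
      (a :: (3 :: (-2 :: (3 :: (q ++ [b, 3, -2, 3, c]))))) :=
    c_low_comm b (by omega) hq [a, 3, -2, 3] [3, -2, 3, c]
  have hr := mid_mixed_zero (D := D) ha hx
  have hl := mixed_mid_zero (D := D) hc hx'
  simp only [List.append_assoc, List.cons_append, List.nil_append] at hl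
  rcases hb with hb | hb
  · rcases hc with hc | hc
    · rcases ha with ha | ha
      · rw [ha, hb, hc]
        exact x_low_mem hq
      · rw [← e, ha, hb]
        exact mem_K_of_zero hl.2
    · rw [hb, hc]
      exact mem_K_of_zero hr.1
  · rcases hc with hc | hc
    · rw [hb, hc]
      exact mem_K_of_zero hr.2
    · rcases ha with ha | ha
      · rw [← e, ha, hb]
        exact mem_K_of_zero hl.1
      · rw [ha, hb, hc]
        exact x_x_neg_mem hq

/-- The expansion of 4x4 is taken on the side that places 3' after w₊, or 3 after w₋. The
cancellation leaves a short gap, except in the terms that are short or contain 43'4. -/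
theorem w_x_zero_of_pos {a : ℤ} (ha : a = 4 ∨ a = -4) :
    D.m [a, 3, 2, -1, 2, 3, 4, 3, -2, 3, 4] = 0 ∧ D.m [a, -3, -2, 1, -2, -3, 4, 3, -2, 3, 4] = 0 :=
        by
  constructor
  · have h : D.m [a, 3, 2, -1, 2, 3, 4, 3, -2, 3, 4] = D.S • D.m [a, 3, 2, -1, 2, 3, 4, 3, -2, 3]
      - D.T • D.m [a, 3, 2, -1, 2, 3, -3, -2, 4, -3, 4, 2, 3]
        + D.U • D.m [a, 3, 2, -1, 2, 3, -3, -2, 4, -3, 2, -3, 4, 3] := D.c_x_right (D.N 2) [a, 3, 2,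
            -1, 2, 3] []
    have z₁ : D.m [a, 3, 2, -1, 2, 3, 4, 3, -2, 3] = 0 := m_zero
        (by rcases ha with rfl | rfl <;> decide)
    have z₂ : D.m [a, 3, 2, -1, 2, 3, -3, -2, 4, -3, 4, 2, 3] = 0 := m_append_zero [2, 3]
        (by decide)
      (peak_zero (l := [3, 2, -1, 2, 3, -3, -2]) ha (by decide))
    have z₃ : D.m [a, 3, 2, -1, 2, 3, -3, -2, 4, -3, 2, -3, 4, 3] = 0 := by
      have e : D.m [a, 3, 2, -1, 2, 3, -3, -2, 4, -3, 2, -3, 4, 3] = D.m [a, 3, 2, -1, 2, -2, 4, -3,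
          2, -3, 4, 3] :=
        D.c_cancel (D.N 2) 3 [a, 3, 2, -1, 2] [-2, 4, -3, 2, -3, 4, 3]
      exact e.trans (m_append_zero [3] (by decide) (short_left (p := []) (d := 3) (q := [2, -1, 2,
          -2])
        (l := [-3, 2, -3]) ha (by simp) (by simp) (by simp) (by decide) (by decide) (by decide)))
    rw [h, z₁, z₂, z₃]
    simp
  · have h : D.m [a, -3, -2, 1, -2, -3, 4, 3, -2, 3, 4] = D.S • D.m [a, -3, -2, 1, -2, -3, 3, -2, 3,
      4] - D.T • D.m [a, -3, -2, 1, -2, -3, 3, 2, 4, -3, 4, -2, -3]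
        + D.U • D.m [a, -3, -2, 1, -2, -3, 3, 4, -3, 2, -3, 4, -2, -3] := D.c_x_left (D.N 2) [a, -3,
            -2, 1, -2, -3] []
    have z₁ : D.m [a, -3, -2, 1, -2, -3, 3, -2, 3, 4] = 0 := m_zero
        (by rcases ha with rfl | rfl <;> decide)
    have z₂ : D.m [a, -3, -2, 1, -2, -3, 3, 2, 4, -3, 4, -2, -3] = 0 := m_append_zero [-2, -3]
        (by decide)
      (peak_zero (l := [-3, -2, 1, -2, -3, 3, 2]) ha (by decide))
    have z₃ : D.m [a, -3, -2, 1, -2, -3, 3, 4, -3, 2, -3, 4, -2, -3] = 0 := by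
      have e : D.m [a, -3, -2, 1, -2, -3, 3, 4, -3, 2, -3, 4, -2, -3] = D.m [a, -3, -2, 1, -2, 4,
          -3, 2, -3, 4, -2, -3] :=
        D.c_cancel' (D.N 2) 3 [a, -3, -2, 1, -2] [4, -3, 2, -3, 4, -2, -3]
      exact e.trans (m_append_zero [-2, -3] (by decide) (short_left (p := []) (d := -3) (q := [-2,
          1, -2])
        (l := [-3, 2, -3]) ha (by simp) (by simp) (by simp) (by decide) (by decide) (by decide)))
    rw [h, z₁, z₂, z₃]
    simp

theorem w_x_zero {a b c : ℤ} (ha : a = 4 ∨ a = -4) (hb : b = 4 ∨ b = -4) (hc : c = 4 ∨ c = -4) :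
    D.m [a, 3, 2, -1, 2, 3, b, 3, -2, 3, c] = 0 ∧ D.m [a, -3, -2, 1, -2, -3, b, 3, -2, 3, c] = 0 :=
        by
  have neg : ∀ {w : List ℤ}, Mid w → D.m (a :: (w ++ [-4, -3, 2, -3, -4])) = 0 →
      D.m (a :: (w ++ [-4, 3, -2, 3, -4])) = 0 := by
    intro w hw h
    have := map_x_inv (right_short (D := D) (a := a) (b := -4) (c := -4) (p := []) (r := [])
        (l := w) ha (by simp) (by simp) (by decide) (by decide) hw) (q := []) (by decide)
    simp only [D.ctx_w, List.cons_append, List.append_assoc, List.nil_append]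
      at this
    exact this.symm.trans ((congrArg (D.U • ·) h).trans (smul_zero _))
  have hbar := w_x_zero_of_pos (D := D.bar) (a := -a) (by omega)
  rcases hb with rfl | rfl <;> rcases hc with rfl | rfl
  · exact w_x_zero_of_pos ha
  · exact ⟨(mid_mixed_zero ha (l := [3, 2, -1, 2, 3]) (by decide)).1, (mid_mixed_zero ha (l := [-3,
      -2, 1, -2, -3]) (by decide)).1⟩
  · exact ⟨(mid_mixed_zero ha (l := [3, 2, -1, 2, 3]) (by decide)).2, (mid_mixed_zero ha (l := [-3,
      -2, 1, -2, -3]) (by decide)).2⟩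
  · exact ⟨neg (w := [3, 2, -1, 2, 3]) (by decide) (by simpa using bar_m_eq_zero D hbar.2),
      neg (w := [-3, -2, 1, -2, -3]) (by decide) (by simpa using bar_m_eq_zero D hbar.1)⟩

theorem mid_x_mem {a b c : ℤ} (ha : a = 4 ∨ a = -4) (hb : b = 4 ∨ b = -4) (hc : c = 4 ∨ c = -4)
    {l p q : List ℤ} (hl : Mid l) (hp : Low p) (hq : Low q) :
    D.m (a :: (l ++ (b :: (p ++ (3 :: (-2 :: (3 :: (q ++ [c])))))))) ∈ D.K := by
  have key : ∀ {l : List ℤ}, Mid l → D.m (a :: (l ++ [b, 3, -2, 3, c])) ∈ D.K := by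
    intro l hl
    refine mid_mem (p := [a]) (q := [b, 3, -2, 3, c]) (fun p' q' d hp hq hd => ?_)
        (fun p' q' hp hq => ?_)
      (mem_K_of_zero (w_x_zero ha hb hc).1) (mem_K_of_zero (w_x_zero ha hb hc).2) hl
    · simpa using short_left (D := D) ha hb hc hd (l := [3, -2, 3]) (by decide) hp hq
    · have e := c_low_comm (D := D) (W := D.N 2) a (by omega) hp [] (3 :: (-2 :: (3 :: (q' ++ [b, 3,
        -2, 3, c]))))
      have h := x_x_mem (D := D) ha hb hc hq
      have h' := ctx_of_mem h hp.mid (q := []) (by decide)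
      simp only [List.append_assoc, List.cons_append, List.nil_append, List.append_nil] at e h' ⊢
      exact mem_K_congr (e.trans h') h
  have h := key (hl.append hp.mid)
  have h' := ctx_of_mem h (p := []) (by decide) hq.mid
  have e₁ := c_low_comm (D := D) (W := D.N 2) b (by omega) hp (a :: l)
      (3 :: (-2 :: (3 :: (q ++ [c]))))
  have e₂ := c_low_comm (D := D) (W := D.N 2) c (by omega) hq (a :: (l ++ (p ++ [b, 3, -2, 3]))) []
  simp only [List.append_assoc, List.cons_append, List.nil_append, List.append_nil] at e₁ e₂ h h'
  exact mem_K_congr (e₁.trans (e₂.symm.trans h')) h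

theorem x_mid_mem {a b c : ℤ} (ha : a = 4 ∨ a = -4) (hb : b = 4 ∨ b = -4) (hc : c = 4 ∨ c = -4)
    {l p q : List ℤ} (hl : Mid l) (hp : Low p) (hq : Low q) :
    D.m (a :: (p ++ (3 :: (-2 :: (3 :: (q ++ (b :: (l ++ [c])))))))) ∈ D.K := by
  have := mem_K_of_op (mid_x_mem (D := D.op) hc hb ha hl.reverse hq.reverse hp.reverse)
  simpa using this

/-- Inverting the first peak multiplies by a power of 3 and by V; both preserve the line. -/
theorem peak_inv_peak_mem {l : List ℤ} (hl : Mid l) (h : D.m (4 :: (-3 :: (4 :: (l ++ [4, -3,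
    4])))) ∈ D.K) :
    D.m (-4 :: (3 :: (-4 :: (l ++ [4, -3, 4])))) ∈ D.K := by
  have h₁ : D.m (-3 :: (-4 :: (3 :: (-4 :: (l ++ [4, -3, 4]))))) = D.V • D.m
      (4 :: (-3 :: (4 :: (l ++ [4, -3, 4])))) := by
    have := congrArg D.rev (peak_mul_peak_inv (D := D.op) hl.reverse)
    rw [map_smul, rev_m, rev_m] at this
    have hV : D.op.V = D.V := rfl
    simpa [hV] using this
  have h₂ := mem_K_congr_smul h₁ h
  have h₃ := ctx_of_mem h₂ (p := [3]) (q := []) (by decide) (by decide)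
  have e := D.c_cancel (D.N 2) 3 [] (-4 :: (3 :: (-4 :: (l ++ [4, -3, 4]))))
  simp only [List.append_nil, List.cons_append, List.nil_append] at e h₃
  exact mem_K_congr (e.symm.trans h₃) h₂

/-- After expansion of the central 34'3, the surviving term is a braid whose gaps are products of x
with words in 1 and 2, so `mid_x_mem` applies. -/
theorem wPlus_inv_mem {a : ℤ} (ha : a = 4 ∨ a = -4) : D.m [a, 3, 2, -1, 2, 3, -4, 3, 2, -1, 2, 3, 4]
    ∈ D.K := by
  have h : D.m [a, 3, 2, -1, 2, 3, -4, 3, 2, -1, 2, 3, 4] = D.U • D.m [a, 3, 2, -1, 2, -3, 4, -3,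
      -4, 2, -1, 2, 3, 4] + D.S • D.m [a, 3, 2, -1, 2, -4, 3, 2, -1, 2, 3, 4]
      - D.T • D.m [a, 3, 2, -1, 2, 4, -3, -4, 2, -1, 2, 3, 4] := D.c_cube_right (D.N 2) 4 3
          (by decide) [a, 3, 2, -1, 2] [2, -1, 2, 3, 4]
  have z₁ : D.m [a, 3, 2, -1, 2, -4, 3, 2, -1, 2, 3, 4] = 0 := short_left (p := []) (d := 3) (q :=
      [2, -1, 2]) (l := [3, 2, -1, 2, 3])
    ha (by simp) (by simp) (by simp) (by decide) (by decide) (by decide)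
  have z₂ : D.m [a, 3, 2, -1, 2, 4, -3, -4, 2, -1, 2, 3, 4] = 0 := by
    rcases ha with rfl | rfl
    · exact ((c_eq (l' := [3, 4, 3, 2, -1, 2, -3, 2, -1, 2, 3, 4, -3]) [4, 3, 2, 0, 7, 8, 9,
        10] [] (by decide)).trans 
      (m_zero (by decide)))
    · exact ((c_eq (l' := [3, 4, -3, 2, -1, 2, -3, 2, -1, 2, 3, 4, -3]) [4, 3, 2, 0, 7, 8, 9,
        10] [] (by decide)).trans 
      (m_zero (by decide)))
  have h₁ : D.m [a, -2, -1, 3, -2, 3, 1, 2, 4, 2, 1, 3, -2, 3, -1, -2, 4] ∈ D.K := mid_x_mem (l :=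
      [-2, -1, 3, -2, 3, 1, 2]) (p := [2, 1])
    (q := [-1, -2]) ha (by simp) (by simp) (by decide) (by decide) (by decide)
  have h₂ := ctx_of_mem h₁ (p := []) (q := [-3]) (by decide) (by decide)
  have e : D.m [a, 3, 2, -1, 2, -3, 4, -3, -4, 2, -1, 2, 3, 4] = D.m [a, -2, -1, 3, -2, 3, 1, 2, 4,
      2, 1, 3, -2, 3, -1, -2, 4, -3] := by
    rcases ha with rfl | rfl
    · exact c_eq [8, 9, 10, 11] [2, 5, 3, 1, 3, 4, 6, 8, 11, 9, 7, 9, 10, 12] (by decide)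
    · exact c_eq [8, 9, 10, 11] [2, 5, 3, 1, 3, 4, 6, 8, 11, 9, 7, 9, 10, 12] (by decide)
  have h₃ : D.m [a, 3, 2, -1, 2, -3, 4, -3, -4, 2, -1, 2, 3, 4] ∈ D.K := mem_K_congr (e.trans h₂) h₁
  rw [h, z₁, z₂, smul_zero, smul_zero, add_zero, sub_zero]
  exact D.K.smul_mem _ h₃

/-- For b = 4, the relation 343 = 434 and commutations bring new letters 4 next to a 3 and c, and
further braid relations leave only two letters 4^±. For b = 4' the cases are `wPlus_inv_mem`, its
reversal and `zPlus_eq`. -/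
theorem wPlus_wPlus_mem {a b c : ℤ} (ha : a = 4 ∨ a = -4) (hb : b = 4 ∨ b = -4)
    (hc : c = 4 ∨ c = -4) : D.m [a, 3, 2, -1, 2, 3, b, 3, 2, -1, 2, 3, c] ∈ D.K := by
  rcases hb with rfl | rfl
  · refine mem_K_of_zero ?_
    rcases ha with rfl | rfl <;> rcases hc with rfl | rfl
    · exact ((c_eq (l' := [3, 4, 3, 2, -1, 2, 3, 2, -1, 2, 3, 4, 3]) [5, 4, 3, 2, 0, 7, 8, 9,
        10] [] (by decide)).trans 
      (m_zero (by decide)))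
    · exact ((c_eq (l' := [3, 4, 3, 2, -1, 2, 3, 2, -1, 2, -3, 4, 3]) [5, 4, 3, 2, 0, 7, 8, 9,
        10] [] (by decide)).trans 
      (m_zero (by decide)))
    · exact ((c_eq (l' := [3, 4, -3, 2, -1, 2, 3, 2, -1, 2, 3, 4, 3]) [5, 4, 3, 2, 0, 7, 8, 9,
        10] [] (by decide)).trans 
      (m_zero (by decide)))
    · exact ((c_eq (l' := [3, 4, -3, 2, -1, 2, 3, 2, -1, 2, -3, 4, 3]) [5, 4, 3, 2, 0, 7, 8, 9,
        10] [] (by decide)).trans 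
      (m_zero (by decide)))
  · rcases hc with rfl | rfl
    · exact wPlus_inv_mem ha
    · rcases ha with rfl | rfl
      · exact mem_K_of_op (wPlus_inv_mem (D := D.op) (a := -4) (by simp))
      · rw [zPlus_eq]
        exact D.K.neg_mem (D.K.smul_mem _ z_mem_K)

/-- The central 3b3' equals 4'3^±4, and its outer letters commute with 21'2 and 2'12'. The word
becomes a34'·21'2·3^±·2'12'·43'c. Unless a = 4' and c = 4, one end simplifies and the product
vanishes; otherwise it is evaluated by `peak_v_three_v'`. -/
theorem wPlus_wMinus_mem {a b c : ℤ} (ha : a = 4 ∨ a = -4) (hb : b = 4 ∨ b = -4)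
    (hc : c = 4 ∨ c = -4) : D.m [a, 3, 2, -1, 2, 3, b, -3, -2, 1, -2, -3, c] ∈ D.K := by
  have key : ∀ {t}, t ∈ D.K → ∀ r : k, r • t ∈ D.K := fun h r => D.K.smul_mem r h
  have k₁ : D.m [-4, 3, -4, 2, -1, 2, 3, -2, 1, -2, 4, -3, 4] ∈ D.K := by
    refine peak_inv_peak_mem (l := [2, -1, 2, 3, -2, 1, -2]) (by decide) ?_
    have h := peak_v_three_v' (D := D) (d := 3) (by simp)
    refine mem_K_congr_smul h ?_
    exact mem_K_congr (ctx_of_mem (l := [4, -3, 4, 2, -1, 2, 3, 2, -1, 2, 4, -3, 4]) (p := []) (q :=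
        [1]) (by
      rw [peak_v_three_v]
      exact key z_mem_K _) (by decide) (by decide)) (by
      rw [peak_v_three_v]
      exact key z_mem_K _)
  have k₂ : D.m [-4, 3, -4, 2, -1, 2, -3, -2, 1, -2, 4, -3, 4] ∈ D.K := by
    refine peak_inv_peak_mem (l := [2, -1, 2, -3, -2, 1, -2]) (by decide) ?_
    have h := peak_v_three_v' (D := D) (d := -3) (by simp)
    refine mem_K_congr_smul h ?_
    exact mem_K_congr (ctx_of_mem (l := [4, -3, 4, 2, -1, 2, -3, 2, -1, 2, 4, -3, 4]) (p :=
        []) (q := [1]) (by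
      rw [peak_v_three_inv_v]
      exact key z_mem_K _) (by decide) (by decide)) (by
      rw [peak_v_three_inv_v]
      exact key z_mem_K _)
  rcases ha with rfl | rfl <;> rcases hb with rfl | rfl <;> rcases hc with rfl | rfl
  · exact mem_K_of_zero ((c_eq (l' := [-3, 4, 3, 2, -1, 2, 3, -2, 1, -2, 4, -3, 4]) [5, 4, 3, 2, 0,
      7, 8, 9] [] (by decide)).trans 
      (m_prepend_zero [-3] (by decide) (peak_zero (a := 4) (l := [3, 2, -1, 2, 3, -2, 1,
          -2]) (by simp) (by decide))))
  · exact mem_K_of_zero ((c_eq (l' := [-3, 4, 3, 2, -1, 2, 3, -2, 1, -2, -3, -4, 3]) [5, 4, 3, 2, 0,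
      7, 8, 9, 10] [] (by decide)).trans 
      (m_zero (by decide)))
  · exact mem_K_of_zero ((c_eq (l' := [-3, 4, 3, 2, -1, 2, -3, -2, 1, -2, 4, -3, 4]) [5, 4, 3, 2, 0,
      7, 8, 9] [] (by decide)).trans 
      (m_prepend_zero [-3] (by decide) (peak_zero (a := 4) (l := [3, 2, -1, 2, -3, -2, 1,
          -2]) (by simp) (by decide))))
  · exact mem_K_of_zero ((c_eq (l' := [-3, 4, 3, 2, -1, 2, -3, -2, 1, -2, -3, -4, 3]) [5, 4, 3, 2,
      0, 7, 8, 9, 10] [] (by decide)).trans 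
      (m_zero (by decide)))
  · exact mem_K_congr (c_eq [5, 4, 3, 2] [9, 8, 7] (by decide)) k₁
  · exact mem_K_of_zero ((c_eq (l' := [-4, 3, -4, 2, -1, 2, 3, -2, 1, -2, -3, -4, 3]) [5, 4, 3, 2,
      7, 8, 9, 10] [] (by decide)).trans 
      (m_append_zero [3] (by decide) (peak_inv_zero_rev (a := -4) (l := [2, -1, 2, 3, -2, 1, -2,
          -3]) (by simp) (by decide))))
  · exact mem_K_congr (c_eq [5, 4, 3, 2] [9, 8, 7] (by decide)) k₂
  · exact mem_K_of_zero ((c_eq (l' := [-4, 3, -4, 2, -1, 2, -3, -2, 1, -2, -3, -4, 3]) [5, 4, 3, 2,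
      7, 8, 9, 10] [] (by decide)).trans 
      (m_append_zero [3] (by decide) (peak_inv_zero_rev (a := -4) (l := [2, -1, 2, -3, -2, 1, -2,
          -3]) (by simp) (by decide))))

theorem mid_w_mem {a b c : ℤ} (ha : a = 4 ∨ a = -4) (hb : b = 4 ∨ b = -4)
    (hc : c = 4 ∨ c = -4) {l : List ℤ} (hl : Mid l) :
    D.m (a :: (l ++ [b, 3, 2, -1, 2, 3, c])) ∈ D.K ∧ D.m (a :: (l ++ [b, -3, -2, 1, -2, -3, c]))
        ∈ D.K := by
  constructor
  · refine mid_mem (p := [a]) (q := [b, 3, 2, -1, 2, 3, c]) (fun p' q' d hp hq hd => ?_)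
      (fun p' q' hp hq => ?_) (wPlus_wPlus_mem ha hb hc) ?_ hl
    · simpa using short_left (D := D) ha hb hc hd (l := [3, 2, -1, 2, 3]) (by decide) hp hq
    · simpa using x_mid_mem (D := D) ha hb hc (l := [3, 2, -1, 2, 3]) (by decide) hp hq
    · exact mem_K_of_op (wPlus_wMinus_mem (D := D.op) hc hb ha)
  · refine mid_mem (p := [a]) (q := [b, -3, -2, 1, -2, -3, c]) (fun p' q' d hp hq hd => ?_)
      (fun p' q' hp hq => ?_) (wPlus_wMinus_mem ha hb hc) ?_ hl
    · simpa using short_left (D := D) ha hb hc hd (l := [-3, -2, 1, -2, -3]) (by decide) hp hq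
    · simpa using x_mid_mem (D := D) ha hb hc (l := [-3, -2, 1, -2, -3]) (by decide) hp hq
    · have := mem_K_of_bar (wPlus_wPlus_mem (D := D.bar) (a := -a) (b := -b) (c := -c)
        (by omega) (by omega) (by omega))
      simpa using this

/-- All products with three factors `4^±` are multiples of `4xy4x4`, modulo shorter products. -/
theorem mid_mid_mem {a b c : ℤ} (ha : a = 4 ∨ a = -4) (hb : b = 4 ∨ b = -4)
    (hc : c = 4 ∨ c = -4) {l l' : List ℤ} (hl : Mid l) (hl' : Mid l') :
    D.m (a :: (l ++ (b :: (l' ++ [c])))) ∈ D.K := by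
  have := mid_mem (D := D) (p := a :: (l ++ [b])) (q := [c]) (fun p' q' d hp hq hd => ?_)
    (fun p' q' hp hq => ?_) ?_ ?_ hl'
  · simpa using this
  · simpa using short_right (D := D) ha hb hc hd hl hp hq
  · simpa using mid_x_mem (D := D) ha hb hc hl hp hq
  · simpa using (mid_w_mem (D := D) ha hb hc hl).1
  · simpa using (mid_w_mem (D := D) ha hb hc hl).2

end CubicSys

/-! ### The generators of `Q_5` -/

/-- The relation of the cubic quotient between two adjacent generators. -/
def ThreeRel {A : Type} [Ring A] (s t : Aˣ) : Prop :=
  (↑(s⁻¹ * t * s) : A) = ↑(s * t * s⁻¹) - ↑(s * t) + ↑(s * t⁻¹) + ↑(s⁻¹ * t) - ↑(s⁻¹ * t⁻¹)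
    + ↑(t * s) - ↑(t * s⁻¹) - ↑(t⁻¹ * s) + ↑(t⁻¹ * s⁻¹) + ↑(s⁻¹ * t⁻¹ * s) - ↑(s * t⁻¹ * s⁻¹)

theorem ThreeRel.conj {A : Type} [Ring A] {s t : Aˣ} (h : ThreeRel s t) (p : Aˣ) :
    ThreeRel (p * s * p⁻¹) (p * t * p⁻¹) := by
  have := congrArg (fun z : A => ↑p * z * ↑p⁻¹) h
  unfold ThreeRel
  simpa [mul_add, add_mul, mul_sub, sub_mul, mul_assoc] using this

namespace BraidSys

variable {A : Type} [Ring A] (D : BraidSys A)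

theorem u_conj {p : List ℤ} {i j : ℤ} (v : Aˣ) (hv : (v : A) = D.w p)
    (h : D.w (p ++ [i]) = D.w (j :: p)) : v * D.u i * v⁻¹ = D.u j := by
  rw [mul_inv_eq_iff_eq_mul]
  refine Units.ext ?_
  rw [D.w_append, D.w_cons, D.w_cons, D.w_nil, mul_one] at h
  rw [Units.val_mul, Units.val_mul, hv]
  exact h

/-- The relation imposed for (1, 2) propagates by conjugation: 121 exchanges 1 and 2, and 1234
shifts indices by one. -/
theorem threeRel (h : ThreeRel (D.u 1) (D.u 2)) (i j : ℤ) (hij : Adj i j) :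
    ThreeRel (D.u i) (D.u j) := by
  have conj : ∀ (v : Aˣ) (p : List ℤ) (hv : (v : A) = D.w p) (i j i' j' : ℤ)
      (_ : ThreeRel (D.u i) (D.u j)) (_ : D.w (p ++ [i]) = D.w (i' :: p))
      (_ : D.w (p ++ [j]) = D.w (j' :: p)), ThreeRel (D.u i') (D.u j') := by
    intro v p hv i j i' j' h h₁ h₂
    have := h.conj v
    rwa [D.u_conj v hv h₁, D.u_conj v hv h₂] at this
  have swap := conj (D.u 1 * D.u 2 * D.u 1) [1, 2, 1] (by simp [D.w_cons, u, mul_assoc])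
  have shift := conj (D.u 1 * D.u 2 * D.u 3 * D.u 4) [1, 2, 3, 4] (by
    simp [D.w_cons, u, mul_assoc])
  have h₂₁ : ThreeRel (D.u 2) (D.u 1) := swap 1 2 2 1 h (D.w_eq [0] [] (by decide))
    (D.w_eq [1] [] (by decide))
  have e₁ : D.w ([1, 2, 3, 4] ++ [1]) = D.w (2 :: [1, 2, 3, 4]) :=
    D.w_eq [3, 2] [0] (by decide)
  have e₂ : D.w ([1, 2, 3, 4] ++ [2]) = D.w (3 :: [1, 2, 3, 4]) :=
    D.w_eq [3, 1] [0] (by decide)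
  have e₃ : D.w ([1, 2, 3, 4] ++ [3]) = D.w (4 :: [1, 2, 3, 4]) :=
    D.w_eq [2, 1] [0] (by decide)
  have h₂₃ := shift 1 2 2 3 h e₁ e₂
  have h₃₂ := shift 2 1 3 2 h₂₁ e₂ e₁
  rcases hij with ⟨rfl, rfl⟩ | ⟨rfl, rfl⟩ | ⟨rfl, rfl⟩ | ⟨rfl, rfl⟩ | ⟨rfl, rfl⟩ | ⟨rfl, rfl⟩
  · exact h
  · exact h₂₁
  · exact h₂₃
  · exact h₃₂
  · exact shift 2 3 3 4 h₂₃ e₂ e₃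
  · exact shift 3 2 4 3 h₃₂ e₃ e₂

end BraidSys

/-- The braid of a letter. -/
noncomputable def letter (i : ℤ) : Braid 5 :=
  -- Letters that are not generators give the trivial braid, so a word with `count4 l = 0` comes
  -- from four strands even if it contains such letters.
  if h : 1 ≤ i.natAbs ∧ i.natAbs < 5 then sigma 5 i.natAbs h ^ i.sign else 1

theorem letter_neg (i : ℤ) : letter (-i) = (letter i)⁻¹ := by
  unfold letter
  by_cases h : 1 ≤ i.natAbs ∧ i.natAbs < 5
  · rw [dif_pos h, dif_pos (by simpa using h), Int.sign_neg, zpow_neg]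
    simp only [Int.natAbs_neg]
  · rw [dif_neg h, dif_neg (by simpa using h), inv_one]

theorem letter_natCast (i : ℕ) (h : 1 ≤ i ∧ i < 5) : letter i = sigma 5 i h := by
  unfold letter
  rw [dif_pos (by simpa using h), Int.sign_eq_one_of_pos (by omega), zpow_one]
  rfl

/-- The braid of a word. -/
noncomputable def braidWord (l : List ℤ) : Braid 5 := (l.map letter).prod

/-- The representation of `B_5` in `Q_5`, divided by the character `s_i ↦ a`. -/
noncomputable def nbr : Braid 5 →* QR 5 where
  toFun g := (((braidChar (var 0) 5 g)⁻¹ : Rˣ) : R) • brR g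
  map_one' := by simp
  map_mul' g h := by
    rw [map_mul, map_mul, mul_inv, Units.val_mul, smul_mul_smul_comm]

theorem nbr_apply (g : Braid 5) : nbr g = (((braidChar (var 0) 5 g)⁻¹ : Rˣ) : R) • brR g := rfl

theorem brR_eq (g : Braid 5) : brR g = ((braidChar (var 0) 5 g : Rˣ) : R) • nbr g := by
  rw [nbr_apply, smul_smul, Units.mul_inv, one_smul]

theorem braidChar_sigma (n i : ℕ) (h : 1 ≤ i ∧ i < n) (a : Rˣ) :
    braidChar a n (sigma n i h) = a := braidLift_sigma _ _ _ i h

/-- The normalized generators of `Q_5`. -/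
noncomputable def braidSys : BraidSys (QR 5) where
  f i := nbr (letter i)
  f_zero := by
    have : letter 0 = 1 := dif_neg (by simp)
    rw [this, map_one]
  f_inv i := by rw [← map_mul, letter_neg, mul_inv_cancel, map_one]
  f_comm i j h₁ h₂ h₃ := by
    lift i to ℕ using by omega
    lift j to ℕ using by omega
    rw [← map_mul, ← map_mul, letter_natCast i (by omega), letter_natCast j (by omega),
      sigma_comm 5 ⟨i, by omega⟩ ⟨j, by omega⟩ (by dsimp only; omega)]
  f_braid i h₁ h₂ := by
    lift i to ℕ using by omega
    have e : letter ((i : ℤ) + 1) = sigma 5 (i + 1) (by omega) :=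
      letter_natCast (i + 1) (by omega)
    simp only [← map_mul]
    rw [letter_natCast i (by omega), e, sigma_braid 5 ⟨i, by omega⟩ ⟨i + 1, by omega⟩ rfl]

theorem braidSys_w (l : List ℤ) : braidSys.w l = nbr (braidWord l) := by
  rw [braidWord, map_list_prod, List.map_map]
  rfl

theorem braidSys_threeRel : ThreeRel (braidSys.u 1) (braidSys.u 2) := by
  have h := RingQuot.mkAlgHom_rel R (QRel.threeStrand (a := var 0) (b := var 1) (c := var 2)
    (n := 5) (by norm_num) (sigma 5 1) (sigma 5 2) rfl rfl)
  simp only [bas, map_add, map_sub, map_smul, mk_of] at h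
  have e₁ : braidSys.u 1 = nbr.toHomUnits (sigma 5 1) :=
    Units.ext (congrArg nbr (letter_natCast 1 (by norm_num)))
  have e₂ : braidSys.u 2 = nbr.toHomUnits (sigma 5 2) :=
    Units.ext (congrArg nbr (letter_natCast 2 (by norm_num)))
  -- The left side of the relation has degree 1, hence the factor a⁻¹. Every power of a on the right
  -- side then matches the degree of its braid.
  have h' := congrArg ((((var 0)⁻¹ : Rˣ) : R) • ·) h
  simp only [smul_add, smul_sub, smul_smul, ← Units.val_mul, ← Units.val_pow_eq_pow_val] at h'
  unfold ThreeRel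
  rw [e₁, e₂]
  simp only [← map_mul, ← map_inv, MonoidHom.coe_toHomUnits, nbr_apply]
  simp only [map_mul, map_inv, braidChar_sigma] at h' ⊢
  have u₁ : ∀ a : Rˣ, (a⁻¹ * a * a)⁻¹ = a⁻¹ := fun a => by group
  have u₂ : ∀ a : Rˣ, (a * a * a⁻¹)⁻¹ = a⁻¹ := fun a => by group
  have u₃ : ∀ a : Rˣ, (a⁻¹ * a⁻¹ * a)⁻¹ = a⁻¹ * a ^ 2 := fun a => by group
  have u₄ : ∀ a : Rˣ, (a * a⁻¹ * a⁻¹)⁻¹ = a⁻¹ * a ^ 2 := fun a => by group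
  have u₅ : ∀ a : Rˣ, (a⁻¹ * a⁻¹)⁻¹ = a⁻¹ * a ^ 3 := fun a => by group
  have u₆ : ∀ a : Rˣ, (a * a⁻¹)⁻¹ = a⁻¹ * a := fun a => by group
  have u₇ : ∀ a : Rˣ, (a⁻¹ * a)⁻¹ = a⁻¹ * a := fun a => by group
  have u₈ : ∀ a : Rˣ, (a * a)⁻¹ = a⁻¹ * a⁻¹ := fun a => by group
  rw [u₁, u₂, u₃, u₄, u₅, u₆, u₇, u₈]
  exact h'

/-- Here b and c denote the roots already divided by a. The powers of a factor out, and the relation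
is multiplied by the square of the inverse. -/
theorem cubic_normalized {k A : Type} [CommRing k] [Ring A] [Algebra k A] (a : kˣ) (b c : k)
    {t t' : A} (ht : t * t' = 1)
    (h : ((a : k) • t - algebraMap k A a) * ((a : k) • t - algebraMap k A (b * a)) *
      ((a : k) • t - algebraMap k A (c * a)) = 0) :
    t = (1 + b + c) • (1 : A) - (b + c + b * c) • t' + (b * c) • (t' * t') := by
  have e : ∀ r : k, (a : k) • t - algebraMap k A (r * a) = (a : k) • (t - r • 1) := fun r => by
    rw [smul_sub, smul_smul, Algebra.algebraMap_eq_smul_one, mul_comm]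
  have e₁ : (a : k) • t - algebraMap k A a = (a : k) • (t - 1) := by
    simpa using e 1
  rw [e₁, e, e, smul_mul_smul_comm, smul_mul_smul_comm, ← Units.val_mul, ← Units.val_mul] at h
  have h₁ : (t - 1) * (t - b • 1) * (t - c • 1) = 0 := by
    have := congrArg ((((a * a * a)⁻¹ : kˣ) : k) • ·) h
    simpa only [smul_smul, Units.inv_mul, one_smul, smul_zero] using this
  have h₂ := congrArg (· * (t' * t')) h₁
  have e₂ : t * (t' * t') = t' := by rw [← mul_assoc, ht, one_mul]
  simp only [sub_mul, mul_sub, mul_one, one_mul, mul_assoc, smul_mul_assoc, mul_smul_comm,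
    e₂, ht, zero_mul] at h₂
  linear_combination (norm := module) h₂

/-- The cubic system of `Q_5`. -/
noncomputable def cubicSys : CubicSys R (QR 5) where
  toBraidSys := braidSys
  S := 1 + ↑(var 1 * (var 0)⁻¹) + ↑(var 2 * (var 0)⁻¹)
  T := ↑(var 1 * (var 0)⁻¹) + ↑(var 2 * (var 0)⁻¹) + ↑(var 1 * (var 0)⁻¹ * (var 2 * (var 0)⁻¹))
  U := ↑(var 1 * (var 0)⁻¹ * (var 2 * (var 0)⁻¹))
  V := ↑(var 1 * (var 0)⁻¹ * (var 2 * (var 0)⁻¹))⁻¹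
  UV := Units.mul_inv _
  cubic i h₁ h₂ := by
    lift i to ℕ using by omega
    have h := RingQuot.mkAlgHom_rel R (QRel.cubic (a := var 0) (b := var 1) (c := var 2)
      (n := 5) ⟨i, by omega⟩)
    simp only [bas, map_mul, map_sub, map_zero, AlgHom.commutes, mk_of] at h
    have e : brR (sigma 5 i (by omega)) = ((var 0 : Rˣ) : R) • braidSys.f i := by
      rw [brR_eq, braidChar_sigma]
      exact congrArg _ (congrArg nbr (letter_natCast i (by omega)).symm)
    have e₁ : ∀ r : Rˣ, (r : R) = ↑(r * (var 0)⁻¹) * ↑(var 0) := fun r => by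
      rw [← Units.val_mul, inv_mul_cancel_right]
    rw [e, e₁ (var 1), e₁ (var 2)] at h
    rw [Units.val_mul (var 1 * (var 0)⁻¹)]
    exact cubic_normalized _ _ _ (braidSys.f_inv i) h
  three i j hij := by
    have h := braidSys.threeRel braidSys_threeRel i j hij
    have e : ∀ a, (braidSys.u a : QR 5) = braidSys.f a := fun _ => rfl
    simpa only [ThreeRel, BraidSys.w_cons, BraidSys.w_nil, mul_one, Units.val_mul, ← BraidSys.u_neg,
      ← mul_assoc, e] using h

/-! ### Words and the filtration of `Q_5` -/

theorem cubicSys_w (l : List ℤ) : cubicSys.w l = nbr (braidWord l) := braidSys_w l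

theorem braidWord_cons (a : ℤ) (l : List ℤ) : braidWord (a :: l) = letter a * braidWord l := by
  simp [braidWord]

theorem braidWord_append (l l' : List ℤ) :
    braidWord (l ++ l') = braidWord l * braidWord l' := by
  simp [braidWord]

theorem exists_braidWord_inv {l : List ℤ} (hl : Mid l) :
    ∃ l', Mid l' ∧ braidWord l' = (braidWord l)⁻¹ := by
  induction l with
  | nil => exact ⟨[], by decide, by simp [braidWord]⟩
  | cons a l ih =>
    obtain ⟨l', h, e⟩ := ih fun b hb => hl b (List.mem_cons_of_mem _ hb)
    refine ⟨l' ++ [-a], h.append (Mid.cons (by simpa using hl a (by simp)) (by decide)), ?_⟩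
    rw [braidWord_append, e, braidWord_cons, braidWord_cons, letter_neg, mul_inv_rev]
    simp [braidWord]

theorem exists_braidWord (g : Braid 4) : ∃ l, Mid l ∧ braidWord l = braidIncl 4 g := by
  have hg : g ∈ Subgroup.closure (Set.range (PresentedGroup.of (rels := {r | ArtinRel 4 r}))) := by
    rw [PresentedGroup.closure_range_of]
    trivial
  induction hg using Subgroup.closure_induction with
  | mem x hx =>
    obtain ⟨i, rfl⟩ := hx
    refine ⟨[(i.1 : ℤ)], ?_, ?_⟩
    · have := i.2
      intro a ha
      rw [List.mem_singleton.1 ha, Int.natAbs_natCast]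
      omega
    · rw [braidWord_cons, letter_natCast i.1 ⟨i.2.1, by omega⟩]
      have := braidIncl_sigma 4 i.1 i.2
      unfold sigma at this
      rw [this]
      simp [braidWord]
      rfl
  | one => exact ⟨[], by decide, by simp [braidWord]⟩
  | mul x y _ _ hx hy =>
    obtain ⟨l, hl, e⟩ := hx
    obtain ⟨l', hl', e'⟩ := hy
    exact ⟨l ++ l', hl.append hl', by rw [braidWord_append, e, e', map_mul]⟩
  | inv x _ hx =>
    obtain ⟨l, hl, e⟩ := hx
    obtain ⟨l', hl', e'⟩ := exists_braidWord_inv hl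
    exact ⟨l', hl', by rw [e', e, map_inv]⟩

theorem exists_braidIncl {l : List ℤ} (hl : count4 l = 0) :
    ∃ g : Braid 4, braidIncl 4 g = braidWord l := by
  induction l with
  | nil => exact ⟨1, by simp [braidWord]⟩
  | cons a l ih =>
    rw [count4_cons] at hl
    have ha : a.natAbs ≠ 4 := fun h => by simp [h] at hl
    obtain ⟨g, hg⟩ := ih (by omega)
    have : ∃ g : Braid 4, braidIncl 4 g = letter a := by
      unfold letter
      by_cases h : 1 ≤ a.natAbs ∧ a.natAbs < 5
      · refine ⟨sigma 4 a.natAbs ⟨h.1, by omega⟩ ^ a.sign, ?_⟩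
        rw [dif_pos h, map_zpow, braidIncl_sigma]
      · exact ⟨1, by rw [dif_neg h, map_one]⟩
    obtain ⟨g', hg'⟩ := this
    exact ⟨g' * g, by rw [map_mul, hg, hg', braidWord_cons]⟩

theorem exists_mid {l : List ℤ} (hl : count4 l = 0) :
    ∃ l', Mid l' ∧ cubicSys.w l = cubicSys.w l' := by
  obtain ⟨g, hg⟩ := exists_braidIncl hl
  obtain ⟨l', h, e⟩ := exists_braidWord g
  exact ⟨l', h, by rw [cubicSys_w, cubicSys_w, e, hg]⟩

theorem braidChar_braidIncl (g : Braid 4) :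
    braidChar (var 0) 5 (braidIncl 4 g) = braidChar (var 0) 4 g := by
  have : (braidChar (var 0) 5).comp (braidIncl 4) = braidChar (var 0) 4 := by
    refine PresentedGroup.ext fun i => ?_
    have h₁ := braidIncl_sigma 4 i.1 i.2
    have h₂ := braidChar_sigma 4 i.1 i.2 (var 0)
    unfold sigma at h₁ h₂
    rw [MonoidHom.comp_apply, h₁, h₂]
    exact braidChar_sigma _ _ _ _
  exact DFunLike.congr_fun this g

/-- The image of a braid on four strands. -/
theorem exists_incl4_brR (g : Braid 4) :
    ∃ l, Mid l ∧ incl4 (brR g) = eps4 (brR g) • cubicSys.w l := by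
  obtain ⟨l, hl, e⟩ := exists_braidWord g
  refine ⟨l, hl, ?_⟩
  have h : eps4 (brR g) = ((braidChar (var 0) 4 g : Rˣ) : R) := by simp [eps, br]
  rw [incl_br, h, cubicSys_w, e, brR_eq, braidChar_braidIncl]

theorem span_range_brR (n : ℕ) : Submodule.span R (Set.range (brR : Braid n → QR n)) = ⊤ := by
  refine eq_top_iff.2 fun x _ => ?_
  obtain ⟨y, rfl⟩ := RingQuot.mkAlgHom_surjective R (QRel (var 0) (var 1) (var 2) n) x
  induction y using MonoidAlgebra.induction_on with
  | of g => exact Submodule.subset_span ⟨g, rfl⟩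
  | add x y hx hy =>
    rw [map_add]
    exact Submodule.add_mem _ (hx trivial) (hy trivial)
  | smul r x hx =>
    rw [map_smul]
    exact Submodule.smul_mem _ r (hx trivial)

theorem imSub_eq : imSub (var 0) (var 1) (var 2) 4 = cubicSys.N 0 := by
  refine le_antisymm ?_ (Submodule.span_le.2 ?_)
  · rintro _ ⟨x, rfl⟩
    have hx : x ∈ Submodule.span R (Set.range (brR : Braid 4 → QR 4)) := by
      rw [span_range_brR]
      trivial
    induction hx using Submodule.span_induction with
    | mem x h =>
      obtain ⟨g, rfl⟩ := h
      obtain ⟨l, hl, e⟩ := exists_incl4_brR g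
      change incl4 (brR g) ∈ _
      rw [e]
      exact Submodule.smul_mem _ _ (cubicSys.w_mem_N hl.count4.le)
    | zero => simp
    | add x y _ _ hx hy =>
      rw [map_add]
      exact Submodule.add_mem _ hx hy
    | smul r x _ hx =>
      rw [map_smul]
      exact Submodule.smul_mem _ r hx
  · rintro _ ⟨l, hl, rfl⟩
    obtain ⟨g, hg⟩ := exists_braidIncl (Nat.le_zero.1 hl)
    rw [cubicSys_w, ← hg, nbr_apply, ← incl_br, ← map_smul]
    exact ⟨_, rfl⟩

namespace CubicSys

variable {k A : Type} [CommRing k] [Ring A] [Algebra k A] {D : CubicSys k A}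

theorem N_mul_N_le (m n : ℕ) : D.N m * D.N n ≤ D.N (m + n) := by
  unfold N
  rw [Submodule.span_mul_span]
  refine Submodule.span_le.2 ?_
  rintro _ ⟨_, ⟨l, hl, rfl⟩, _, ⟨l', hl', rfl⟩, rfl⟩
  change D.w l * D.w l' ∈ _
  rw [← D.w_append]
  exact D.w_mem_N (by rw [count4_append]; omega)

theorem N_mono {m n : ℕ} (h : m ≤ n) : D.N m ≤ D.N n := by
  refine Submodule.span_mono ?_
  rintro _ ⟨l, hl, rfl⟩
  exact ⟨l, hl.trans h, rfl⟩

variable (D)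

/-- Isolate the last letter `4^±` of a word. -/
theorem exists_last (n : ℕ) (l : List ℤ) (hl : count4 l ≤ n + 1) : ∃ p b q,
    (b = 0 ∨ b = 4 ∨ b = -4) ∧ count4 p ≤ n ∧ count4 q = 0 ∧ D.w l = D.w p * (D.f b * D.w q) := by
  induction l using List.reverseRecOn with
  | nil => exact ⟨[], 0, [], by simp, by simp, by simp, by simp [D.f_zero]⟩
  | append_singleton l a ih =>
    rw [count4_append] at hl
    by_cases ha : a.natAbs = 4
    · refine ⟨l, a, [], by omega, ?_, by simp, by simp [D.w_append, D.w_cons]⟩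
      simp only [count4_cons, ha] at hl
      simp at hl
      omega
    · obtain ⟨p, b, q, hb, hp, hq, e⟩ := ih (by omega)
      refine ⟨p, b, q ++ [a], hb, hp, ?_, ?_⟩
      · simp [count4_append, hq, count4_cons, ha]
      · rw [D.w_append, e, D.w_append]
        simp only [mul_assoc]

theorem f_neg_four : D.f (-4) = (D.T * D.V) • (1 : A) - (D.S * D.V) • D.f 4
    + D.V • (D.f 4 * D.f 4) := by
  have := D.bar.cubic 4 (by norm_num) (by norm_num)
  exact this

/-- The words of length at most one in the fourth generator. -/
def four : Submodule k A := Submodule.span k {1, D.f 4, D.f (-4)}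

theorem four_le : D.four ≤ D.N 1 := by
  refine Submodule.span_le.2 ?_
  have e : ∀ a, D.f a = D.w [a] := fun a => by simp [D.w_cons]
  rintro _ (rfl | rfl | rfl)
  · exact D.w_nil ▸ D.w_mem_N (by simp)
  · rw [e]
    exact D.w_mem_N (by decide)
  · rw [e]
    exact D.w_mem_N (by decide)

theorem f_four_mul_mem {x : A} (hx : x ∈ D.four) : D.f 4 * x ∈ D.four := by
  have h₁ : (1 : A) ∈ D.four := Submodule.subset_span (by simp)
  have h₂ : D.f 4 ∈ D.four := Submodule.subset_span (by simp)
  have h₃ : D.f (-4) ∈ D.four := Submodule.subset_span (by simp)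
  have h : D.f 4 * D.f 4 ∈ D.four := by
    have e := D.f_neg_four
    have : D.f 4 * D.f 4 = D.U • D.f (-4) - (D.U * (D.T * D.V)) • (1 : A)
        + (D.U * (D.S * D.V)) • D.f 4 := by
      rw [e]
      linear_combination (norm := module) -D.UV • (D.f 4 * D.f 4)
    rw [this]
    exact Submodule.add_mem _ (Submodule.sub_mem _ (Submodule.smul_mem _ _ h₃)
      (Submodule.smul_mem _ _ h₁)) (Submodule.smul_mem _ _ h₂)
  induction hx using Submodule.span_induction with
  | mem x hx =>
    rcases hx with rfl | rfl | rfl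
    · rwa [mul_one]
    · exact h
    · rwa [D.f_inv]
  | zero => simp
  | add x y _ _ hx hy =>
    rw [mul_add]
    exact Submodule.add_mem _ hx hy
  | smul r x _ hx =>
    rw [mul_smul_comm]
    exact Submodule.smul_mem _ r hx

theorem f_four_pow_mem (n : ℕ) : D.f 4 ^ n ∈ D.four := by
  induction n with
  | zero => exact Submodule.subset_span (by simp)
  | succ n ih =>
    rw [pow_succ']
    exact D.f_four_mul_mem ih

end CubicSys

/-! ### Identification of the filtration with the spans of words -/

theorem brR_sigma_four : brR (sigma 5 4) = ((var 0 : Rˣ) : R) • cubicSys.f 4 := by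
  rw [brR_eq, braidChar_sigma]
  exact congrArg _ (congrArg nbr (letter_natCast 4 (by norm_num)).symm)

theorem uSub_eq : uSub (var 0) (var 1) (var 2) 5 4 = cubicSys.four := by
  have hs : brR (sigma 5 4) ∈ Algebra.adjoin R {brR (sigma 5 4)} :=
    Algebra.subset_adjoin rfl
  have hf : cubicSys.f 4 ∈ Algebra.adjoin R {brR (sigma 5 4)} := by
    have : cubicSys.f 4 = (((var 0)⁻¹ : Rˣ) : R) • brR (sigma 5 4) := by
      rw [brR_sigma_four, smul_smul, Units.inv_mul, one_smul]
    rw [this]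
    exact Subalgebra.smul_mem _ hs _
  refine le_antisymm ?_ (Submodule.span_le.2 ?_)
  · intro x hx
    have hx' : x ∈ Algebra.adjoin R {brR (sigma 5 4)} := hx
    rw [Algebra.adjoin_singleton_eq_range_aeval] at hx'
    obtain ⟨p, rfl⟩ := hx'
    change Polynomial.aeval (brR (sigma 5 4)) p ∈ _
    rw [Polynomial.aeval_eq_sum_range]
    refine Submodule.sum_mem _ fun i _ => Submodule.smul_mem _ _ ?_
    rw [brR_sigma_four, smul_pow]
    exact Submodule.smul_mem _ _ (cubicSys.f_four_pow_mem i)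
  · rintro _ (rfl | rfl | rfl)
    · exact Subalgebra.one_mem _
    · exact hf
    · rw [cubicSys.f_neg_four]
      exact Subalgebra.add_mem _ (Subalgebra.sub_mem _ (Subalgebra.smul_mem _
        (Subalgebra.one_mem _) _) (Subalgebra.smul_mem _ hf _))
        (Subalgebra.smul_mem _ (Subalgebra.mul_mem _ hf hf) _)

theorem Q5_eq (n : ℕ) : Q5 n = cubicSys.N n := by
  induction n with
  | zero => exact imSub_eq
  | succ n ih =>
    change Q5 n * uSub (var 0) (var 1) (var 2) 5 4 * imSub (var 0) (var 1) (var 2) 4 = _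
    rw [ih, uSub_eq, imSub_eq]
    refine le_antisymm ?_ (Submodule.span_le.2 ?_)
    · refine (mul_le_mul' ((mul_le_mul' le_rfl cubicSys.four_le).trans
        (CubicSys.N_mul_N_le n 1)) le_rfl).trans (CubicSys.N_mul_N_le (n + 1) 0)
    · rintro _ ⟨l, hl, rfl⟩
      obtain ⟨p, b, q, hb, hp, hq, e⟩ := cubicSys.exists_last n l hl
      rw [e, ← mul_assoc]
      refine Submodule.mul_mem_mul (Submodule.mul_mem_mul (cubicSys.w_mem_N hp) ?_)
        (cubicSys.w_mem_N hq.le)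
      refine Submodule.subset_span ?_
      rcases hb with rfl | rfl | rfl
      · simp [cubicSys.f_zero]
      · simp
      · simp

/-! ### The third step of the filtration -/

/-- Isolating the last letter 4^± three times gives p a l₁ b l₂ c q. If one of a, b, c is 0 the word
lies in `N 2`; otherwise `mid_mid_mem` applies, and p and q act trivially. -/
theorem m_mem_K {l : List ℤ} (hl : count4 l ≤ 3) : cubicSys.m l ∈ cubicSys.K := by
  obtain ⟨p₁, c, q₁, hc, hp₁, hq₁, e₁⟩ := cubicSys.exists_last 2 l hl
  obtain ⟨p₂, b, q₂, hb, hp₂, hq₂, e₂⟩ := cubicSys.exists_last 1 p₁ hp₁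
  obtain ⟨p₃, a, q₃, ha, hp₃, hq₃, e₃⟩ := cubicSys.exists_last 0 p₂ hp₂
  obtain ⟨p, hp, e⟩ := exists_mid (Nat.le_zero.1 hp₃)
  obtain ⟨l₁, h₁, f₁⟩ := exists_mid hq₃
  obtain ⟨l₂, h₂, f₂⟩ := exists_mid hq₂
  obtain ⟨q, hq, f₃⟩ := exists_mid hq₁
  have key : cubicSys.m l = cubicSys.m (p ++ ((a :: (l₁ ++ (b :: (l₂ ++ [c])))) ++ q)) := by
    have : cubicSys.w l = cubicSys.w (p ++ ((a :: (l₁ ++ (b :: (l₂ ++ [c])))) ++ q)) := by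
      rw [e₁, e₂, e₃, e, f₁, f₂, f₃]
      simp only [BraidSys.w_append, BraidSys.w_cons, BraidSys.w_nil, mul_one, mul_assoc]
    exact congrArg (cubicSys.N 2).mkQ this
  have zero : (a = 0 ∨ b = 0 ∨ c = 0) → cubicSys.m l ∈ cubicSys.K := by
    intro h
    rw [key]
    refine CubicSys.mem_K_of_zero (CubicSys.m_zero ?_)
    simp only [count4_append, count4_cons, CubicSys.count4_nil, hp.count4, h₁.count4, h₂.count4,
        hq.count4]
    rcases h with rfl | rfl | rfl <;> split_ifs <;> simp_all
  rcases ha with ha | ha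
  · exact zero (Or.inl ha)
  rcases hb with hb | hb
  · exact zero (Or.inr (Or.inl hb))
  rcases hc with hc | hc
  · exact zero (Or.inr (Or.inr hc))
  have h := CubicSys.mid_mid_mem (D := cubicSys) ha hb hc h₁ h₂
  rw [key, CubicSys.ctx_of_mem h hp hq]
  exact h

theorem brR_mem_N {l : List ℤ} {n : ℕ} (hl : count4 l ≤ n) :
    brR (braidWord l) ∈ cubicSys.N n := by
  rw [brR_eq, ← cubicSys_w]
  exact Submodule.smul_mem _ _ (cubicSys.w_mem_N hl)

theorem mkQ_brR (l : List ℤ) : (cubicSys.N 2).mkQ (brR (braidWord l)) =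
    ((braidChar (var 0) 5 (braidWord l) : Rˣ) : R) • cubicSys.m l := by
  rw [brR_eq, ← cubicSys_w, map_smul]
  rfl

/-- Every word which spans the line modulo `N 2` gives a decomposition of `N 3`. -/
theorem N_three_eq {l : List ℤ} (hl : count4 l = 3) {r : R} (hr : IsUnit r)
    (h : cubicSys.m l = r • cubicSys.m [4, 3, -2, 3, 1, -2, 1, 4, 3, -2, 3, 4]) :
    cubicSys.N 3 = cubicSys.N 2 ⊔ Submodule.span R {brR (braidWord l)} := by
  refine le_antisymm (Submodule.span_le.2 ?_) (sup_le (CubicSys.N_mono (by norm_num)) ?_)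
  · rintro _ ⟨l', hl', rfl⟩
    obtain ⟨s, hs⟩ := Submodule.mem_span_singleton.1 (m_mem_K hl')
    obtain ⟨v, hv⟩ := (hr.mul (Units.isUnit (braidChar (var 0) 5 (braidWord l)))).exists_left_inv
    have e : (cubicSys.N 2).mkQ (cubicSys.w l') =
        (cubicSys.N 2).mkQ ((s * v) • brR (braidWord l)) := by
      rw [map_smul, mkQ_brR, h, smul_smul, smul_smul]
      refine hs.symm.trans (congrArg (· • _) ?_)
      linear_combination (-s) * hv
    rw [Submodule.mkQ_apply, Submodule.mkQ_apply, Submodule.Quotient.eq] at e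
    rw [SetLike.mem_coe, ← sub_add_cancel (cubicSys.w l') ((s * v) • brR (braidWord l))]
    exact Submodule.add_mem_sup e (Submodule.smul_mem _ _ (Submodule.mem_span_singleton_self _))
  · rw [Submodule.span_singleton_le_iff_mem]
    exact brR_mem_N hl.le

theorem smul_sub_smul_mem {k M : Type*} [CommRing k] [AddCommGroup M] [Module k M]
    {W : Submodule k M} (r : k) {u v : M} (h : u - v ∈ W) : r • u - r • v ∈ W := by
  rw [← smul_sub]
  exact W.smul_mem r h

/-- `Q_4` acts by the character `ε` on the line. -/
theorem act_brR {l : List ℤ} (hl : count4 l ≤ 3) (r : QR 4) :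
    incl4 r * brR (braidWord l) - eps4 r • brR (braidWord l) ∈ cubicSys.N 2 ∧
      brR (braidWord l) * incl4 r - eps4 r • brR (braidWord l) ∈ cubicSys.N 2 := by
  have ht : (cubicSys.N 2).mkQ (brR (braidWord l)) ∈ cubicSys.K := by
    rw [mkQ_brR]
    exact Submodule.smul_mem _ _ (m_mem_K hl)
  generalize brR (braidWord l) = t at ht ⊢
  have hr : r ∈ Submodule.span R (Set.range (brR : Braid 4 → QR 4)) := by
    rw [span_range_brR]
    trivial
  induction hr using Submodule.span_induction with
  | mem x h =>
    obtain ⟨g, rfl⟩ := h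
    obtain ⟨p, hp, e⟩ := exists_incl4_brR g
    have h₁ : (cubicSys.N 2).mkQ (cubicSys.w p * t * cubicSys.w []) = (cubicSys.N 2).mkQ t := by
      rw [mul_assoc]
      simpa [CubicSys.act, CubicSys.ctx] using
        CubicSys.act_of_mem ht hp (q := []) (by decide)
    have h₂ : (cubicSys.N 2).mkQ (cubicSys.w [] * t * cubicSys.w p) = (cubicSys.N 2).mkQ t :=
      CubicSys.act_of_mem ht (p := []) (by decide) hp
    rw [Submodule.mkQ_apply, Submodule.mkQ_apply, Submodule.Quotient.eq, BraidSys.w_nil] at h₁ h₂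
    rw [mul_one] at h₁
    rw [one_mul] at h₂
    rw [e, smul_mul_assoc, mul_smul_comm]
    exact ⟨smul_sub_smul_mem _ h₁, smul_sub_smul_mem _ h₂⟩
  | zero => simp
  | add x y _ _ hx hy =>
    simp only [map_add, add_mul, mul_add, add_smul, add_sub_add_comm]
    exact ⟨Submodule.add_mem _ hx.1 hy.1, Submodule.add_mem _ hx.2 hy.2⟩
  | smul s x _ hx =>
    simp only [map_smul, smul_mul_assoc, mul_smul_comm, smul_eq_mul, mul_smul]
    exact ⟨smul_sub_smul_mem s hx.1, smul_sub_smul_mem s hx.2⟩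

theorem letter_sigma_neg (i : ℕ) (h : 1 ≤ i ∧ i < 5) : letter (-i) = (sigma 5 i h)⁻¹ := by
  rw [letter_neg, letter_natCast i h]

theorem letter_values : letter 1 = sigma 5 1 ∧ letter 2 = sigma 5 2 ∧ letter 3 = sigma 5 3 ∧
    letter 4 = sigma 5 4 ∧ letter (-1) = (sigma 5 1)⁻¹ ∧ letter (-2) = (sigma 5 2)⁻¹ ∧
    letter (-3) = (sigma 5 3)⁻¹ ∧ letter (-4) = (sigma 5 4)⁻¹ :=
  ⟨letter_natCast 1 _, letter_natCast 2 _, letter_natCast 3 _, letter_natCast 4 _,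
    letter_sigma_neg 1 _, letter_sigma_neg 2 _, letter_sigma_neg 3 _, letter_sigma_neg 4 _⟩

theorem braidWord_z : braidWord [4, 3, -2, 3, 1, -2, 1, 4, 3, -2, 3, 4] = z := by
  obtain ⟨h₁, h₂, h₃, h₄, g₁, g₂, g₃, g₄⟩ := letter_values
  simp [braidWord, z, x, y, mul_assoc, *]

theorem braidWord_zMinus : braidWord [4, -3, -2, 1, -2, -3, 4, -3, -2, 1, -2, -3, 4] = zMinus := by
  obtain ⟨h₁, h₂, h₃, h₄, g₁, g₂, g₃, g₄⟩ := letter_values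
  simp [braidWord, zMinus, wMinus, mul_assoc, *]

theorem braidWord_zPlus : braidWord [-4, 3, 2, -1, 2, 3, -4, 3, 2, -1, 2, 3, -4] = zPlus := by
  obtain ⟨h₁, h₂, h₃, h₄, g₁, g₂, g₃, g₄⟩ := letter_values
  simp [braidWord, zPlus, wPlus, mul_assoc, *]

end CubicQuotient

theorem mainTheorem4 :
    CubicQuotient.Q5 3 =
        CubicQuotient.Q5 2 ⊔
          Submodule.span CubicQuotient.R {CubicQuotient.brR CubicQuotient.z} ∧
      CubicQuotient.Q5 3 =
        CubicQuotient.Q5 2 ⊔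
          Submodule.span CubicQuotient.R {CubicQuotient.brR CubicQuotient.zMinus} ∧
      CubicQuotient.Q5 3 =
        CubicQuotient.Q5 2 ⊔
          Submodule.span CubicQuotient.R {CubicQuotient.brR CubicQuotient.zPlus} ∧
      ∀ t ∈ ({CubicQuotient.z, CubicQuotient.zMinus, CubicQuotient.zPlus} :
          Set (CubicQuotient.Braid 5)),
        ∀ l : CubicQuotient.QR 4,
          CubicQuotient.incl4 l * CubicQuotient.brR t -
              CubicQuotient.eps4 l • CubicQuotient.brR t ∈ CubicQuotient.Q5 2 ∧
            CubicQuotient.brR t * CubicQuotient.incl4 l -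
              CubicQuotient.eps4 l • CubicQuotient.brR t ∈ CubicQuotient.Q5 2 := by
  -- The three elements are, up to units, 1, -V⁵ and -V³ times z, so each spans the third step
  -- modulo the second.
  have hV : IsUnit CubicQuotient.cubicSys.V :=
    IsUnit.of_mul_eq_one _ ((mul_comm _ _).trans CubicQuotient.cubicSys.UV)
  have h₁ := CubicQuotient.CubicSys.zMinus_eq (D := CubicQuotient.cubicSys)
  have h₂ := CubicQuotient.CubicSys.zPlus_eq (D := CubicQuotient.cubicSys)
  rw [← neg_smul] at h₁ h₂
  rw [CubicQuotient.Q5_eq, CubicQuotient.Q5_eq, ← CubicQuotient.braidWord_z,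
    ← CubicQuotient.braidWord_zMinus, ← CubicQuotient.braidWord_zPlus]
  refine ⟨CubicQuotient.N_three_eq (by decide) isUnit_one (one_smul _ _).symm,
    CubicQuotient.N_three_eq (by decide) ((((hV.mul hV).mul hV).mul hV).mul hV).neg h₁,
    CubicQuotient.N_three_eq (by decide) ((hV.mul hV).mul hV).neg h₂, ?_⟩
  rintro t (rfl | rfl | rfl) l <;> exact CubicQuotient.act_brR (by decide) l
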